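/- Let a pure Shimura datum $(\mathbf G,X)$ be as in Deligne: $\mathbf G$ is a connected reductive linear algebraic group over $\mathbb Q$ and $X$ is a $\mathbf G(\mathbb R)$-conjugacy class of homomorphisms $h:\mathbb S=\mathrm{Res}_{\mathbb C/\mathbb R}\mathbb G_{\mathrm m}\to\mathbf G_{\mathbb R}$ of real algebraic groups such that, for $h\in X$, the Hodge structure on $\mathrm{Lie}(\mathbf G_{\mathbb R})$ is of type $\{(-1,1),(0,0),(1,-1)\}$, conjugation by $h(i)$ is a Cartan involution of $\mathbf G^{\mathrm{ad}}_{\mathbb R}$, and $\mathbf G^{\mathrm{ad}}$ has no non-trivial factor over $\mathbb Q$ on which the projection of $h$ is trivial. For $h\in X$ let $\mu_h:\mathbb G_{\mathrm m,\mathbb C}\to\mathbf G_{\mathbb C}$, $\mu_h(z)=h_{\mathbb C}(z,1)$. The reflex field $E(\mathbf G,X)$ is the smallest subfield $E$ of $\mathbb C$ such that $\mathrm{Aut}(\mathbb C/E)$ is the stabilizer in $\mathrm{Aut}(\mathbb C/\mathbb Q)$ of the $\mathbf G(\mathbb C)$-conjugacy class of $\mu_h$. The rank of $\mathbf G$ is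 the common dimension of the maximal $\mathbb Q$-tori in $\mathbf G$. A subdatum of $(\mathbf G,X)$ is a pure Shimura datum $(\mathbf G',X')$ with $\mathbf G'\subset\mathbf G$ a $\mathbb Q$-subgroup and $X'\subset X$ (via composition with the inclusion). (1) There is a function $d:\mathbb N\to\mathbb N$ such that for every $r$ and every pure Shimura datum $(\mathbf G,X)$ with $\mathbf G$ of rank $r$, the reflex field satisfies $[E(\mathbf G,X):\mathbb Q]\le d(r)$. (2) For every pure Shimura datum $(\mathbf G,X)$, with reflex field $E=E(\mathbf G,X)$, there is a constant $c$ such that for every subdatum $(\mathbf G',X')$ of $(\mathbf G,X)$ one has $E\subseteq E(\mathbf G',X')$ and $[E(\mathbf G',X'):E]\le c$. -/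

import Mathlib

open scoped MatrixGroups

namespace ShimuraBound

/-! ### Linear algebraic groups

Over a subfield `k` of `ℂ`, a linear algebraic `k`-group is given through a closed embedding into
some `GL_n` by its group of complex points: a subgroup of `GL_n(ℂ)` which is cut out in `GL_n(ℂ)`
by polynomials in the matrix entries with coefficients in `k`. -/

/-- The common zeros in `GL_n(ℂ)` of a set of polynomials over `k` in the matrix entries. -/
def zeroLocus {k : Type} [Field k] [Algebra k ℂ] {n : ℕ}
    (S : Set (MvPolynomial (Fin n × Fin n) k)) : Set (GL (Fin n) ℂ) :=
  {g | ∀ p ∈ S, MvPolynomial.aeval (fun ij : Fin n × Fin n => (g : Matrix _ _ ℂ) ij.1 ij.2) p = 0}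

/-- `Z ⊆ GL_n(ℂ)` is Zariski closed and defined over `k`. -/
def IsZariskiClosed (k : Type) [Field k] [Algebra k ℂ] {n : ℕ} (Z : Set (GL (Fin n) ℂ)) : Prop :=
  ∃ S : Set (MvPolynomial (Fin n × Fin n) k), Z = zeroLocus S

/-- Connectedness for the (complex) Zariski topology. -/
def IsZariskiConnected {n : ℕ} (G : Subgroup (GL (Fin n) ℂ)) : Prop :=
  ∀ Z₁ Z₂ : Set (GL (Fin n) ℂ), IsZariskiClosed ℂ Z₁ → IsZariskiClosed ℂ Z₂ →
    (G : Set (GL (Fin n) ℂ)) ⊆ Z₁ ∪ Z₂ → Disjoint (G ∩ Z₁ : Set (GL (Fin n) ℂ)) (G ∩ Z₂) →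
    (G : Set (GL (Fin n) ℂ)) ⊆ Z₁ ∨ (G : Set (GL (Fin n) ℂ)) ⊆ Z₂

/-- `N` is a normal subgroup of `G`. -/
def IsNormalIn {n : ℕ} (N G : Subgroup (GL (Fin n) ℂ)) : Prop :=
  N ≤ G ∧ ∀ g ∈ G, ∀ x ∈ N, g * x * g⁻¹ ∈ N

/-- All elements of `U` are unipotent matrices. -/
def IsUnipotent {n : ℕ} (U : Subgroup (GL (Fin n) ℂ)) : Prop :=
  ∀ u ∈ U, IsNilpotent ((u : Matrix (Fin n) (Fin n) ℂ) - 1)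

/-- Connected reductive: the unipotent radical (over `ℂ`) is trivial. -/
def IsReductive {n : ℕ} (G : Subgroup (GL (Fin n) ℂ)) : Prop :=
  IsZariskiConnected G ∧
    ∀ U : Subgroup (GL (Fin n) ℂ), IsZariskiClosed ℂ (U : Set (GL (Fin n) ℂ)) →
      IsZariskiConnected U → IsNormalIn U G → IsUnipotent U → U = ⊥

/-- The centre of `G`, as a subgroup of `GL_n(ℂ)`. -/
def centre {n : ℕ} (G : Subgroup (GL (Fin n) ℂ)) : Subgroup (GL (Fin n) ℂ) :=
  G ⊓ Subgroup.centralizer (G : Set (GL (Fin n) ℂ))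

/-- The Lie algebra of `G` over `ℂ`: the tangent space at `1`, that is, the matrices killed by the
differential at `1` of every polynomial that vanishes on `G`. -/
def lie {n : ℕ} (G : Subgroup (GL (Fin n) ℂ)) : Submodule ℂ (Matrix (Fin n) (Fin n) ℂ) where
  carrier := {A | ∀ p : MvPolynomial (Fin n × Fin n) ℂ, (G : Set (GL (Fin n) ℂ)) ⊆ zeroLocus {p} →
    ∑ ij : Fin n × Fin n,
      MvPolynomial.eval (fun kl : Fin n × Fin n => (1 : Matrix (Fin n) (Fin n) ℂ) kl.1 kl.2)
        (MvPolynomial.pderiv ij p) * A ij.1 ij.2 = 0}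
  add_mem' := by
    intro A B hA hB p hp
    simp only [Matrix.add_apply, mul_add, Finset.sum_add_distrib, hA p hp, hB p hp, add_zero]
  zero_mem' := by
    intro p _
    simp
  smul_mem' := by
    intro c A hA p hp
    have h := hA p hp
    simp only [Matrix.smul_apply, smul_eq_mul]
    calc _ = c * ∑ ij : Fin n × Fin n,
          MvPolynomial.eval (fun kl : Fin n × Fin n => (1 : Matrix (Fin n) (Fin n) ℂ) kl.1 kl.2)
            (MvPolynomial.pderiv ij p) * A ij.1 ij.2 := by
          rw [Finset.mul_sum]
          exact Finset.sum_congr rfl fun ij _ => by ring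
      _ = 0 := by rw [h, mul_zero]

/-- Apply a field endomorphism of `ℂ` to the entries of a matrix. -/
noncomputable abbrev mapGL {n : ℕ} (σ : ℂ →+* ℂ) : GL (Fin n) ℂ →* GL (Fin n) ℂ :=
  Matrix.GeneralLinearGroup.map σ

/-- Complex conjugation on `GL_n(ℂ)`. -/
noncomputable abbrev conjGL {n : ℕ} : GL (Fin n) ℂ →* GL (Fin n) ℂ := mapGL (starRingEnd ℂ)

/-! ### Tori and the rank -/

/-- A homomorphism `(ℂˣ)^d → GL_n(ℂ)` is algebraic: its entries are Laurent polynomials. -/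
def IsAlgebraicHom {d n : ℕ} (f : (Fin d → ℂˣ) →* GL (Fin n) ℂ) : Prop :=
  ∀ i j, ∃ c : (Fin d → ℤ) →₀ ℂ, ∀ t : Fin d → ℂˣ,
    (f t : Matrix (Fin n) (Fin n) ℂ) i j = c.sum fun m a => a * ∏ k, (t k : ℂ) ^ m k

/-- `T ⊆ GL_n` is a `ℚ`-torus of dimension `d`: it is defined over `ℚ`, and over `ℂ` it is
isomorphic to `𝔾_m^d` as an algebraic group. Regular functions on a closed subset of `GL_n` are
polynomials in the entries, divided by a power of the determinant. -/
def IsTorusOfDim {n : ℕ} (T : Subgroup (GL (Fin n) ℂ)) (d : ℕ) : Prop :=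
  IsZariskiClosed ℚ (T : Set (GL (Fin n) ℂ)) ∧
    ∃ e : (Fin d → ℂˣ) ≃* T, IsAlgebraicHom (T.subtype.comp e.toMonoidHom) ∧
      ∀ k : Fin d, ∃ (p : MvPolynomial (Fin n × Fin n) ℂ) (N : ℕ), ∀ g : T,
        ((e.symm g k : ℂˣ) : ℂ) =
          MvPolynomial.eval (fun ij : Fin n × Fin n =>
            ((g : GL (Fin n) ℂ) : Matrix (Fin n) (Fin n) ℂ) ij.1 ij.2) p /
              ((g : GL (Fin n) ℂ) : Matrix (Fin n) (Fin n) ℂ).det ^ N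

/-- `T` is a `ℚ`-torus. -/
def IsTorus {n : ℕ} (T : Subgroup (GL (Fin n) ℂ)) : Prop := ∃ d, IsTorusOfDim T d

/-- `T` is a maximal `ℚ`-torus in `G`. -/
def IsMaximalTorus {n : ℕ} (T G : Subgroup (GL (Fin n) ℂ)) : Prop :=
  IsTorus T ∧ T ≤ G ∧ ∀ T' : Subgroup (GL (Fin n) ℂ), IsTorus T' → T ≤ T' → T' ≤ G → T' = T

/-- `r` is the rank of `G`, the dimension of a maximal `ℚ`-torus in `G`. -/
def HasRank {n : ℕ} (G : Subgroup (GL (Fin n) ℂ)) (r : ℕ) : Prop :=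
  ∃ T, IsMaximalTorus T G ∧ IsTorusOfDim T r

/-! ### Homomorphisms from the Deligne torus

`𝕊 = Res_{ℂ/ℝ} 𝔾_m` has complex points `𝕊(ℂ) = ℂˣ × ℂˣ`, on which complex conjugation acts by
`(z, w) ↦ (w̄, z̄)`; thus `𝕊(ℝ) = ℂˣ`, embedded by `z ↦ (z, z̄)`. -/

/-- Complex conjugation on `ℂˣ`. -/
noncomputable abbrev conjUnit : ℂˣ →* ℂˣ := Units.map (starRingEnd ℂ : ℂ →* ℂ)

/-- `h` is a homomorphism of real algebraic groups `𝕊 → G_ℝ`: an algebraic homomorphism on complex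
points that commutes with complex conjugation. -/
def IsDeligneHom {n : ℕ} (G : Subgroup (GL (Fin n) ℂ))
    (h : (Fin 2 → ℂˣ) →* GL (Fin n) ℂ) : Prop :=
  IsAlgebraicHom h ∧ (∀ t, h t ∈ G) ∧
    ∀ t : Fin 2 → ℂˣ, conjGL (h t) = h ![conjUnit (t 1), conjUnit (t 0)]

/-- The action of `h` on the real points `𝕊(ℝ) = ℂˣ`. -/
noncomputable def onReal {n : ℕ} (h : (Fin 2 → ℂˣ) →* GL (Fin n) ℂ) (z : ℂˣ) : GL (Fin n) ℂ :=
  h ![z, conjUnit z]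

/-- The element `h(i)`. -/
noncomputable def atI {n : ℕ} (h : (Fin 2 → ℂˣ) →* GL (Fin n) ℂ) : GL (Fin n) ℂ :=
  onReal h (Units.mk0 Complex.I Complex.I_ne_zero)

/-- The cocharacter `μ_h : 𝔾_m → G_ℂ`, `μ_h(z) = h_ℂ(z, 1)`. -/
noncomputable def mu {n : ℕ} (h : (Fin 2 → ℂˣ) →* GL (Fin n) ℂ) : ℂˣ →* GL (Fin n) ℂ :=
  h.comp (MonoidHom.mulSingle (fun _ : Fin 2 => ℂˣ) 0)

/-- The conjugate `g f g⁻¹` of a homomorphism. -/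
def conjHom {A B : Type} [Group A] [Group B] (g : B) (f : A →* B) : A →* B :=
  (MulAut.conj g).toMonoidHom.comp f

/-- The part of type `(p, q)` of `Lie(G)` under `Ad ∘ h`, on which `h(z)` acts as
multiplication by `z ^ (-p) * z̄ ^ (-q)`. -/
noncomputable def hodgePart {n : ℕ} (G : Subgroup (GL (Fin n) ℂ))
    (h : (Fin 2 → ℂˣ) →* GL (Fin n) ℂ) (p q : ℤ) : Submodule ℂ (Matrix (Fin n) (Fin n) ℂ) where
  carrier := {A | A ∈ lie G ∧ ∀ z : ℂˣ,
    (onReal h z : Matrix (Fin n) (Fin n) ℂ) * A * ((onReal h z)⁻¹ : GL (Fin n) ℂ) =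
      ((z : ℂ) ^ (-p) * (conjUnit z : ℂ) ^ (-q)) • A}
  add_mem' := by
    rintro A B ⟨hA, hA'⟩ ⟨hB, hB'⟩
    exact ⟨add_mem hA hB, fun z => by rw [mul_add, add_mul, hA', hB', smul_add]⟩
  zero_mem' := ⟨zero_mem _, fun z => by simp⟩
  smul_mem' := by
    rintro c A ⟨hA, hA'⟩
    exact ⟨Submodule.smul_mem _ c hA, fun z => by
      rw [mul_smul_comm, smul_mul_assoc, hA', smul_comm]⟩

/-- The points of the real form of `G^ad = G / Z(G)` given by the complex conjugation
`g ↦ h(i) ḡ h(i)⁻¹`, as a subset of `G^ad(ℂ) = G(ℂ) / Z(G)(ℂ)`. -/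
def twistedRealForm {n : ℕ} (G : Subgroup (GL (Fin n) ℂ))
    (h : (Fin 2 → ℂˣ) →* GL (Fin n) ℂ) : Set (G ⧸ Subgroup.center G) :=
  (fun g : G => (g : G ⧸ Subgroup.center G)) ''
    {g : G | (g : GL (Fin n) ℂ)⁻¹ * (atI h * conjGL (g : GL (Fin n) ℂ) * (atI h)⁻¹) ∈ centre G}

/-! ### Shimura data -/

/-- A pure Shimura datum `(G, X)` in the sense of Deligne, with `G` embedded in `GL_n`. -/
structure ShimuraDatum (n : ℕ) where
  /-- The reductive `ℚ`-group, through its complex points. -/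
  G : Subgroup (GL (Fin n) ℂ)
  isClosed : IsZariskiClosed ℚ (G : Set (GL (Fin n) ℂ))
  isReductive : IsReductive G
  /-- The set of homomorphisms `𝕊 → G_ℝ`. -/
  X : Set ((Fin 2 → ℂˣ) →* GL (Fin n) ℂ)
  isDeligneHom : ∀ h ∈ X, IsDeligneHom G h
  /-- `X` is one conjugacy class under `G(ℝ)`. -/
  isConjClass : ∃ h₀ ∈ X, X = {h | ∃ g ∈ G, conjGL g = g ∧ h = conjHom g h₀}
  /-- The Hodge structure on `Lie(G)` is of type `{(-1, 1), (0, 0), (1, -1)}`. -/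
  hodgeType : ∀ h ∈ X, lie G ≤ hodgePart G h (-1) 1 ⊔ hodgePart G h 0 0 ⊔ hodgePart G h 1 (-1)
  /-- Conjugation by `h(i)` is a Cartan involution of `G^ad` over `ℝ`: the real form it defines
  is compact. -/
  cartan : ∀ h ∈ X, IsCompact (twistedRealForm G h)
  /-- `G^ad` has no nontrivial factor over `ℚ` on which the projection of `h` is trivial: if
  `G^ad = N / Z(G) × M / Z(G)` over `ℚ` and `h` has values in `N`, then `M / Z(G)` is trivial. -/
  noTrivialFactor : ∀ h ∈ X, ∀ N M : Subgroup (GL (Fin n) ℂ),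
    IsZariskiClosed ℚ (N : Set (GL (Fin n) ℂ)) → IsZariskiClosed ℚ (M : Set (GL (Fin n) ℂ)) →
    IsNormalIn N G → IsNormalIn M G → N ⊓ M = centre G → N ⊔ M = G →
    (∀ t, h t ∈ N) → M = centre G

namespace ShimuraDatum

/-- `(G', X')` is a subdatum of `(G, X)`: `G'` is a `ℚ`-subgroup of `G` and `X' ⊆ X`. -/
def IsSubdatum {n : ℕ} (D' D : ShimuraDatum n) : Prop := D'.G ≤ D.G ∧ D'.X ⊆ D.X

/-- The `G(ℂ)`-conjugacy class of the cocharacters `μ_h`, for `h ∈ X`. -/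
def cocharClass {n : ℕ} (D : ShimuraDatum n) : Set (ℂˣ →* GL (Fin n) ℂ) :=
  {ν | ∃ h ∈ D.X, ∃ g ∈ D.G, ν = conjHom g (mu h)}

end ShimuraDatum

/-- The action of `Aut(ℂ/ℚ)` on cocharacters, `(σ ν)(t) = σ(ν(σ⁻¹ t))`. -/
noncomputable def galoisAct {n : ℕ} (σ : ℂ ≃ₐ[ℚ] ℂ) (ν : ℂˣ →* GL (Fin n) ℂ) :
    ℂˣ →* GL (Fin n) ℂ :=
  (mapGL (σ : ℂ →+* ℂ)).comp (ν.comp (Units.map (σ.symm : ℂ →* ℂ)))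

/-- The reflex field `E(G, X) ⊆ ℂ`: the smallest subfield `F` of `ℂ` such that `Aut(ℂ/F)` is the
stabiliser in `Aut(ℂ/ℚ)` of the conjugacy class of the `μ_h`. (If there were no such `F`, then this
would be all of `ℂ`, which is not of finite degree over `ℚ`.) -/
noncomputable def ShimuraDatum.reflexField {n : ℕ} (D : ShimuraDatum n) : IntermediateField ℚ ℂ :=
  sInf {F | ∀ σ : ℂ ≃ₐ[ℚ] ℂ, σ ∈ F.fixingSubgroup ↔ galoisAct σ '' D.cocharClass = D.cocharClass}

end ShimuraBound

/-!
The class of the cocharacters `μ_h` of a Shimura datum `(G, X)` contains a cocharacter of any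
given maximal `ℚ`-torus `T` of `G`. The group `Aut(ℂ/ℚ)` acts on the cocharacters of `T`, a
lattice of rank `d = dim T`, through a finite group whose order is bounded in terms of `d`. Hence
the stabiliser of the class has bounded index and contains a subgroup that is the automorphism
group of a subfield of `ℂ` of finite degree; by Galois theory it is the automorphism group of its
own fixed field, and the degree of the reflex field is at most this index. For a subdatum in
`GL_n`, the dimension of a maximal torus is at most `n²`, which bounds the degrees of all the
reflex fields together; and an automorphism that stabilises the class of the subdatum stabilises
the class of the datum, as this is a single orbit of `G(ℂ)`.

The work is done on Lie algebras. A matrix `A` lies in `lie G` if and only if all `exp(zA)` lie in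
`G` (`mem_lie_iff`), and a cocharacter corresponds to a diagonalisable `A ∈ lie G` with integral
eigenvalues (`cochar_expU`). The cocharacter is moved into `T` in two steps.

* Two diagonalisable elements of `lie G` commute after conjugation of one of them by an element of
  `G(ℂ)` (`exists_Ad_commute`). This comes from the conjugacy of the Engel subalgebras of the
  regular elements: by the inverse function theorem, conjugacy is an open relation, and the set of
  regular elements is connected. It is applied to `A` and a generic element of `lie T`.
* A diagonalisable element of `lie G` that commutes with `lie T` lies in `lie T`
  (`IsMaximalTorus.mem_lie_of_commute`), although `T` is maximal only among the tori over `ℚ`. The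
  elements of `lie G` that commute with `lie T` and are orthogonal to it under the trace form are
  a space that is stable under `Aut(ℂ/ℚ)`, and so spanned by rational matrices. The semisimple
  part of such a rational matrix lies in `lie G` (`diagConj_mem_lie_of_add`) and generates a
  `ℚ`-torus together with `T` (`torusOf`, `isTorus_torusOf`); by maximality it lies in `lie T`, to
  which it is orthogonal, so it vanishes. Thus the space consists of nilpotent matrices.

The bound for the action on the lattice is Minkowski's: the action preserves the positive definite
integral form `tr(A²)`, so it is faithful modulo `3` (`eq_zero_of_isometry`,
`IsTorusOfDim.exists_subgroup`). The Galois theory of `ℂ` over its subfields rests on the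
extension of automorphisms along transcendence bases (`exists_mem_fixingSubgroup_ne`,
`fixingSubgroup_fixedField_of_le`).
-/

namespace ShimuraBound

open scoped Matrix.Norms.Operator

variable {n : ℕ}

/-! ### The exponential map and the Lie algebra -/

/-- The exponential of a complex matrix, as an element of `GL_n(ℂ)`. -/
noncomputable def expGL (A : Matrix (Fin n) (Fin n) ℂ) : GL (Fin n) ℂ :=
  (Matrix.isUnit_exp A).unit

@[simp] lemma coe_expGL (A : Matrix (Fin n) (Fin n) ℂ) :
    (expGL A : Matrix (Fin n) (Fin n) ℂ) = NormedSpace.exp A := rfl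

lemma expGL_add {A B : Matrix (Fin n) (Fin n) ℂ} (h : Commute A B) :
    expGL (A + B) = expGL A * expGL B :=
  Units.ext (Matrix.exp_add_of_commute A B h)

@[simp] lemma expGL_zero : expGL (0 : Matrix (Fin n) (Fin n) ℂ) = 1 :=
  Units.ext NormedSpace.exp_zero

lemma expGL_neg (A : Matrix (Fin n) (Fin n) ℂ) : expGL (-A) = (expGL A)⁻¹ := by
  rw [eq_inv_iff_mul_eq_one, ← expGL_add (Commute.refl A).neg_left, neg_add_cancel, expGL_zero]

/-- Conjugation of a matrix by an element of `GL_n(ℂ)`. -/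
def Ad (g : GL (Fin n) ℂ) (A : Matrix (Fin n) (Fin n) ℂ) : Matrix (Fin n) (Fin n) ℂ :=
  (g : Matrix (Fin n) (Fin n) ℂ) * A * ((g⁻¹ : GL (Fin n) ℂ) : Matrix (Fin n) (Fin n) ℂ)

lemma Ad_mul (g h : GL (Fin n) ℂ) (A : Matrix (Fin n) (Fin n) ℂ) :
    Ad (g * h) A = Ad g (Ad h A) := by
  simp only [Ad, mul_inv_rev, Units.val_mul, mul_assoc]

@[simp] lemma Ad_one (A : Matrix (Fin n) (Fin n) ℂ) : Ad 1 A = A := by simp [Ad]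

lemma Ad_inv_Ad (g : GL (Fin n) ℂ) (A : Matrix (Fin n) (Fin n) ℂ) : Ad g⁻¹ (Ad g A) = A := by
  rw [← Ad_mul, inv_mul_cancel, Ad_one]

lemma Ad_Ad_inv (g : GL (Fin n) ℂ) (A : Matrix (Fin n) (Fin n) ℂ) : Ad g (Ad g⁻¹ A) = A := by
  rw [← Ad_mul, mul_inv_cancel, Ad_one]

lemma Ad_mul_mul (g : GL (Fin n) ℂ) (A B : Matrix (Fin n) (Fin n) ℂ) :
    Ad g (A * B) = Ad g A * Ad g B := by
  simp [Ad, mul_assoc]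

lemma Ad_add (g : GL (Fin n) ℂ) (A B : Matrix (Fin n) (Fin n) ℂ) :
    Ad g (A + B) = Ad g A + Ad g B := by
  simp [Ad, mul_add, add_mul]

lemma Ad_sub (g : GL (Fin n) ℂ) (A B : Matrix (Fin n) (Fin n) ℂ) :
    Ad g (A - B) = Ad g A - Ad g B := by
  simp [Ad, mul_sub, sub_mul]

@[simp] lemma Ad_zero (g : GL (Fin n) ℂ) : Ad g 0 = 0 := by simp [Ad]

lemma Ad_smul (g : GL (Fin n) ℂ) (c : ℂ) (A : Matrix (Fin n) (Fin n) ℂ) :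
    Ad g (c • A) = c • Ad g A := by
  simp [Ad]

lemma expGL_Ad (g : GL (Fin n) ℂ) (A : Matrix (Fin n) (Fin n) ℂ) :
    expGL (Ad g A) = g * expGL A * g⁻¹ :=
  Units.ext (by simpa [Ad] using Matrix.exp_units_conj g A)

lemma hasDerivAt_exp_smul (A : Matrix (Fin n) (Fin n) ℂ) (z : ℂ) :
    HasDerivAt (fun w : ℂ => NormedSpace.exp (w • A)) (NormedSpace.exp (z • A) * A) z :=
  hasDerivAt_exp_smul_const A z

lemma HasDerivAt.matrix_apply {f : ℂ → Matrix (Fin n) (Fin n) ℂ} {f' : Matrix (Fin n) (Fin n) ℂ}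
    {z : ℂ} (h : HasDerivAt f f' z) (i j : Fin n) :
    HasDerivAt (fun w => f w i j) (f' i j) z := by
  have := (LinearMap.toContinuousLinearMap
    (Matrix.entryLinearMap ℂ ℂ i j : Matrix (Fin n) (Fin n) ℂ →ₗ[ℂ] ℂ)).hasFDerivAt.comp_hasDerivAt
      z h
  exact this

/-- A matrix is determined by the one-parameter group that it generates. -/
lemma eq_of_expGL_smul_eq {A B : Matrix (Fin n) (Fin n) ℂ}
    (h : ∀ z : ℂ, expGL (z • A) = expGL (z • B)) : A = B := by
  have hA := hasDerivAt_exp_smul A 0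
  have hB := hasDerivAt_exp_smul B 0
  have : (fun w : ℂ => NormedSpace.exp (w • A)) = fun w : ℂ => NormedSpace.exp (w • B) := by
    funext z
    exact congrArg Units.val (h z)
  rw [this] at hA
  simpa using hA.unique hB

/-- The value of a polynomial in the matrix entries at a matrix. -/
noncomputable def ev (p : MvPolynomial (Fin n × Fin n) ℂ) (A : Matrix (Fin n) (Fin n) ℂ) : ℂ :=
  MvPolynomial.eval (fun ij => A ij.1 ij.2) p

lemma hasDerivAt_ev (p : MvPolynomial (Fin n × Fin n) ℂ) {f : ℂ → Matrix (Fin n) (Fin n) ℂ}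
    {f' : Matrix (Fin n) (Fin n) ℂ} {z : ℂ} (h : HasDerivAt f f' z) :
    HasDerivAt (fun w => ev p (f w)) (∑ ij, ev (MvPolynomial.pderiv ij p) (f z) * f' ij.1 ij.2)
      z := by
  induction p using MvPolynomial.induction_on with
  | C a => simpa [ev] using hasDerivAt_const z a
  | add p q hp hq =>
    simp only [ev, map_add, add_mul, Finset.sum_add_distrib] at hp hq ⊢
    exact hp.add hq
  | mul_X p kl hp =>
    have h1 := hp.mul (HasDerivAt.matrix_apply h kl.1 kl.2)
    simp only [ev, map_mul, MvPolynomial.eval_X] at h1 ⊢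
    refine h1.congr_deriv ?_
    simp only [Derivation.leibniz, MvPolynomial.pderiv_X, smul_eq_mul, map_add, map_mul,
      MvPolynomial.eval_X, add_mul, Finset.sum_add_distrib]
    rw [add_comm, Finset.sum_mul]
    congr 1
    · rw [Finset.sum_eq_single kl]
      · simp
      · intro b _ hb
        simp [hb.symm]
      · simp
    · exact Finset.sum_congr rfl fun _ _ => by ring

lemma mem_zeroLocus_complex {S : Set (MvPolynomial (Fin n × Fin n) ℂ)} {g : GL (Fin n) ℂ} :
    g ∈ zeroLocus S ↔ ∀ p ∈ S, ev p g = 0 := by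
  simp only [zeroLocus, ev, Set.mem_ofPred_eq, MvPolynomial.aeval_eq_eval]

/-- The polynomial `p` in the matrix entries vanishes on `Z`. -/
def Vanishes (p : MvPolynomial (Fin n × Fin n) ℂ) (Z : Set (GL (Fin n) ℂ)) : Prop :=
  ∀ g ∈ Z, ev p (g : Matrix (Fin n) (Fin n) ℂ) = 0

lemma vanishes_iff {p : MvPolynomial (Fin n × Fin n) ℂ} {Z : Set (GL (Fin n) ℂ)} :
    Vanishes p Z ↔ Z ⊆ zeroLocus {p} :=
  ⟨fun h g hg => mem_zeroLocus_complex.2 fun q hq => by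
      rw [Set.mem_singleton_iff.1 hq]; exact h g hg,
    fun h g hg => mem_zeroLocus_complex.1 (h hg) p rfl⟩

lemma IsZariskiClosed.mem_iff {Z : Set (GL (Fin n) ℂ)} (hZ : IsZariskiClosed ℂ Z)
    {g : GL (Fin n) ℂ} : g ∈ Z ↔ ∀ p, Vanishes p Z → ev p (g : Matrix (Fin n) (Fin n) ℂ) = 0 := by
  refine ⟨fun hg p hp => hp g hg, fun h => ?_⟩
  obtain ⟨S, rfl⟩ := hZ
  exact mem_zeroLocus_complex.2 fun p hp => h p fun g hg => mem_zeroLocus_complex.1 hg p hp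

lemma mem_lie_iff_vanishes {G : Subgroup (GL (Fin n) ℂ)} {A : Matrix (Fin n) (Fin n) ℂ} :
    A ∈ lie G ↔ ∀ p, Vanishes p (G : Set (GL (Fin n) ℂ)) →
      ∑ ij, ev (MvPolynomial.pderiv ij p) (1 : Matrix (Fin n) (Fin n) ℂ) * A ij.1 ij.2 = 0 := by
  simp only [vanishes_iff]
  rfl

lemma IsZariskiClosed.complex {k : Type} [Field k] [Algebra k ℂ] {Z : Set (GL (Fin n) ℂ)}
    (hZ : IsZariskiClosed k Z) : IsZariskiClosed ℂ Z := by
  obtain ⟨S, rfl⟩ := hZ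
  refine ⟨MvPolynomial.map (algebraMap k ℂ) '' S, ?_⟩
  ext g
  simp only [zeroLocus, Set.mem_ofPred_eq, Set.forall_mem_image, MvPolynomial.aeval_map_algebraMap]

/-- Left translation of a polynomial function on matrices. -/
noncomputable def leftTranslate (g : Matrix (Fin n) (Fin n) ℂ)
    (p : MvPolynomial (Fin n × Fin n) ℂ) : MvPolynomial (Fin n × Fin n) ℂ :=
  MvPolynomial.bind₁ (fun ij => ∑ k, MvPolynomial.C (g ij.1 k) * MvPolynomial.X (k, ij.2)) p

lemma ev_leftTranslate (g A : Matrix (Fin n) (Fin n) ℂ) (p : MvPolynomial (Fin n × Fin n) ℂ) :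
    ev (leftTranslate g p) A = ev p (g * A) := by
  simp only [ev, leftTranslate, MvPolynomial.eval, MvPolynomial.eval₂Hom_bind₁]
  congr 2
  funext ij
  simp [Matrix.mul_apply]

/-- The left-invariant derivation `p ↦ (x ↦ d/dz p(x(1 + zA)))` of the coordinate ring. -/
noncomputable def invDeriv (A : Matrix (Fin n) (Fin n) ℂ)
    (p : MvPolynomial (Fin n × Fin n) ℂ) : MvPolynomial (Fin n × Fin n) ℂ :=
  ∑ ij : Fin n × Fin n, MvPolynomial.pderiv ij p *
    ∑ k, MvPolynomial.X (ij.1, k) * MvPolynomial.C (A k ij.2)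

lemma ev_invDeriv (A M : Matrix (Fin n) (Fin n) ℂ) (p : MvPolynomial (Fin n × Fin n) ℂ) :
    ev (invDeriv A p) M = ∑ ij, ev (MvPolynomial.pderiv ij p) M * (M * A) ij.1 ij.2 := by
  simp [ev, invDeriv, Matrix.mul_apply]

lemma hasDerivAt_ev_exp (p : MvPolynomial (Fin n × Fin n) ℂ) (A : Matrix (Fin n) (Fin n) ℂ)
    (z : ℂ) : HasDerivAt (fun w : ℂ => ev p (NormedSpace.exp (w • A)))
      (ev (invDeriv A p) (NormedSpace.exp (z • A))) z := by
  rw [ev_invDeriv]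
  exact hasDerivAt_ev p (hasDerivAt_exp_smul A z)

/-- The vanishing ideal of a group is stable under the left-invariant derivations that come from the
tangent space at `1`. -/
lemma Vanishes.invDeriv {G : Subgroup (GL (Fin n) ℂ)} {A : Matrix (Fin n) (Fin n) ℂ}
    (hA : A ∈ lie G) {p : MvPolynomial (Fin n × Fin n) ℂ}
    (hp : Vanishes p (G : Set (GL (Fin n) ℂ))) :
    Vanishes (ShimuraBound.invDeriv A p) (G : Set (GL (Fin n) ℂ)) := by
  intro g hg
  have h1 := mem_lie_iff_vanishes.1 hA (leftTranslate g p) fun x hx => by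
    rw [ev_leftTranslate]
    exact hp (g * x) (G.mul_mem hg hx)
  have hd : HasDerivAt (fun w : ℂ => (1 : Matrix (Fin n) (Fin n) ℂ) + w • A) A 0 :=
    (((hasDerivAt_id (0 : ℂ)).smul_const A).const_add 1).congr_deriv (one_smul ℂ A)
  have hd' : HasDerivAt (fun w : ℂ => (g : Matrix (Fin n) (Fin n) ℂ) * (1 + w • A)) (g * A) 0 :=
    hd.const_mul _
  have h2 := hasDerivAt_ev (leftTranslate g p) hd
  have h3 := hasDerivAt_ev p hd'
  simp only [ev_leftTranslate] at h2
  have h4 := h3.unique h2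
  simp only [zero_smul, add_zero, mul_one] at h4
  rw [ev_invDeriv, h4, h1]

/-- The tangent space at `1` of a closed subgroup consists of the matrices whose one-parameter
group lies in the subgroup. -/
theorem mem_lie_iff {G : Subgroup (GL (Fin n) ℂ)}
    (hG : IsZariskiClosed ℂ (G : Set (GL (Fin n) ℂ))) {A : Matrix (Fin n) (Fin n) ℂ} :
    A ∈ lie G ↔ ∀ z : ℂ, expGL (z • A) ∈ G := by
  constructor
  · intro hA z
    refine hG.mem_iff.2 fun p hp => ?_
    -- All derivatives at `0` of the entire function `z ↦ p(exp(zA))` vanish.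
    have hder : ∀ (k : ℕ) (q : MvPolynomial (Fin n × Fin n) ℂ),
        iteratedDeriv k (fun w : ℂ => ev q (NormedSpace.exp (w • A))) =
          fun w : ℂ => ev ((invDeriv A)^[k] q) (NormedSpace.exp (w • A)) := by
      intro k
      induction k with
      | zero => intro q; simp
      | succ k ih =>
        intro q
        rw [iteratedDeriv_succ', funext fun w => (hasDerivAt_ev_exp q A w).deriv, ih]
        rfl
    have hvan : ∀ k : ℕ, Vanishes ((invDeriv A)^[k] p) (G : Set (GL (Fin n) ℂ)) := by
      intro k
      induction k with
      | zero => exact hp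
      | succ k ih =>
        rw [Function.iterate_succ_apply']
        exact ih.invDeriv hA
    have hT := Complex.taylorSeries_eq_of_entire' (c := 0) (z := z)
      (f := fun w : ℂ => ev p (NormedSpace.exp (w • A)))
      fun w => (hasDerivAt_ev_exp p A w).differentiableAt
    rw [coe_expGL, ← hT]
    convert tsum_zero with k
    rw [hder]
    have := hvan k 1 G.one_mem
    simp only [Units.val_one] at this
    simp [this]
  · intro h
    refine mem_lie_iff_vanishes.2 fun p hp => ?_
    have h1 := hasDerivAt_ev_exp p A 0
    have h2 : (fun w : ℂ => ev p (NormedSpace.exp (w • A))) = fun _ => 0 :=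
      funext fun w => by
        have := hp _ (h w)
        rwa [coe_expGL] at this
    rw [h2] at h1
    have h3 := h1.unique (hasDerivAt_const _ _)
    rw [ev_invDeriv] at h3
    simpa using h3

lemma Ad_mem_lie {G : Subgroup (GL (Fin n) ℂ)}
    (hG : IsZariskiClosed ℂ (G : Set (GL (Fin n) ℂ))) {g : GL (Fin n) ℂ} (hg : g ∈ G)
    {A : Matrix (Fin n) (Fin n) ℂ} (hA : A ∈ lie G) : Ad g A ∈ lie G := by
  rw [mem_lie_iff hG] at hA ⊢
  intro z
  rw [← Ad_smul, expGL_Ad]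
  exact G.mul_mem (G.mul_mem hg (hA z)) (G.inv_mem hg)

lemma expGL_mem {G : Subgroup (GL (Fin n) ℂ)}
    (hG : IsZariskiClosed ℂ (G : Set (GL (Fin n) ℂ))) {A : Matrix (Fin n) (Fin n) ℂ}
    (hA : A ∈ lie G) : expGL A ∈ G := by
  simpa using (mem_lie_iff hG).1 hA 1

/-! ### Conjugacy of diagonalisable elements of the Lie algebra -/

/-- Openness at `(0, X)` of the map `(a, Y) ↦ exp(a) Y exp(-a)`, as soon as its derivative there
is surjective. -/
lemma eventually_exp_conj {𝔸 E F : Type*} [NormedRing 𝔸] [NormedAlgebra ℂ 𝔸]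
    [FiniteDimensional ℂ 𝔸] [NormedAddCommGroup E] [NormedSpace ℂ E] [CompleteSpace E]
    [NormedAddCommGroup F] [NormedSpace ℂ F] [CompleteSpace F]
    (i : E →L[ℂ] 𝔸) (hi : Function.Injective i) (k : F →L[ℂ] 𝔸)
    (hV : ∀ a Y, ∃ v, i v = NormedSpace.exp (i a) * k Y * NormedSpace.exp (-(i a)))
    (X : F) (X₀ : E) (hX : i X₀ = k X)
    (hsurj : ∀ v, ∃ a Y, i v = i a * k X - k X * i a + k Y)
    {p : F → Prop} (hp : ∀ᶠ Y in nhds X, p Y) :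
    ∀ᶠ Z in nhds X₀, ∃ (a : E) (Y : F), p Y ∧
      i Z = NormedSpace.exp (i a) * k Y * NormedSpace.exp (-(i a)) := by
  have : CompleteSpace 𝔸 := FiniteDimensional.complete ℂ 𝔸
  have : FiniteDimensional ℂ E := FiniteDimensional.of_injective i.toLinearMap hi
  obtain ⟨r₀, hr₀⟩ := LinearMap.exists_leftInverse_of_injective i.toLinearMap
    (LinearMap.ker_eq_bot.2 hi)
  obtain ⟨r, hr⟩ : ∃ r : 𝔸 →L[ℂ] E, ∀ C : E, r (i C) = C :=
    ⟨LinearMap.toContinuousLinearMap r₀, fun C => LinearMap.congr_fun hr₀ C⟩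
  let ι : E × F →L[ℂ] 𝔸 := i.comp (ContinuousLinearMap.fst ℂ E F)
  let κ : E × F →L[ℂ] 𝔸 := k.comp (ContinuousLinearMap.snd ℂ E F)
  have he : ∀ L : E × F →L[ℂ] 𝔸, L ((0, X) : E × F) = 0 →
      HasStrictFDerivAt (fun p : E × F => NormedSpace.exp (L p)) L (0, X) := by
    intro L hL
    have h0 : HasStrictFDerivAt (NormedSpace.exp : 𝔸 → 𝔸) (1 : 𝔸 →L[ℂ] 𝔸) (L (0, X)) := by
      rw [hL]
      exact hasStrictFDerivAt_exp_zero
    exact h0.comp (0, X) L.hasStrictFDerivAt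
  have h1 := he ι (by simp [ι])
  have h2 := he (-ι) (by simp [ι])
  have h4 := r.hasStrictFDerivAt.comp ((0, X) : E × F) ((h1.mul' κ.hasStrictFDerivAt).mul' h2)
  have h5 := h4.map_nhds_eq_of_surj (by
    rw [LinearMap.range_eq_top]
    intro v
    obtain ⟨a, Y, hv⟩ := hsurj v
    refine ⟨(a, Y), ?_⟩
    rw [← hr v, hv]
    simp only [ContinuousLinearMap.coe_coe, ContinuousLinearMap.comp_apply]
    congr 1
    simp [ι, κ]
    abel)
  have h6 : r ((((fun p : E × F => NormedSpace.exp (ι p)) * κ *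
      fun p : E × F => NormedSpace.exp ((-ι) p))) (0, X)) = X₀ := by
    rw [← hr X₀, hX]
    simp [ι, κ]
  simp only [h6] at h5
  have h7 : ∀ᶠ q in nhds ((0, X) : E × F), p q.2 := continuous_snd.continuousAt.eventually hp
  rw [← h5]
  filter_upwards [Filter.image_mem_map h7] with Z hZ
  obtain ⟨q, hq, rfl⟩ := hZ
  refine ⟨q.1, q.2, hq, ?_⟩
  obtain ⟨v, hv⟩ := hV q.1 q.2
  have h8 : (((fun p : E × F => NormedSpace.exp (ι p)) * κ *
      fun p : E × F => NormedSpace.exp ((-ι) p))) q = i v := by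
    rw [hv]
    simp [ι, κ]
  exact (congrArg (fun x => i (r x)) h8).trans (by rw [hr, hv])

/-- The commutator is the derivative at `0` of the curve `z ↦ exp(zA) B exp(-zA)` in `lie G`. -/
lemma lie_bracket_mem {G : Subgroup (GL (Fin n) ℂ)}
    (hG : IsZariskiClosed ℂ (G : Set (GL (Fin n) ℂ))) {A B : Matrix (Fin n) (Fin n) ℂ}
    (hA : A ∈ lie G) (hB : B ∈ lie G) : A * B - B * A ∈ lie G := by
  obtain ⟨r, hr⟩ := LinearMap.exists_leftInverse_of_injective (lie G).subtype
    (lie G).ker_subtype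
  have hr' : ∀ C ∈ lie G, ((r C : lie G) : Matrix (Fin n) (Fin n) ℂ) = C := fun C hC =>
    congrArg Subtype.val (LinearMap.congr_fun hr ⟨C, hC⟩)
  have h1 := hasDerivAt_exp_smul A 0
  have h2 := hasDerivAt_exp_smul (-A) 0
  have h3 := (h1.mul_const B).mul h2
  obtain ⟨L, hL⟩ : ∃ L : Matrix (Fin n) (Fin n) ℂ →L[ℂ] Matrix (Fin n) (Fin n) ℂ,
      ∀ C, L C = r C := ⟨LinearMap.toContinuousLinearMap ((lie G).subtype.comp r), fun _ => rfl⟩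
  have h4 := L.hasFDerivAt.comp_hasDerivAt (0 : ℂ) h3
  have h5 : L ∘ ((fun z : ℂ => NormedSpace.exp (z • A) * B) * fun z : ℂ =>
      NormedSpace.exp (z • -A)) =
      ((fun z : ℂ => NormedSpace.exp (z • A) * B) * fun z : ℂ => NormedSpace.exp (z • -A)) := by
    funext z
    have := hr' _ (Ad_mem_lie hG ((mem_lie_iff hG).1 hA z) hB)
    rw [Ad, ← expGL_neg, ← smul_neg, ← hL] at this
    exact this
  rw [h5] at h4
  have h6 := h4.unique h3
  have h7 : A * B - B * A = (r (A * B - B * A) : lie G) := by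
    rw [← hL]
    have h8 := h6.symm
    simp only [zero_smul, NormedSpace.exp_zero, one_mul, mul_one, mul_neg, ← sub_eq_add_neg] at h8
    exact h8
  rw [h7]
  exact Submodule.coe_mem _

/-- The commutator bracket on the Lie algebra of a closed subgroup. -/
instance lieRing (G : Subgroup (GL (Fin n) ℂ))
    [hG : Fact (IsZariskiClosed ℂ (G : Set (GL (Fin n) ℂ)))] : LieRing (lie G) where
  bracket A B := ⟨(A : Matrix (Fin n) (Fin n) ℂ) * B - B * A,
    lie_bracket_mem hG.out A.2 B.2⟩
  add_lie A B C := Subtype.ext (by simp; noncomm_ring)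
  lie_add A B C := Subtype.ext (by simp; noncomm_ring)
  lie_self A := Subtype.ext (sub_self _)
  leibniz_lie A B C := Subtype.ext (by simp; noncomm_ring)

instance lieAlgebra (G : Subgroup (GL (Fin n) ℂ))
    [hG : Fact (IsZariskiClosed ℂ (G : Set (GL (Fin n) ℂ)))] : LieAlgebra ℂ (lie G) where
  lie_smul c A B := Subtype.ext (by
    change (A : Matrix (Fin n) (Fin n) ℂ) * (c • (B : Matrix (Fin n) (Fin n) ℂ)) -
      (c • (B : Matrix (Fin n) (Fin n) ℂ)) * A = c • ((A : Matrix (Fin n) (Fin n) ℂ) * B - B * A)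
    rw [mul_smul_comm, smul_mul_assoc, smul_sub])

section
variable (G : Subgroup (GL (Fin n) ℂ))
    [hG : Fact (IsZariskiClosed ℂ (G : Set (GL (Fin n) ℂ)))]

lemma coe_bracket (A B : lie G) : ((⁅A, B⁆ : lie G) : Matrix (Fin n) (Fin n) ℂ) =
    (A : Matrix (Fin n) (Fin n) ℂ) * B - B * A := rfl

lemma ad_apply_coe (A B : lie G) : (LieAlgebra.ad ℂ (lie G) A B : Matrix (Fin n) (Fin n) ℂ) =
    (A : Matrix (Fin n) (Fin n) ℂ) * B - B * A := rfl

/-- The adjoint action of `G` on its Lie algebra. -/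
def AdLie (g : G) : lie G →ₗ[ℂ] lie G where
  toFun A := ⟨Ad g A, Ad_mem_lie hG.out g.2 A.2⟩
  map_add' _ _ := Subtype.ext (Ad_add _ _ _)
  map_smul' _ _ := Subtype.ext (Ad_smul _ _ _)

lemma coe_AdLie (g : G) (A : lie G) : (AdLie G g A : Matrix (Fin n) (Fin n) ℂ) = Ad g A := rfl

variable {G}

lemma AdLie_mul (g h : G) (A : lie G) : AdLie G (g * h) A = AdLie G g (AdLie G h A) :=
  Subtype.ext (Ad_mul _ _ _)

lemma AdLie_inv_AdLie (g : G) (A : lie G) : AdLie G g⁻¹ (AdLie G g A) = A :=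
  Subtype.ext (Ad_inv_Ad _ _)

lemma AdLie_lie (g : G) (A B : lie G) : AdLie G g ⁅A, B⁆ = ⁅AdLie G g A, AdLie G g B⁆ := by
  apply Subtype.ext
  rw [coe_AdLie, coe_bracket, coe_bracket, coe_AdLie, coe_AdLie, Ad_sub, Ad_mul_mul, Ad_mul_mul]

lemma AdLie_mem_engel (g : G) {A B : lie G} (h : B ∈ LieSubalgebra.engel ℂ A) :
    AdLie G g B ∈ LieSubalgebra.engel ℂ (AdLie G g A) := by
  rw [LieSubalgebra.mem_engel_iff] at h ⊢
  obtain ⟨k, hk⟩ := h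
  refine ⟨k, ?_⟩
  have : ∀ (k : ℕ) (B : lie G), ((LieAlgebra.ad ℂ (lie G) (AdLie G g A)) ^ k) (AdLie G g B) =
      AdLie G g (((LieAlgebra.ad ℂ (lie G) A) ^ k) B) := by
    intro k
    induction k with
    | zero => intro B; rfl
    | succ k ih =>
      intro B
      rw [pow_succ, pow_succ, Module.End.mul_apply, Module.End.mul_apply, LieAlgebra.ad_apply,
        LieAlgebra.ad_apply, ← AdLie_lie, ih]
  rw [this, hk, map_zero]

/-- If `Y` lies in the Engel subalgebra of `X` and is close to `X`, then `ad Y` is still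
invertible modulo that subalgebra. -/
lemma eventually_engel_le (X : lie G) :
    ∀ᶠ Y : (LieSubalgebra.engel ℂ X).toSubmodule in nhds ⟨X, LieSubalgebra.self_mem_engel ℂ X⟩,
      LieSubalgebra.engel ℂ (Y : lie G) ≤ LieSubalgebra.engel ℂ X := by
  set H := (LieSubalgebra.engel ℂ X).toSubmodule with hH
  have hmaps : ∀ Y : H, H ≤ H.comap (LieAlgebra.ad ℂ (lie G) (Y : lie G)) := fun Y v hv =>
    (LieSubalgebra.engel ℂ X).lie_mem Y.2 hv
  let f : H →ₗ[ℂ] Module.End ℂ (lie G ⧸ H) :=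
    { toFun := fun Y => H.mapQ H (LieAlgebra.ad ℂ (lie G) (Y : lie G)) (hmaps Y)
      map_add' := fun Y Z => by
        ext v
        simp
      map_smul' := fun c Y => by
        ext v
        simp }
  have hf : ∀ (Y : H) (v : lie G), f Y (H.mkQ v) = H.mkQ ⁅(Y : lie G), v⁆ := fun Y v => rfl
  have hdet : Continuous fun Y : H => LinearMap.det (f Y) := by
    let b := Module.finBasis ℂ (lie G ⧸ H)
    have h1 : Continuous ((LinearMap.toMatrix b b).toLinearMap.comp f) :=
      LinearMap.continuous_of_finiteDimensional _
    have h2 : (fun Y : H => LinearMap.det (f Y)) =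
        fun Y => (((LinearMap.toMatrix b b).toLinearMap.comp f) Y).det := by
      funext Y
      exact (LinearMap.det_toMatrix b (f Y)).symm
    rw [h2]
    exact h1.matrix_det
  have hX : LinearMap.det (f ⟨X, LieSubalgebra.self_mem_engel ℂ X⟩) ≠ 0 := by
    rw [← isUnit_iff_ne_zero, ← LinearMap.isUnit_iff_isUnit_det, LinearMap.isUnit_iff_ker_eq_bot,
      LinearMap.ker_eq_bot']
    intro v
    obtain ⟨v, rfl⟩ := H.mkQ_surjective v
    rw [hf, Submodule.mkQ_apply, Submodule.mkQ_apply, Submodule.Quotient.mk_eq_zero,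
      Submodule.Quotient.mk_eq_zero]
    intro h
    obtain ⟨k, hk⟩ := (LieSubalgebra.mem_engel_iff _ _ _).1 h
    refine (LieSubalgebra.mem_engel_iff _ _ _).2 ⟨k + 1, ?_⟩
    rwa [pow_succ, Module.End.mul_apply, LieAlgebra.ad_apply]
  filter_upwards [hdet.continuousAt.eventually_ne hX] with Y hY v hv
  replace hY : LinearMap.det (f Y) ≠ 0 := hY
  rw [← isUnit_iff_ne_zero, ← LinearMap.isUnit_iff_isUnit_det] at hY
  obtain ⟨k, hk⟩ := (LieSubalgebra.mem_engel_iff _ _ _).1 hv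
  have hpow : ∀ (k : ℕ) (v : lie G), ((f Y) ^ k) (H.mkQ v) =
      H.mkQ (((LieAlgebra.ad ℂ (lie G) (Y : lie G)) ^ k) v) := by
    intro k
    induction k with
    | zero => intro v; rfl
    | succ k ih =>
      intro v
      rw [pow_succ, pow_succ, Module.End.mul_apply, Module.End.mul_apply, hf, ih]
      rfl
  have h1 := hpow k v
  rw [hk, map_zero] at h1
  have h2 := LinearMap.ker_eq_bot'.1 ((LinearMap.isUnit_iff_ker_eq_bot _).1 (hY.pow k)) _ h1
  exact (Submodule.Quotient.mk_eq_zero H).1 h2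

/-- Every element close to `X` is conjugate to an element of the Engel subalgebra of `X`: the map
`(a, Y) ↦ exp(a) Y exp(-a)` has the derivative `(a, Y) ↦ [a, X] + Y` at `(0, X)`, and `ad X` is
invertible modulo its generalised null space. -/
lemma eventually_conj_engel (X : lie G) :
    ∀ᶠ Z in nhds X, ∃ (g : G) (Y : lie G), Y ∈ LieSubalgebra.engel ℂ X ∧
      LieSubalgebra.engel ℂ Y ≤ LieSubalgebra.engel ℂ X ∧ Z = AdLie G g Y := by
  set H := (LieSubalgebra.engel ℂ X).toSubmodule with hH
  let X' : H := ⟨X, LieSubalgebra.self_mem_engel ℂ X⟩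
  have hsurj : ∀ v : lie G, ∃ a Y : lie G, Y ∈ H ∧
      (v : Matrix (Fin n) (Fin n) ℂ) = (a : Matrix (Fin n) (Fin n) ℂ) * X - X * a + Y := by
    intro v
    have hmaps : H ≤ H.comap (LieAlgebra.ad ℂ (lie G) X) := fun v hv =>
      (LieSubalgebra.engel ℂ X).lie_mem X'.2 hv
    have hinj : Function.Injective (H.mapQ H (LieAlgebra.ad ℂ (lie G) X) hmaps) := by
      rw [← LinearMap.ker_eq_bot, LinearMap.ker_eq_bot']
      intro w
      obtain ⟨w, rfl⟩ := H.mkQ_surjective w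
      rw [Submodule.mkQ_apply, Submodule.mapQ_apply, Submodule.Quotient.mk_eq_zero,
        Submodule.Quotient.mk_eq_zero]
      intro h
      obtain ⟨k, hk⟩ := (LieSubalgebra.mem_engel_iff _ _ _).1 h
      refine (LieSubalgebra.mem_engel_iff _ _ _).2 ⟨k + 1, ?_⟩
      rwa [pow_succ, Module.End.mul_apply]
    obtain ⟨w, hw⟩ := LinearMap.injective_iff_surjective.1 hinj (H.mkQ v)
    obtain ⟨w, rfl⟩ := H.mkQ_surjective w
    rw [Submodule.mkQ_apply, Submodule.mapQ_apply, Submodule.mkQ_apply, eq_comm,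
      Submodule.Quotient.eq] at hw
    refine ⟨-w, _, hw, ?_⟩
    rw [Submodule.coe_sub, ad_apply_coe, Submodule.coe_neg, neg_mul, mul_neg]
    abel
  have hexp : ∀ a Y : lie G, NormedSpace.exp (a : Matrix (Fin n) (Fin n) ℂ) *
      (Y : Matrix (Fin n) (Fin n) ℂ) * NormedSpace.exp (-(a : Matrix (Fin n) (Fin n) ℂ)) =
      Ad (expGL (a : Matrix (Fin n) (Fin n) ℂ)) (Y : Matrix (Fin n) (Fin n) ℂ) := by
    intro a Y
    rw [Ad, ← expGL_neg, coe_expGL, coe_expGL]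
  refine (eventually_exp_conj (lie G).subtypeL Subtype.val_injective
    ((lie G).subtypeL.comp H.subtypeL) (fun a Y => ?_) X' X rfl (fun v => ?_)
    (eventually_engel_le X)).mono fun Z hZ => ?_
  · exact ⟨AdLie G ⟨expGL a, expGL_mem hG.out a.2⟩ Y, (hexp a Y).symm⟩
  · obtain ⟨a, Y, hY, h⟩ := hsurj v
    exact ⟨a, ⟨Y, hY⟩, h⟩
  · obtain ⟨a, Y, hY, hZ⟩ := hZ
    exact ⟨⟨expGL a, expGL_mem hG.out a.2⟩, Y, Y.2, hY, Subtype.ext (hZ.trans (hexp a Y))⟩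

/-- On the complex line through `X` and a regular element all but finitely many elements are
regular. -/
lemma finite_not_isRegular (X Y : lie G) (hY : LieAlgebra.IsRegular ℂ Y) :
    {z : ℂ | ¬ LieAlgebra.IsRegular ℂ (X + z • (Y - X))}.Finite := by
  let b := Module.finBasis ℂ (lie G)
  set p := ((LieAlgebra.ad ℂ (lie G) : lie G →ₗ[ℂ] Module.End ℂ (lie G)).polyCharpoly b).coeff
    (LieAlgebra.rank ℂ (lie G)) with hp
  let q : Polynomial ℂ := MvPolynomial.aeval (fun i => Polynomial.C (b.repr X i) +
    Polynomial.C (b.repr (Y - X) i) * Polynomial.X) p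
  have hq : ∀ z : ℂ, q.eval z = MvPolynomial.eval (b.repr (X + z • (Y - X))) p := by
    intro z
    have h1 : q.eval z = (Polynomial.aeval z) q := by simp [Polynomial.aeval_def]
    rw [h1, ← AlgHom.comp_apply, MvPolynomial.comp_aeval, MvPolynomial.aeval_eq_eval]
    congr 2
    funext i
    simp
    ring
  have hq0 : q ≠ 0 := by
    intro h
    have h1 := hq 1
    rw [h, Polynomial.eval_zero, one_smul, add_sub_cancel] at h1
    exact (LieAlgebra.isRegular_iff_coeff_polyCharpoly_rank_ne_zero ℂ b Y).1 hY h1.symm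
  refine (Polynomial.finite_setOfPred_isRoot hq0).subset fun z hz => ?_
  by_contra h
  refine hz ((LieAlgebra.isRegular_iff_coeff_polyCharpoly_rank_ne_zero ℂ b _).2 ?_)
  rw [← hp, ← hq]
  exact h

/-- The Engel subalgebras of any two regular elements are conjugate under `G`: conjugacy classes
are open in the set of regular elements, which is connected because it meets complex lines in the
complements of finite sets. -/
lemma exists_AdLie_engel {X Y : lie G} (hX : LieAlgebra.IsRegular ℂ X)
    (hY : LieAlgebra.IsRegular ℂ Y) :
    ∃ g : G, ∀ v ∈ LieSubalgebra.engel ℂ X, AdLie G g v ∈ LieSubalgebra.engel ℂ Y := by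
  set S : Set ℂ := {z : ℂ | ¬ LieAlgebra.IsRegular ℂ (X + z • (Y - X))}ᶜ with hS
  have hSc : IsPreconnected S :=
    ((finite_not_isRegular X Y hY).countable.isPathConnected_compl_of_one_lt_rank
      (by rw [Complex.rank_real_complex]; exact Cardinal.one_lt_two)).isConnected.isPreconnected
  have hreg : ∀ z ∈ S, LieAlgebra.IsRegular ℂ (X + z • (Y - X)) := fun z hz => not_not.1 hz
  let P : ℂ → ℂ → Prop := fun z w => ∃ g : G, ∀ v ∈ LieSubalgebra.engel ℂ (X + z • (Y - X)),
    AdLie G g v ∈ LieSubalgebra.engel ℂ (X + w • (Y - X))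
  have key : P 0 1 := by
    refine hSc.induction₂' P (fun z hz => ?_) (fun x y z _ _ _ hxy hyz => ?_) ?_ ?_
    · have hcont : Continuous fun w : ℂ => X + w • (Y - X) := by fun_prop
      have h1 := hcont.continuousAt.eventually (eventually_conj_engel (X + z • (Y - X)))
      filter_upwards [nhdsWithin_le_nhds h1, self_mem_nhdsWithin] with w hw hwS
      obtain ⟨g, T, hT, hle, hw⟩ := hw
      have heq : LieSubalgebra.engel ℂ T = LieSubalgebra.engel ℂ (X + z • (Y - X)) := by
        rw [← LieSubalgebra.toSubmodule_inj]
        refine Submodule.eq_of_le_of_finrank_le hle ?_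
        exact ((LieAlgebra.isRegular_iff_finrank_engel_eq_rank ℂ _).1 (hreg z hz)).trans_le
          (LieAlgebra.rank_le_finrank_engel ℂ T)
      refine ⟨⟨g, fun v hv => ?_⟩, ⟨g⁻¹, fun v hv => ?_⟩⟩
      · rw [hw]
        rw [← heq] at hv
        exact AdLie_mem_engel g hv
      · rw [hw] at hv
        have := AdLie_mem_engel g⁻¹ hv
        rw [AdLie_inv_AdLie] at this
        exact hle this
    · obtain ⟨g, hg⟩ := hxy
      obtain ⟨h, hh⟩ := hyz
      exact ⟨h * g, fun v hv => by rw [AdLie_mul]; exact hh _ (hg _ hv)⟩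
    · exact not_not.2 (by simpa using hX)
    · exact not_not.2 (by simpa using hY)
  simpa [P] using key

/-- Close to `A` there are regular elements, and these are conjugate into the Engel subalgebra of
`A`; so a conjugate of the Engel subalgebra of a regular element lies in that of `A`. If the latter
is the centraliser of `A`, then this conjugate contains `A`. -/
lemma exists_isRegular_AdLie_engel_le (A : lie G)
    (hA : ∀ v ∈ LieSubalgebra.engel ℂ A, ⁅A, v⁆ = 0) :
    ∃ (Z : lie G) (g : G), LieAlgebra.IsRegular ℂ Z ∧
      (∀ v ∈ LieSubalgebra.engel ℂ Z, AdLie G g v ∈ LieSubalgebra.engel ℂ A) ∧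
      AdLie G g⁻¹ A ∈ LieSubalgebra.engel ℂ Z := by
  obtain ⟨Y, hY⟩ := LieAlgebra.exists_isRegular ℂ (lie G)
  have hcont : Continuous fun w : ℂ => A + w • (Y - A) := by fun_prop
  have h1 := (hcont.tendsto' 0 A (by simp)).eventually (eventually_conj_engel A)
  have h2 : ∀ᶠ z in nhdsWithin (0 : ℂ) {0}ᶜ, LieAlgebra.IsRegular ℂ (A + z • (Y - A)) := by
    have h3 := ((finite_not_isRegular A Y hY).subset
      (t := {z : ℂ | ¬ LieAlgebra.IsRegular ℂ (A + z • (Y - A))} \ {0})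
      Set.sdiff_subset).isClosed.isOpen_compl.mem_nhds (x := (0 : ℂ)) (by simp)
    filter_upwards [nhdsWithin_le_nhds h3, self_mem_nhdsWithin] with z hz hz0
    by_contra h
    exact hz ⟨h, hz0⟩
  obtain ⟨z, ⟨g, T, hT, hle, hz⟩, hzreg⟩ :=
    ((h1.filter_mono nhdsWithin_le_nhds).and h2).exists
  refine ⟨_, g⁻¹, hzreg, fun v hv => ?_, ?_⟩
  · rw [hz] at hv
    have := AdLie_mem_engel g⁻¹ hv
    rw [AdLie_inv_AdLie] at this
    exact hle this
  · rw [hz, inv_inv]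
    refine AdLie_mem_engel g ((LieSubalgebra.mem_engel_iff _ _ _).2 ⟨1, ?_⟩)
    rw [pow_one, LieAlgebra.ad_apply, ← lie_skew, hA T hT, neg_zero]

end

/-- The matrix `P diag(v) P⁻¹`, whose eigenvectors are the columns of `P`, with eigenvalues `v`. -/
def diagConj (P : GL (Fin n) ℂ) (v : Fin n → ℂ) : Matrix (Fin n) (Fin n) ℂ :=
  Ad P (Matrix.diagonal v)

/-- The generalised null space of `ad A` is its null space when `A` is diagonalisable. -/
lemma ad_engel_diagConj {G : Subgroup (GL (Fin n) ℂ)}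
    [hG : Fact (IsZariskiClosed ℂ (G : Set (GL (Fin n) ℂ)))] {A : lie G}
    (hA : ∃ P v, (A : Matrix (Fin n) (Fin n) ℂ) = diagConj P v) :
    ∀ B ∈ LieSubalgebra.engel ℂ A, ⁅A, B⁆ = 0 := by
  obtain ⟨P, v, hA⟩ := hA
  have key : ∀ (k : ℕ) (B : lie G) (i j : Fin n),
      (Ad P⁻¹ (((LieAlgebra.ad ℂ (lie G) A) ^ k) B)) i j = (v i - v j) ^ k * (Ad P⁻¹ B) i j := by
    intro k
    induction k with
    | zero => intro B i j; simp
    | succ k ih =>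
      intro B i j
      have h1 : Ad P⁻¹ (LieAlgebra.ad ℂ (lie G) A B) =
          Matrix.diagonal v * Ad P⁻¹ B - Ad P⁻¹ B * Matrix.diagonal v := by
        rw [ad_apply_coe, Ad_sub, Ad_mul_mul, Ad_mul_mul, hA, diagConj, Ad_inv_Ad]
      rw [pow_succ, Module.End.mul_apply, ih, h1, Matrix.sub_apply, Matrix.diagonal_mul,
        Matrix.mul_diagonal]
      ring
  intro B hB
  obtain ⟨k, hk⟩ := (LieSubalgebra.mem_engel_iff _ _ _).1 hB
  have h0 : Ad P⁻¹ (⁅A, B⁆ : lie G) = 0 := by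
    ext i j
    have h1 := key 1 B i j
    have h2 := key k B i j
    rw [hk] at h2
    rw [pow_one, LieAlgebra.ad_apply] at h1
    rw [h1, Matrix.zero_apply]
    have h3 : (v i - v j) ^ k * (Ad P⁻¹ B) i j = 0 := by
      rw [← h2, Submodule.coe_zero, Ad_zero, Matrix.zero_apply]
    rcases mul_eq_zero.1 h3 with h | h
    · rw [eq_zero_of_pow_eq_zero h, pow_one, zero_mul]
    · rw [h, mul_zero]
  apply Subtype.ext
  rw [← Ad_Ad_inv P (⁅A, B⁆ : lie G), h0, Ad_zero, Submodule.coe_zero]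

/-- Both centralisers contain conjugates of the Engel subalgebra of a regular element, and these
Engel subalgebras are conjugate to each other. A conjugate of `A` lies in such a subalgebra, and so
in the centraliser of `B`. -/
theorem exists_AdLie_lie_eq_zero {G : Subgroup (GL (Fin n) ℂ)}
    [hG : Fact (IsZariskiClosed ℂ (G : Set (GL (Fin n) ℂ)))] (A B : lie G)
    (hA : ∃ P v, (A : Matrix (Fin n) (Fin n) ℂ) = diagConj P v)
    (hB : ∃ P v, (B : Matrix (Fin n) (Fin n) ℂ) = diagConj P v) :
    ∃ g : G, ⁅B, AdLie G g A⁆ = 0 := by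
  have hA' := ad_engel_diagConj hA
  have hB' := ad_engel_diagConj hB
  obtain ⟨Z₁, g₁, hZ₁, -, hA₁⟩ := exists_isRegular_AdLie_engel_le A hA'
  obtain ⟨Z₂, g₂, hZ₂, hle, -⟩ := exists_isRegular_AdLie_engel_le B hB'
  obtain ⟨g, hg⟩ := exists_AdLie_engel hZ₁ hZ₂
  have h1 : AdLie G g₂ (AdLie G g (AdLie G g₁⁻¹ A)) ∈ LieSubalgebra.engel ℂ B := hle _ (hg _ hA₁)
  refine ⟨g₂ * (g * g₁⁻¹), ?_⟩
  rw [AdLie_mul, AdLie_mul]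
  exact hB' _ h1

/-- Two diagonalisable elements of the Lie algebra of a closed subgroup commute after conjugation
of one of them by an element of the subgroup. -/
theorem exists_Ad_commute {G : Subgroup (GL (Fin n) ℂ)}
    (hG : IsZariskiClosed ℂ (G : Set (GL (Fin n) ℂ))) {A B : Matrix (Fin n) (Fin n) ℂ}
    (hA : A ∈ lie G) (hB : B ∈ lie G) (hA' : ∃ P v, A = diagConj P v)
    (hB' : ∃ P v, B = diagConj P v) : ∃ g ∈ G, Commute B (Ad g A) := by
  have : Fact (IsZariskiClosed ℂ (G : Set (GL (Fin n) ℂ))) := ⟨hG⟩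
  obtain ⟨g, hg⟩ := exists_AdLie_lie_eq_zero (⟨A, hA⟩ : lie G) ⟨B, hB⟩ hA' hB'
  have h2 := congrArg Subtype.val hg
  rw [coe_bracket, coe_AdLie, Submodule.coe_zero, sub_eq_zero] at h2
  exact ⟨g, g.2, h2⟩

/-! ### Diagonalisation -/

lemma eq_diagConj_iff {A : Matrix (Fin n) (Fin n) ℂ} {P : GL (Fin n) ℂ} {v : Fin n → ℂ} :
    A = diagConj P v ↔ A * P = P * Matrix.diagonal v := by
  rw [diagConj, Ad]
  constructor
  · intro h
    rw [h, mul_assoc, ← Units.val_mul, inv_mul_cancel, Units.val_one, mul_one]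
  · intro h
    rw [← h, mul_assoc, ← Units.val_mul, mul_inv_cancel, Units.val_one, mul_one]

lemma diagConj_add (P : GL (Fin n) ℂ) (v w : Fin n → ℂ) :
    diagConj P (v + w) = diagConj P v + diagConj P w := by
  rw [diagConj, diagConj, diagConj, ← Ad_add, Matrix.diagonal_add]
  rfl

lemma diagConj_sub (P : GL (Fin n) ℂ) (v w : Fin n → ℂ) :
    diagConj P (v - w) = diagConj P v - diagConj P w := by
  rw [diagConj, diagConj, diagConj, ← Ad_sub, Matrix.diagonal_sub]
  rfl

lemma diagConj_smul (P : GL (Fin n) ℂ) (c : ℂ) (v : Fin n → ℂ) :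
    diagConj P (c • v) = c • diagConj P v := by
  rw [diagConj, diagConj, ← Ad_smul, Matrix.diagonal_smul]

lemma diagConj_mul (P : GL (Fin n) ℂ) (v w : Fin n → ℂ) :
    diagConj P v * diagConj P w = diagConj P (v * w) := by
  rw [diagConj, diagConj, diagConj, ← Ad_mul_mul, Matrix.diagonal_mul_diagonal]
  rfl

lemma diagConj_commute (P : GL (Fin n) ℂ) (v w : Fin n → ℂ) :
    Commute (diagConj P v) (diagConj P w) := by
  rw [Commute, SemiconjBy, diagConj_mul, diagConj_mul, mul_comm]

lemma diagConj_injective (P : GL (Fin n) ℂ) : Function.Injective (diagConj P) := by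
  intro v w h
  have := congrArg (Ad P⁻¹) h
  rw [diagConj, diagConj, Ad_inv_Ad, Ad_inv_Ad] at this
  exact Matrix.diagonal_injective this

lemma Ad_diagConj (g P : GL (Fin n) ℂ) (v : Fin n → ℂ) :
    Ad g (diagConj P v) = diagConj (g * P) v := by
  rw [diagConj, diagConj, Ad_mul]

lemma trace_diagConj (P : GL (Fin n) ℂ) (v : Fin n → ℂ) : (diagConj P v).trace = ∑ i, v i := by
  rw [diagConj, Ad, Matrix.trace_mul_comm, ← mul_assoc, ← Units.val_mul, inv_mul_cancel,
    Units.val_one, one_mul, Matrix.trace_diagonal]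

/-- The invertible matrix conjugate by `P` to the diagonal matrix with entries `s`. -/
def diagGL (P : GL (Fin n) ℂ) : (Fin n → ℂˣ) →* GL (Fin n) ℂ :=
  (MulAut.conj P).toMonoidHom.comp
    ((Units.map (Matrix.diagonalRingHom (Fin n) ℂ : (Fin n → ℂ) →* Matrix (Fin n) (Fin n) ℂ)).comp
      (MulEquiv.piUnits.symm : (Fin n → ℂˣ) ≃* (Fin n → ℂ)ˣ).toMonoidHom)

lemma coe_diagGL (P : GL (Fin n) ℂ) (s : Fin n → ℂˣ) :
    (diagGL P s : Matrix (Fin n) (Fin n) ℂ) = diagConj P fun i => (s i : ℂ) := rfl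

lemma diagGL_injective (P : GL (Fin n) ℂ) : Function.Injective (diagGL P) := by
  intro s t h
  have h1 := congrArg Units.val h
  rw [coe_diagGL, coe_diagGL] at h1
  exact funext fun i => Units.ext (congrFun (diagConj_injective P h1) i)

lemma mul_diagGL_mul_inv (g P : GL (Fin n) ℂ) (s : Fin n → ℂˣ) :
    g * diagGL P s * g⁻¹ = diagGL (g * P) s := by
  apply Units.ext
  rw [coe_diagGL, ← Ad_diagConj]
  rfl

/-- The exponential function with values in `ℂˣ`. -/
noncomputable def expU (z : ℂ) : ℂˣ := Units.mk0 (Complex.exp z) (Complex.exp_ne_zero z)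

@[simp] lemma coe_expU (z : ℂ) : (expU z : ℂ) = Complex.exp z := rfl

lemma expU_surjective : Function.Surjective expU := fun t =>
  ⟨Complex.log t, Units.ext (Complex.exp_log t.ne_zero)⟩

lemma expU_zpow (z : ℂ) (m : ℤ) : expU z ^ m = expU (m * z) :=
  Units.ext (by simp [Complex.exp_int_mul])

lemma prod_expU {ι : Type*} (s : Finset ι) (f : ι → ℂ) :
    ∏ i ∈ s, expU (f i) = expU (∑ i ∈ s, f i) :=
  Units.ext (by simp [Complex.exp_sum])

lemma expGL_diagConj (P : GL (Fin n) ℂ) (v : Fin n → ℂ) :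
    expGL (diagConj P v) = diagGL P fun i => expU (v i) := by
  rw [diagConj, expGL_Ad]
  have h : expGL (Matrix.diagonal v) = diagGL 1 fun i => expU (v i) := by
    apply Units.ext
    rw [coe_diagGL, diagConj, Ad_one, coe_expGL, Matrix.exp_diagonal]
    congr 1
    funext i
    rw [Pi.exp_def, coe_expU, Complex.exp_eq_exp_ℂ]
  rw [h, mul_diagGL_mul_inv, mul_one]

/-- If `s` spans `ℂ^n`, then there is an invertible matrix whose columns lie in `s`. -/
lemma exists_GL_col_mem {s : Set (Fin n → ℂ)} (hs : Submodule.span ℂ s = ⊤) :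
    ∃ P : GL (Fin n) ℂ, ∀ j, (fun i => (P : Matrix (Fin n) (Fin n) ℂ) i j) ∈ s := by
  let b := Module.Basis.ofSpan hs.ge
  have hfin := Module.Finite.finite_basis b
  have := Fintype.ofFinite ((linearIndepOn_empty ℂ id).extend (Set.empty_subset s))
  have hcard : Fintype.card ((linearIndepOn_empty ℂ id).extend (Set.empty_subset s)) = n := by
    rw [← Module.finrank_eq_card_basis b, Module.finrank_fin_fun]
  let b' := b.reindex (Fintype.equivFinOfCardEq hcard)
  refine ⟨⟨(Pi.basisFun ℂ (Fin n)).toMatrix b', b'.toMatrix (Pi.basisFun ℂ (Fin n)),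
    Module.Basis.toMatrix_mul_toMatrix_flip _ _, Module.Basis.toMatrix_mul_toMatrix_flip _ _⟩,
    fun j => ?_⟩
  have h1 : (fun i => (Pi.basisFun ℂ (Fin n)).toMatrix b' i j) = b' j := by
    funext i
    simp [Module.Basis.toMatrix_apply]
  have h2 : b' j ∈ Set.range b := ⟨_, (b.reindex_apply _ _).symm⟩
  exact h1 ▸ Module.Basis.ofSpan_subset hs.ge h2

/-- If the columns of `P` are eigenvectors of `A`, then `P` diagonalises `A`. -/
lemma exists_eq_diagConj {A : Matrix (Fin n) (Fin n) ℂ} {P : GL (Fin n) ℂ} {v : Fin n → ℂ}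
    (h : ∀ j, A.mulVec (fun i => (P : Matrix (Fin n) (Fin n) ℂ) i j) =
      v j • fun i => (P : Matrix (Fin n) (Fin n) ℂ) i j) : A = diagConj P v := by
  rw [eq_diagConj_iff]
  ext i j
  have h1 := congrFun (h j) i
  rw [Matrix.mul_diagonal, mul_comm _ (v j)]
  exact h1

/-- A commuting family of matrices, each of which is killed by a squarefree polynomial, can be
diagonalised simultaneously. -/
lemma exists_forall_eq_diagConj {F : Set (Matrix (Fin n) (Fin n) ℂ)}
    (hcomm : ∀ A ∈ F, ∀ B ∈ F, Commute A B)
    (hF : ∀ A ∈ F, ∃ p : Polynomial ℂ, Squarefree p ∧ Polynomial.aeval A p = 0) :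
    ∃ P : GL (Fin n) ℂ, ∀ A ∈ F, ∃ v, A = diagConj P v := by
  let f : F → Module.End ℂ (Fin n → ℂ) := fun A => Matrix.toLinAlgEquiv' A.1
  have hss : ∀ A : F, (f A).IsSemisimple := by
    intro A
    obtain ⟨p, hp, hA⟩ := hF A A.2
    refine Module.End.isSemisimple_of_squarefree_aeval_eq_zero hp ?_
    change Polynomial.aeval (Matrix.toLinAlgEquiv' A.1) p = 0
    exact (Polynomial.aeval_algHom_apply Matrix.toLinAlgEquiv'.toAlgHom A.1 p).trans
      (by rw [hA, map_zero])
  have htop :=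
    Module.End.iSup_iInf_maxGenEigenspace_eq_top_of_iSup_maxGenEigenspace_eq_top_of_commute f
      (fun A B _ => (hcomm A A.2 B B.2).map Matrix.toLinAlgEquiv')
    fun A => Module.End.iSup_maxGenEigenspace_eq_top (f A)
  rw [Submodule.iSup_eq_span] at htop
  obtain ⟨P, hP⟩ := exists_GL_col_mem htop
  choose χ hχ using fun j => Set.mem_iUnion.1 (hP j)
  refine ⟨P, fun A hA => ⟨fun j => χ j ⟨A, hA⟩, exists_eq_diagConj fun j => ?_⟩⟩
  have h1 := (Submodule.mem_iInf _).1 (hχ j) ⟨A, hA⟩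
  rw [(hss ⟨A, hA⟩).isFinitelySemisimple.maxGenEigenspace_eq_eigenspace,
    Module.End.mem_eigenspace_iff] at h1
  exact h1

/-- The value at `t` of the character of `𝔾_m^d` with exponents `m`. -/
def charVal {d : ℕ} (m : Fin d → ℤ) (t : Fin d → ℂˣ) : ℂˣ := ∏ k, t k ^ m k

/-- The characters of `𝔾_m^d`, with values in `ℂ`. -/
def charHom {d : ℕ} (m : Fin d → ℤ) : (Fin d → ℂˣ) →* ℂ where
  toFun t := charVal m t
  map_one' := by simp [charVal]
  map_mul' t s := by simp [charVal, mul_zpow, Finset.prod_mul_distrib]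

lemma charVal_expU {d : ℕ} (m : Fin d → ℤ) (u : Fin d → ℂ) :
    charVal m (fun k => expU (u k)) = expU (∑ k, m k * u k) := by
  simp only [charVal, expU_zpow, prod_expU]

lemma charHom_injective {d : ℕ} : Function.Injective (charHom : (Fin d → ℤ) → _) := by
  intro m m' h
  funext k
  have h1 := DFunLike.congr_fun h (Pi.mulSingle k (Units.mk0 (2 : ℂ) two_ne_zero))
  have h2 : ∀ m : Fin d → ℤ, charVal m (Pi.mulSingle k (Units.mk0 (2 : ℂ) two_ne_zero)) =
      Units.mk0 (2 : ℂ) two_ne_zero ^ m k := by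
    intro m
    rw [charVal, Finset.prod_eq_single k]
    · simp
    · intro b _ hb
      simp [Pi.mulSingle_eq_of_ne hb]
    · simp
  change ((charVal m _ : ℂˣ) : ℂ) = (charVal m' _ : ℂˣ) at h1
  rw [h2, h2, Units.val_zpow_eq_zpow_val, Units.val_zpow_eq_zpow_val, Units.val_mk0] at h1
  have h3 := congrArg norm h1
  rw [norm_zpow, norm_zpow, Complex.norm_ofNat] at h3
  exact zpow_right_injective₀ (by norm_num) (by norm_num) h3

/-- Algebraic homomorphisms from a split torus are diagonalisable. -/
theorem IsAlgebraicHom.exists_eq_diagGL {d : ℕ} {f : (Fin d → ℂˣ) →* GL (Fin n) ℂ}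
    (hf : IsAlgebraicHom f) : ∃ (P : GL (Fin n) ℂ) (χ : Fin n → Fin d → ℤ),
      ∀ t, f t = diagGL P fun i => charVal (χ i) t := by
  choose c hc using hf
  let S : Finset (Fin d → ℤ) := Finset.univ.biUnion fun i => Finset.univ.biUnion fun j =>
    (c i j).support
  let E : (Fin d → ℤ) → Matrix (Fin n) (Fin n) ℂ := fun m => Matrix.of fun i j => c i j m
  have hfE : ∀ t, (f t : Matrix (Fin n) (Fin n) ℂ) = ∑ m ∈ S, charHom m t • E m := by
    intro t
    ext i j
    rw [hc, Finsupp.sum_of_support_subset (s := S), Matrix.sum_apply]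
    · refine Finset.sum_congr rfl fun m _ => ?_
      simp [E, charHom, charVal, mul_comm]
    · intro m hm
      exact Finset.mem_biUnion.2 ⟨i, Finset.mem_univ _, Finset.mem_biUnion.2
        ⟨j, Finset.mem_univ _, hm⟩⟩
    · simp
  have hind : LinearIndependent ℂ fun m : Fin d → ℤ => ((charHom m : _ →* ℂ) : (Fin d → ℂˣ) → ℂ) :=
    (linearIndependent_monoidHom (Fin d → ℂˣ) ℂ).comp _ charHom_injective
  -- Comparing the coefficients of the characters of `t` in `f(ts) = f(s) f(t)`.
  have hE : ∀ s, ∀ m ∈ S, charHom m s • E m = (f s : Matrix (Fin n) (Fin n) ℂ) * E m := by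
    intro s m hm
    ext i j
    have h1 : ∑ m ∈ S, ((charHom m s • E m) i j - ((f s : Matrix (Fin n) (Fin n) ℂ) * E m) i j) •
        ((charHom m : _ →* ℂ) : (Fin d → ℂˣ) → ℂ) = 0 := by
      funext t
      have h2 : (f (s * t) : Matrix (Fin n) (Fin n) ℂ) = f s * f t := by
        rw [map_mul, Units.val_mul]
      rw [hfE, hfE t, Finset.mul_sum] at h2
      have h3 := congrFun (congrFun h2 i) j
      rw [Matrix.sum_apply, Matrix.sum_apply, ← sub_eq_zero, ← Finset.sum_sub_distrib] at h3
      rw [Finset.sum_apply, Pi.zero_apply, ← h3]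
      refine Finset.sum_congr rfl fun m _ => ?_
      simp only [Pi.smul_apply, smul_eq_mul, map_mul, Matrix.smul_apply, mul_smul_comm]
      ring
    exact sub_eq_zero.1 (linearIndependent_iff'.1 hind S _ h1 m hm)
  have hspan : Submodule.span ℂ {x : Fin n → ℂ | ∃ m ∈ S, ∃ j, x = fun i => E m i j} = ⊤ := by
    rw [eq_top_iff, ← (Pi.basisFun ℂ (Fin n)).span_eq, Submodule.span_le]
    rintro _ ⟨j, rfl⟩
    have h1 : (Pi.basisFun ℂ (Fin n)) j = ∑ m ∈ S, fun i => E m i j := by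
      funext i
      have h2 := congrFun (congrFun (hfE 1) i) j
      rw [map_one, Units.val_one, Matrix.sum_apply] at h2
      rw [Finset.sum_apply, Pi.basisFun_apply, Pi.single_apply, ← Matrix.one_apply, h2]
      simp
    rw [h1]
    exact Submodule.sum_mem _ fun m hm => Submodule.subset_span ⟨m, hm, j, rfl⟩
  obtain ⟨P, hP⟩ := exists_GL_col_mem hspan
  choose χ hχ k hk using hP
  refine ⟨P, χ, fun t => Units.ext ?_⟩
  rw [coe_diagGL]
  refine exists_eq_diagConj fun j => ?_
  rw [hk j]
  funext i
  have h1 := congrFun (congrFun (hE t _ (hχ j)) i) (k j)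
  exact h1.symm

/-! ### The Lie algebra of a torus -/

/-- A holomorphic homomorphism from `ℂ` to `ℂˣ` is of the form `z ↦ exp(uz)`. -/
lemma exists_eq_exp_mul {φ : ℂ → ℂ} (hφ : Differentiable ℂ φ) (h0 : φ 0 = 1)
    (hadd : ∀ z w, φ (z + w) = φ z * φ w) : ∃ u : ℂ, ∀ z, φ z = Complex.exp (z * u) := by
  refine ⟨deriv φ 0, fun z => ?_⟩
  have hder : ∀ z, HasDerivAt φ (φ z * deriv φ 0) z := by
    intro z
    have h1 : HasDerivAt (fun w => φ z * φ (w - z)) (φ z * deriv φ 0) z := by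
      have h2 : HasDerivAt φ (deriv φ 0) (z - z) := by
        rw [sub_self]
        exact (hφ 0).hasDerivAt
      simpa using (h2.comp_sub_const z z).const_mul (φ z)
    have h3 : (fun w => φ z * φ (w - z)) = φ := by
      funext w
      rw [← hadd, add_sub_cancel]
    rwa [h3] at h1
  have hder' : ∀ z, HasDerivAt (fun w => φ w * Complex.exp (w * (-deriv φ 0))) 0 z := by
    intro z
    have h1 : HasDerivAt (fun w : ℂ => w * (-deriv φ 0)) (-deriv φ 0) z := by
      simpa using (hasDerivAt_id z).mul_const (-deriv φ 0)
    refine ((hder z).mul h1.cexp).congr_deriv ?_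
    ring
  have hconst := is_const_of_deriv_eq_zero (fun z => (hder' z).differentiableAt)
    (fun z => (hder' z).deriv) z 0
  simp only [h0, zero_mul, Complex.exp_zero, mul_neg, Complex.exp_neg, inv_one, mul_one] at hconst
  exact (mul_inv_eq_one₀ (Complex.exp_ne_zero _)).1 hconst

/-- The element of the Lie algebra of a diagonalised torus with coordinates `u`. Here `P`
diagonalises the torus and the characters that occur have the exponents `χ i`. -/
noncomputable def torusLie {d : ℕ} (P : GL (Fin n) ℂ) (χ : Fin n → Fin d → ℤ) (u : Fin d → ℂ) :
    Matrix (Fin n) (Fin n) ℂ := diagConj P fun i => ∑ k, χ i k * u k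

lemma torusLie_add {d : ℕ} (P : GL (Fin n) ℂ) (χ : Fin n → Fin d → ℤ) (u v : Fin d → ℂ) :
    torusLie P χ (u + v) = torusLie P χ u + torusLie P χ v := by
  rw [torusLie, torusLie, torusLie, ← diagConj_add]
  congr 1
  funext i
  simp [mul_add, Finset.sum_add_distrib]

lemma torusLie_smul {d : ℕ} (P : GL (Fin n) ℂ) (χ : Fin n → Fin d → ℤ) (c : ℂ) (u : Fin d → ℂ) :
    torusLie P χ (c • u) = c • torusLie P χ u := by
  rw [torusLie, torusLie, ← diagConj_smul]
  congr 1
  funext i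
  simp only [Pi.smul_apply, smul_eq_mul, Finset.mul_sum]
  exact Finset.sum_congr rfl fun _ _ => by ring

/-- `torusLie` as a linear map. -/
noncomputable def torusLieHom {d : ℕ} (P : GL (Fin n) ℂ) (χ : Fin n → Fin d → ℤ) :
    (Fin d → ℂ) →ₗ[ℂ] Matrix (Fin n) (Fin n) ℂ where
  toFun := torusLie P χ
  map_add' := torusLie_add P χ
  map_smul' := torusLie_smul P χ

lemma expGL_torusLie {d : ℕ} (P : GL (Fin n) ℂ) (χ : Fin n → Fin d → ℤ) (u : Fin d → ℂ) :
    expGL (torusLie P χ u) = diagGL P fun i => charVal (χ i) fun k => expU (u k) := by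
  rw [torusLie, expGL_diagConj]
  congr 1
  funext i
  rw [charVal_expU]

lemma differentiable_ev_exp (p : MvPolynomial (Fin n × Fin n) ℂ) (A : Matrix (Fin n) (Fin n) ℂ) :
    Differentiable ℂ fun z : ℂ => ev p (NormedSpace.exp (z • A)) :=
  fun z => (hasDerivAt_ev_exp p A z).differentiableAt

lemma exists_ev_eq_det : ∃ p : MvPolynomial (Fin n × Fin n) ℂ,
    ∀ A : Matrix (Fin n) (Fin n) ℂ, ev p A = A.det := by
  refine ⟨(Matrix.mvPolynomialX (Fin n) (Fin n) ℂ).det, fun A => ?_⟩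
  rw [ev, RingHom.map_det]
  congr 1
  ext i j
  simp

/-- A torus is diagonalised by a matrix `P`, its Lie algebra consists of the matrices
`torusLie P χ u`, and the torus is the image of its Lie algebra under the exponential map, with the
integral vectors `u` as the kernel of `u ↦ exp(2πi u)`. -/
theorem IsTorusOfDim.exists_torusLie {T : Subgroup (GL (Fin n) ℂ)} {d : ℕ}
    (hT : IsTorusOfDim T d) : ∃ (P : GL (Fin n) ℂ) (χ : Fin n → Fin d → ℤ),
      (∀ A, A ∈ lie T ↔ ∃ u, A = torusLie P χ u) ∧
      (∀ g ∈ T, ∃ u, g = expGL (torusLie P χ u)) ∧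
      (∀ u, expGL ((2 * Real.pi * Complex.I : ℂ) • torusLie P χ u) = 1 →
        ∃ m : Fin d → ℤ, u = fun k => (m k : ℂ)) := by
  obtain ⟨hcl, e, he, hreg⟩ := hT
  obtain ⟨P, χ, hP⟩ := he.exists_eq_diagGL
  have heP : ∀ t, (e t : GL (Fin n) ℂ) = diagGL P fun i => charVal (χ i) t := hP
  have hexp : ∀ u, expGL (torusLie P χ u) = e fun k => expU (u k) := fun u => by
    rw [expGL_torusLie, heP]
  refine ⟨P, χ, fun A => ⟨fun hA => ?_, ?_⟩, fun g hg => ?_, fun u hu => ?_⟩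
  · have hmem := (mem_lie_iff hcl.complex).1 hA
    -- The coordinates of `exp(zA)` under the isomorphism with `𝔾_m^d` are holomorphic in `z`.
    have hcoord : ∀ k, ∃ u : ℂ, ∀ z : ℂ,
        ((e.symm ⟨expGL (z • A), hmem z⟩ k : ℂˣ) : ℂ) = Complex.exp (z * u) := by
      intro k
      obtain ⟨p, N, hpN⟩ := hreg k
      obtain ⟨q, hq⟩ := exists_ev_eq_det (n := n)
      refine exists_eq_exp_mul ?_ ?_ ?_
      · have h1 : (fun z : ℂ => ((e.symm ⟨expGL (z • A), hmem z⟩ k : ℂˣ) : ℂ)) =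
            fun z : ℂ => ev p (NormedSpace.exp (z • A)) / ev q (NormedSpace.exp (z • A)) ^ N := by
          funext z
          rw [hpN, hq]
          rfl
        rw [h1]
        refine (differentiable_ev_exp p A).div ((differentiable_ev_exp q A).pow N) fun z => ?_
        rw [hq, ← coe_expGL]
        exact pow_ne_zero _ (Matrix.GeneralLinearGroup.det_ne_zero _)
      · have h1 : (⟨expGL ((0 : ℂ) • A), hmem 0⟩ : T) = 1 := Subtype.ext (by simp)
        rw [h1, map_one, Pi.one_apply, Units.val_one]
      · intro z w
        have h1 : (⟨expGL ((z + w) • A), hmem (z + w)⟩ : T) =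
            ⟨expGL (z • A), hmem z⟩ * ⟨expGL (w • A), hmem w⟩ := Subtype.ext (by
          change expGL ((z + w) • A) = expGL (z • A) * expGL (w • A)
          rw [add_smul, expGL_add (((Commute.refl A).smul_left z).smul_right w)])
        rw [h1, map_mul, Pi.mul_apply, Units.val_mul]
    choose u hu using hcoord
    refine ⟨u, eq_of_expGL_smul_eq fun z => ?_⟩
    rw [← torusLie_smul, hexp]
    have h2 : e.symm ⟨expGL (z • A), hmem z⟩ = fun k => expU ((z • u) k) :=
      funext fun k => Units.ext (hu k z)
    rw [← h2, MulEquiv.apply_symm_apply]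
  · rintro ⟨u, rfl⟩
    refine (mem_lie_iff hcl.complex).2 fun z => ?_
    rw [← torusLie_smul, hexp]
    exact (e _).2
  · choose u hu using fun k => expU_surjective (e.symm ⟨g, hg⟩ k)
    refine ⟨u, ?_⟩
    rw [hexp, funext hu, MulEquiv.apply_symm_apply]
  · rw [← torusLie_smul, hexp] at hu
    have h1 := (map_eq_one_iff e e.injective).1 (Subtype.ext hu)
    have h2 : ∀ k, ∃ m : ℤ, u k = m := by
      intro k
      have h3 := congrArg Units.val (congrFun h1 k)
      rw [coe_expU, Pi.one_apply, Units.val_one, Complex.exp_eq_one_iff] at h3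
      obtain ⟨m, hm⟩ := h3
      refine ⟨m, ?_⟩
      rw [Pi.smul_apply, smul_eq_mul, mul_comm] at hm
      exact mul_right_cancel₀ Complex.two_pi_I_ne_zero hm
    choose m hm using h2
    exact ⟨m, funext hm⟩

/-- If `exp(2πi u) = 1` only for integral `u`, then `torusLie` is injective: the multiples of a
vector in the kernel would all be integral. -/
lemma torusLieHom_injective {d : ℕ} {P : GL (Fin n) ℂ} {χ : Fin n → Fin d → ℤ}
    (h : ∀ u, expGL ((2 * Real.pi * Complex.I : ℂ) • torusLie P χ u) = 1 →
      ∃ m : Fin d → ℤ, u = fun k => (m k : ℂ)) : Function.Injective (torusLieHom P χ) := by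
  rw [← LinearMap.ker_eq_bot, LinearMap.ker_eq_bot']
  intro u hu
  by_contra hne
  obtain ⟨k, hk⟩ := Function.ne_iff.1 hne
  have h1 : torusLie P χ ((2 * u k)⁻¹ • u) = 0 := by
    rw [torusLie_smul]
    change _ • torusLieHom P χ u = 0
    rw [hu, smul_zero]
  obtain ⟨m, hm⟩ := h ((2 * u k)⁻¹ • u) (by rw [h1, smul_zero, expGL_zero])
  have h2 := congrFun hm k
  have hk' : u k ≠ 0 := hk
  rw [Pi.smul_apply, smul_eq_mul, mul_inv, mul_assoc, inv_mul_cancel₀ hk', mul_one] at h2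
  have h3 : (1 : ℂ) = ((2 * m k : ℤ) : ℂ) := by
    push_cast
    rw [← h2]
    norm_num
  have h4 : (1 : ℤ) = 2 * m k := by exact_mod_cast h3
  omega

/-! ### Cocharacters -/

/-- The cocharacter of `GL_n` that is diagonalised by `P` and has the weights `m`. -/
def cochar (P : GL (Fin n) ℂ) (m : Fin n → ℤ) : ℂˣ →* GL (Fin n) ℂ where
  toFun t := diagGL P fun i => t ^ m i
  map_one' := by
    simp only [one_zpow]
    exact map_one (diagGL P)
  map_mul' t s := by
    rw [← map_mul]
    simp only [mul_zpow]
    rfl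

lemma cochar_apply (P : GL (Fin n) ℂ) (m : Fin n → ℤ) (t : ℂˣ) :
    cochar P m t = diagGL P fun i => t ^ m i := rfl

lemma cochar_expU (P : GL (Fin n) ℂ) (m : Fin n → ℤ) (z : ℂ) :
    cochar P m (expU z) = expGL (z • diagConj P fun i => (m i : ℂ)) := by
  rw [← diagConj_smul, expGL_diagConj, cochar_apply]
  congr 1
  funext i
  rw [expU_zpow, Pi.smul_apply, smul_eq_mul, mul_comm]

/-- A cocharacter is determined by its derivative. -/
lemma cochar_eq_of_diagConj_eq {P Q : GL (Fin n) ℂ} {m l : Fin n → ℤ}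
    (h : (diagConj P fun i => (m i : ℂ)) = diagConj Q fun i => (l i : ℂ)) :
    cochar P m = cochar Q l := by
  ext1 t
  obtain ⟨z, rfl⟩ := expU_surjective t
  rw [cochar_expU, cochar_expU, h]

lemma conjHom_cochar (g P : GL (Fin n) ℂ) (m : Fin n → ℤ) :
    conjHom g (cochar P m) = cochar (g * P) m := by
  ext1 t
  exact mul_diagGL_mul_inv g P _

/-! ### The action of the automorphisms of the complex numbers on matrices -/

/-- The matrix obtained by applying a field automorphism to the entries. -/
noncomputable def gal (σ : ℂ ≃ₐ[ℚ] ℂ) (A : Matrix (Fin n) (Fin n) ℂ) :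
    Matrix (Fin n) (Fin n) ℂ := A.map σ

lemma gal_apply (σ : ℂ ≃ₐ[ℚ] ℂ) (A : Matrix (Fin n) (Fin n) ℂ) (i j : Fin n) :
    gal σ A i j = σ (A i j) := rfl

lemma coe_mapGL (σ : ℂ ≃ₐ[ℚ] ℂ) (g : GL (Fin n) ℂ) :
    (mapGL (σ : ℂ →+* ℂ) g : Matrix (Fin n) (Fin n) ℂ) = gal σ g := rfl

lemma gal_mul (σ : ℂ ≃ₐ[ℚ] ℂ) (A B : Matrix (Fin n) (Fin n) ℂ) :
    gal σ (A * B) = gal σ A * gal σ B := Matrix.map_mul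

lemma gal_add (σ : ℂ ≃ₐ[ℚ] ℂ) (A B : Matrix (Fin n) (Fin n) ℂ) :
    gal σ (A + B) = gal σ A + gal σ B := Matrix.map_add _ (map_add σ) A B

lemma gal_smul (σ : ℂ ≃ₐ[ℚ] ℂ) (c : ℂ) (A : Matrix (Fin n) (Fin n) ℂ) :
    gal σ (c • A) = σ c • gal σ A := by
  ext i j
  simp [gal_apply]

@[simp] lemma gal_zero (σ : ℂ ≃ₐ[ℚ] ℂ) : gal σ (0 : Matrix (Fin n) (Fin n) ℂ) = 0 := by
  ext i j
  simp [gal_apply]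

lemma gal_comp (σ τ : ℂ ≃ₐ[ℚ] ℂ) (A : Matrix (Fin n) (Fin n) ℂ) :
    gal (σ * τ) A = gal σ (gal τ A) := rfl

@[simp] lemma gal_one (A : Matrix (Fin n) (Fin n) ℂ) : gal 1 A = A := rfl

lemma gal_inv_gal (σ : ℂ ≃ₐ[ℚ] ℂ) (A : Matrix (Fin n) (Fin n) ℂ) : gal σ⁻¹ (gal σ A) = A := by
  rw [← gal_comp, inv_mul_cancel, gal_one]

lemma gal_gal_inv (σ : ℂ ≃ₐ[ℚ] ℂ) (A : Matrix (Fin n) (Fin n) ℂ) : gal σ (gal σ⁻¹ A) = A := by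
  rw [← gal_comp, mul_inv_cancel, gal_one]

lemma trace_gal (σ : ℂ ≃ₐ[ℚ] ℂ) (A : Matrix (Fin n) (Fin n) ℂ) :
    (gal σ A).trace = σ A.trace := by
  simp [Matrix.trace, gal_apply]

lemma gal_diagConj (σ : ℂ ≃ₐ[ℚ] ℂ) (P : GL (Fin n) ℂ) (v : Fin n → ℂ) :
    gal σ (diagConj P v) = diagConj (mapGL (σ : ℂ →+* ℂ) P) fun i => σ (v i) := by
  rw [diagConj, diagConj, Ad, Ad, gal_mul, gal_mul, ← map_inv, coe_mapGL, coe_mapGL]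
  congr 2
  ext i j
  rw [gal_apply, Matrix.diagonal_apply, Matrix.diagonal_apply]
  split_ifs <;> simp

lemma mapGL_diagGL (σ : ℂ ≃ₐ[ℚ] ℂ) (P : GL (Fin n) ℂ) (s : Fin n → ℂˣ) :
    mapGL (σ : ℂ →+* ℂ) (diagGL P s) =
      diagGL (mapGL (σ : ℂ →+* ℂ) P) fun i => Units.map (σ : ℂ →* ℂ) (s i) := by
  apply Units.ext
  rw [coe_mapGL, coe_diagGL, gal_diagConj, coe_diagGL]
  rfl

lemma galoisAct_cochar (σ : ℂ ≃ₐ[ℚ] ℂ) (P : GL (Fin n) ℂ) (m : Fin n → ℤ) :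
    galoisAct σ (cochar P m) = cochar (mapGL (σ : ℂ →+* ℂ) P) m := by
  ext1 t
  change mapGL (σ : ℂ →+* ℂ) (diagGL P fun i => (Units.map (σ.symm : ℂ →* ℂ) t) ^ m i) = _
  rw [mapGL_diagGL, cochar_apply]
  congr 1
  funext i
  apply Units.ext
  simp

lemma galoisAct_conjHom (σ : ℂ ≃ₐ[ℚ] ℂ) (g : GL (Fin n) ℂ) (ν : ℂˣ →* GL (Fin n) ℂ) :
    galoisAct σ (conjHom g ν) = conjHom (mapGL (σ : ℂ →+* ℂ) g) (galoisAct σ ν) := by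
  ext1 t
  change mapGL (σ : ℂ →+* ℂ) (g * _ * g⁻¹) = _
  rw [map_mul, map_mul, map_inv]
  rfl

/-- `μ_h` is a diagonalisable cocharacter with integral weights. -/
lemma exists_mu_eq_cochar {h : (Fin 2 → ℂˣ) →* GL (Fin n) ℂ} (hh : IsAlgebraicHom h) :
    ∃ P m, mu h = cochar P m := by
  obtain ⟨P, χ, hP⟩ := hh.exists_eq_diagGL
  refine ⟨P, fun i => χ i 0, ?_⟩
  ext1 t
  change h (Pi.mulSingle 0 t) = _
  rw [hP, cochar_apply]
  congr 1
  funext i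
  simp [charVal, Fin.prod_univ_two]

/-! ### Automorphisms of the field of complex numbers -/

/-- An automorphism of a polynomial ring generated by a transcendence basis of `ℂ` extends to `ℂ`,
which is an algebraic closure of its field of fractions. -/
lemma exists_ringEquiv_extending {K ι : Type*} [Field K] [Algebra K ℂ] {v : ι → ℂ}
    (hv : IsTranscendenceBasis K v) (φ : MvPolynomial ι K ≃+* MvPolynomial ι K) :
    ∃ σ : ℂ ≃+* ℂ, ∀ p, σ (MvPolynomial.aeval v p) = MvPolynomial.aeval v (φ p) := by
  have := IsAlgClosed.isAlgClosure_of_transcendence_basis v hv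
  let e : MvPolynomial ι K ≃+* Algebra.adjoin K (Set.range v) := hv.1.aevalEquiv.toRingEquiv
  have he : ∀ p, algebraMap (Algebra.adjoin K (Set.range v)) ℂ (e p) = MvPolynomial.aeval v p :=
    fun p => hv.1.algebraMap_aevalEquiv p
  refine ⟨IsAlgClosure.equivOfEquiv ℂ ℂ (e.symm.trans (φ.trans e)), fun p => ?_⟩
  rw [← he, IsAlgClosure.equivOfEquiv_algebraMap, ← he]
  simp

/-- Every subfield of `ℂ` is the fixed field of its group of automorphisms. -/
theorem exists_mem_fixingSubgroup_ne (F : IntermediateField ℚ ℂ) {x : ℂ} (hx : x ∉ F) :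
    ∃ σ ∈ F.fixingSubgroup, σ x ≠ x := by
  suffices h : ∃ σ : ℂ ≃+* ℂ, (∀ y ∈ F, σ y = y) ∧ σ x ≠ x by
    obtain ⟨σ, h1, h2⟩ := h
    exact ⟨AlgEquiv.ofRingEquiv (f := σ) fun q => by simp,
      (IntermediateField.mem_fixingSubgroup_iff _ _).2 h1, h2⟩
  let N := algebraicClosure F ℂ
  have hF : ∀ y (hy : y ∈ F), y = algebraMap N ℂ (algebraMap F N ⟨y, hy⟩) := fun y hy => rfl
  by_cases hxN : x ∈ N
  · -- An automorphism of the algebraic closure of `F` that moves `x` extends to `ℂ`.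
    have hG : IsGalois F N := {}
    have h1 : ¬ ∀ τ : N ≃ₐ[F] N, τ ⟨x, hxN⟩ = ⟨x, hxN⟩ := by
      rw [← InfiniteGalois.mem_bot_iff_fixed, IntermediateField.mem_bot]
      rintro ⟨y, hy⟩
      exact hx (by
        have h2 : (y : ℂ) = x := congrArg Subtype.val hy
        rw [← h2]
        exact y.2)
    push Not at h1
    obtain ⟨τ, hτ⟩ := h1
    obtain ⟨s, hs⟩ := exists_isTranscendenceBasis N ℂ
    obtain ⟨σ, hσ⟩ := exists_ringEquiv_extending hs (MvPolynomial.mapEquiv s τ.toRingEquiv)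
    have hσN : ∀ a : N, σ (algebraMap N ℂ a) = algebraMap N ℂ (τ a) := by
      intro a
      have := hσ (MvPolynomial.C a)
      simpa using this
    refine ⟨σ, fun y hy => ?_, fun h => hτ ?_⟩
    · rw [hF y hy, hσN, τ.commutes]
    · have h2 := hσN ⟨x, hxN⟩
      apply Subtype.ext
      exact h2.symm.trans h
  · -- `x` belongs to a transcendence basis, whose elements can be multiplied by `-1`.
    have hxt : Transcendental N x := by
      have h1 : Transcendental F x := fun h => hxN (mem_algebraicClosure_iff.2 h)
      exact h1.algebraicClosure
    have hind : AlgebraicIndepOn N id ({x} : Set ℂ) :=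
      (algebraicIndependent_unique_type_iff (x := fun y : ({x} : Set ℂ) => (y : ℂ))).2 hxt
    obtain ⟨s, hxs, hs⟩ := exists_isTranscendenceBasis_superset hind
    let φ : MvPolynomial s N →ₐ[N] MvPolynomial s N := MvPolynomial.aeval fun i => -MvPolynomial.X i
    have hφ : φ.comp φ = AlgHom.id N _ := by
      ext i
      simp [φ]
    obtain ⟨σ, hσ⟩ := exists_ringEquiv_extending hs (AlgEquiv.ofAlgHom φ φ hφ hφ).toRingEquiv
    refine ⟨σ, fun y hy => ?_, fun h => ?_⟩
    · have := hσ (MvPolynomial.C (algebraMap F N ⟨y, hy⟩))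
      simpa [φ] using this
    · have h1 := hσ (MvPolynomial.X ⟨x, hxs rfl⟩)
      simp only [MvPolynomial.aeval_X, h] at h1
      have h2 : x = -x := by simpa [φ] using h1
      have h3 : x = 0 := by
        have h4 : (2 : ℂ) * x = 0 := by linear_combination h2
        simpa using h4
      exact hx (h3 ▸ F.zero_mem)

lemma exists_rat_of_forall_eq {x : ℂ} (hx : ∀ σ : ℂ ≃ₐ[ℚ] ℂ, σ x = x) : ∃ q : ℚ, x = q := by
  have h : x ∈ (⊥ : IntermediateField ℚ ℂ) := by
    by_contra h
    obtain ⟨σ, -, hσ⟩ := exists_mem_fixingSubgroup_ne _ h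
    exact hσ (hx σ)
  obtain ⟨q, hq⟩ := IntermediateField.mem_bot.1 h
  exact ⟨q, by rw [← hq]; simp⟩

/-- Finite Galois theory inside `ℂ`: a group of automorphisms that contains the automorphism group
`N` of a subfield, where `N` is normal and of finite index, is the automorphism group of its fixed
field, and the degree of the latter is at most the index of `N`. -/
theorem fixingSubgroup_fixedField_of_le {N H : Subgroup (ℂ ≃ₐ[ℚ] ℂ)} [hN : N.Normal]
    [hfin : N.FiniteIndex] (hclosed : (IntermediateField.fixedField N).fixingSubgroup ≤ N)
    (hNH : N ≤ H) :
    (IntermediateField.fixedField H).fixingSubgroup = H ∧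
      Module.rank ℚ (IntermediateField.fixedField H) ≤ (N.index : Cardinal) := by
  set L := IntermediateField.fixedField N with hL
  have hmem : ∀ x, x ∈ L ↔ ∀ σ ∈ N, σ x = x := fun x => IntermediateField.mem_fixedField_iff _ _
  have hmap : ∀ (σ : ℂ ≃ₐ[ℚ] ℂ) (x : ℂ), x ∈ L → σ x ∈ L := by
    intro σ x hx
    rw [hmem] at hx ⊢
    intro τ hτ
    have h1 := hx (σ⁻¹ * τ * σ) (by simpa using hN.conj_mem τ hτ σ⁻¹)
    have h2 := congrArg σ h1
    rw [AlgEquiv.mul_apply, AlgEquiv.mul_apply, ← AlgEquiv.mul_apply σ, mul_inv_cancel] at h2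
    exact h2
  -- The restriction of automorphisms of `ℂ` to `L`.
  let ρ : (ℂ ≃ₐ[ℚ] ℂ) →* (L ≃ₐ[ℚ] L) :=
    { toFun := fun σ => AlgEquiv.ofAlgHom
        ((σ.toAlgHom.comp L.val).codRestrict L.toSubalgebra fun x => hmap σ x x.2)
        ((σ⁻¹.toAlgHom.comp L.val).codRestrict L.toSubalgebra fun x => hmap σ⁻¹ x x.2)
        (by ext x; exact DFunLike.congr_fun (mul_inv_cancel σ) (x : ℂ))
        (by ext x; exact DFunLike.congr_fun (inv_mul_cancel σ) (x : ℂ))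
      map_one' := rfl
      map_mul' := fun _ _ => rfl }
  have hρ : ∀ (σ : ℂ ≃ₐ[ℚ] ℂ) (x : L), ((ρ σ x : L) : ℂ) = σ x := fun _ _ => rfl
  have hker : N ≤ ρ.ker := fun σ hσ => MonoidHom.mem_ker.2 (AlgEquiv.ext fun x => Subtype.ext
    ((hmem x).1 x.2 σ hσ))
  have hkerfin : ρ.ker.FiniteIndex := Subgroup.finiteIndex_of_le hker
  have hcard : Nat.card ρ.range = ρ.ker.index := (Subgroup.index_ker ρ).symm
  have hrange : Finite ρ.range := Nat.finite_of_card_ne_zero (hcard ▸ hkerfin.index_ne_zero)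
  have hGal : IsGaloisGroup ρ.range ℚ L :=
    { faithful := inferInstance
      commutes := inferInstance
      isInvariant := ⟨fun x hx => by
        obtain ⟨q, hq⟩ := exists_rat_of_forall_eq (x := (x : ℂ)) fun σ =>
          congrArg Subtype.val (hx ⟨ρ σ, σ, rfl⟩)
        exact ⟨q, Subtype.ext (by rw [hq]; simp)⟩⟩ }
  have hfd : FiniteDimensional ℚ L := IsGaloisGroup.finiteDimensional ρ.range ℚ L
  have hrank : Module.finrank ℚ L ≤ N.index := by
    rw [← IsGaloisGroup.card_eq_finrank ρ.range ℚ L, hcard]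
    exact Nat.le_of_dvd (Nat.pos_of_ne_zero hfin.index_ne_zero) (Subgroup.index_dvd_of_le hker)
  have hle : IntermediateField.fixedField H ≤ L := fun x hx => by
    rw [IntermediateField.mem_fixedField_iff] at hx
    exact (hmem x).2 fun σ hσ => hx σ (hNH hσ)
  refine ⟨le_antisymm (fun σ hσ => ?_) ?_, ?_⟩
  · rw [IntermediateField.mem_fixingSubgroup_iff] at hσ
    have h1 : ρ σ ∈ (IntermediateField.fixedField (H.map ρ)).fixingSubgroup := by
      rw [IntermediateField.mem_fixingSubgroup_iff]
      intro x hx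
      rw [IntermediateField.mem_fixedField_iff] at hx
      refine Subtype.ext (hσ x ((IntermediateField.mem_fixedField_iff _ _).2 fun τ hτ => ?_))
      exact congrArg Subtype.val (hx (ρ τ) ⟨τ, hτ, rfl⟩)
    rw [IntermediateField.fixingSubgroup_fixedField] at h1
    obtain ⟨τ, hτ, hτσ⟩ := h1
    have h2 : τ⁻¹ * σ ∈ N := hclosed <|
        (IntermediateField.mem_fixingSubgroup_iff _ _).2 fun x hx => by
      have h3 := congrArg Subtype.val (DFunLike.congr_fun hτσ ⟨x, hx⟩)
      rw [hρ, hρ] at h3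
      rw [AlgEquiv.mul_apply, ← h3, ← AlgEquiv.mul_apply, inv_mul_cancel, AlgEquiv.one_apply]
    have := H.mul_mem hτ (hNH h2)
    rwa [mul_inv_cancel_left] at this
  · exact (IntermediateField.le_iff_le _ _).1 le_rfl
  · refine (LinearMap.rank_le_of_injective (IntermediateField.inclusion hle).toLinearMap
      (IntermediateField.inclusion hle).injective).trans ?_
    rw [← Module.finrank_eq_rank]
    exact_mod_cast hrank

/-! ### Descent to the rational numbers -/

/-- A subspace stable under the automorphisms of `ℂ` contains, with a nonzero vector, a nonzero
rational vector whose support is not larger. -/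
lemma exists_rational_of_stable {ι : Type*} {W : Submodule ℂ (ι →₀ ℂ)}
    (hW : ∀ σ : ℂ ≃ₐ[ℚ] ℂ, ∀ w ∈ W, w.mapRange σ (map_zero σ) ∈ W) (w : ι →₀ ℂ) (hw : w ∈ W)
    (hw0 : w ≠ 0) : ∃ v ∈ W, v ≠ 0 ∧ v.support ⊆ w.support ∧ ∀ i, ∃ q : ℚ, v i = q := by
  classical
  induction hc : w.support.card using Nat.strong_induction_on generalizing w with
  | _ c ih =>
  obtain ⟨i₀, hi₀⟩ := Finsupp.ne_iff.1 hw0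
  rw [Finsupp.zero_apply] at hi₀
  set w' := (w i₀)⁻¹ • w with hw'
  have hw'W : w' ∈ W := W.smul_mem _ hw
  have hsupp : w'.support ⊆ w.support := Finsupp.support_smul
  have hone : w' i₀ = 1 := by simp [hw', hi₀]
  by_cases hrat : ∀ i, ∃ q : ℚ, w' i = q
  · exact ⟨w', hw'W, fun h => by simp [h] at hone, hsupp, hrat⟩
  · push Not at hrat
    obtain ⟨i, hi⟩ := hrat
    have h1 : ¬ ∀ σ : ℂ ≃ₐ[ℚ] ℂ, σ (w' i) = w' i := fun h => by
      obtain ⟨q, hq⟩ := exists_rat_of_forall_eq h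
      exact hi q hq
    push Not at h1
    obtain ⟨σ, hσ⟩ := h1
    set u := w'.mapRange σ (map_zero σ) - w' with hu
    have huW : u ∈ W := W.sub_mem (hW σ w' hw'W) hw'W
    have hu0 : u ≠ 0 := fun h => hσ (by
      have := DFunLike.congr_fun h i
      simpa [hu, sub_eq_zero] using this)
    have hui₀ : u i₀ = 0 := by simp [hu, hone]
    have husub : u.support ⊆ w.support.erase i₀ := by
      intro j hj
      rw [Finsupp.mem_support_iff] at hj
      refine Finset.mem_erase.2 ⟨fun h => hj (h ▸ hui₀), hsupp ?_⟩
      rw [Finsupp.mem_support_iff]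
      intro h
      exact hj (by simp [hu, h])
    have hcard : u.support.card < c := by
      rw [← hc]
      exact (Finset.card_le_card husub).trans_lt
        (Finset.card_erase_lt_of_mem (Finsupp.mem_support_iff.2 hi₀))
    obtain ⟨v, hvW, hv0, hvs, hvr⟩ := ih _ hcard u huW hu0 rfl
    exact ⟨v, hvW, hv0, hvs.trans (husub.trans (Finset.erase_subset _ _)), hvr⟩

/-- A subspace stable under the automorphisms of `ℂ` is spanned by its rational vectors. -/
theorem mem_span_rational_of_stable {ι : Type*} {W : Submodule ℂ (ι →₀ ℂ)}
    (hW : ∀ σ : ℂ ≃ₐ[ℚ] ℂ, ∀ w ∈ W, w.mapRange σ (map_zero σ) ∈ W) (w : ι →₀ ℂ) (hw : w ∈ W) :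
    w ∈ Submodule.span ℂ {v | v ∈ W ∧ ∀ i, ∃ q : ℚ, v i = q} := by
  classical
  induction hc : w.support.card using Nat.strong_induction_on generalizing w with
  | _ c ih =>
  by_cases hw0 : w = 0
  · rw [hw0]
    exact zero_mem _
  obtain ⟨v, hvW, hv0, hvs, hvr⟩ := exists_rational_of_stable hW w hw hw0
  obtain ⟨i, hi⟩ := Finsupp.ne_iff.1 hv0
  rw [Finsupp.zero_apply] at hi
  have hvS : v ∈ Submodule.span ℂ {v | v ∈ W ∧ ∀ i, ∃ q : ℚ, v i = q} :=
    Submodule.subset_span ⟨hvW, hvr⟩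
  set u := w - (w i / v i) • v with hu
  have hui : u i = 0 := by simp [hu, hi]
  have husub : u.support ⊆ w.support.erase i := by
    intro j hj
    rw [Finsupp.mem_support_iff] at hj
    refine Finset.mem_erase.2 ⟨fun h => hj (h ▸ hui), ?_⟩
    rw [Finsupp.mem_support_iff]
    intro h
    have h2 : v j = 0 := by
      by_contra h3
      exact (Finsupp.mem_support_iff.1 (hvs (Finsupp.mem_support_iff.2 h3))) h
    exact hj (by simp [hu, h, h2])
  have hcard : u.support.card < c := by
    rw [← hc]
    exact (Finset.card_le_card husub).trans_lt
      (Finset.card_erase_lt_of_mem (hvs (Finsupp.mem_support_iff.2 hi)))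
  have h3 := ih _ hcard u (W.sub_mem hw (W.smul_mem _ hvW)) rfl
  have h4 : w = u + (w i / v i) • v := by rw [hu, sub_add_cancel]
  rw [h4]
  exact add_mem h3 (Submodule.smul_mem _ _ hvS)

/-- `mem_span_rational_of_stable` in a space with a chosen basis. -/
lemma mem_span_rational_of_basis {ι V : Type*} [AddCommGroup V] [Module ℂ V]
    (b : Module.Basis ι ℂ V) {W : Submodule ℂ V}
    (hW : ∀ σ : ℂ ≃ₐ[ℚ] ℂ, ∀ w ∈ W, b.repr.symm ((b.repr w).mapRange σ (map_zero σ)) ∈ W)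
    {w : V} (hw : w ∈ W) :
    w ∈ Submodule.span ℂ {v | v ∈ W ∧ ∀ i, ∃ q : ℚ, b.repr v i = q} := by
  have h1 := mem_span_rational_of_stable (W := W.comap b.repr.symm.toLinearMap)
    (fun σ v hv => by simpa using hW σ _ hv) (b.repr w) (by simpa using hw)
  have h2 := Submodule.mem_map_of_mem (f := b.repr.symm.toLinearMap) h1
  rw [Submodule.map_span] at h2
  have h3 : b.repr.symm.toLinearMap (b.repr w) = w := by simp
  rw [h3] at h2
  refine Submodule.span_mono ?_ h2
  rintro _ ⟨v, ⟨hv, hv'⟩, rfl⟩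
  exact ⟨hv, fun i => by simpa using hv' i⟩

/-! ### Galois stability and rationality -/

lemma IsZariskiClosed.mapGL_mem {Z : Set (GL (Fin n) ℂ)} (hZ : IsZariskiClosed ℚ Z)
    (σ : ℂ ≃ₐ[ℚ] ℂ) {g : GL (Fin n) ℂ} (hg : g ∈ Z) : mapGL (σ : ℂ →+* ℂ) g ∈ Z := by
  obtain ⟨S, rfl⟩ := hZ
  intro p hp
  have h1 := congrArg σ (hg p hp)
  rw [map_zero] at h1
  rw [← h1]
  exact (MvPolynomial.comp_aeval_apply (φ := σ.toAlgHom) _ p).symm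

lemma ev_map (σ : ℂ ≃ₐ[ℚ] ℂ) (p : MvPolynomial (Fin n × Fin n) ℂ)
    (A : Matrix (Fin n) (Fin n) ℂ) :
    ev (MvPolynomial.map (σ : ℂ →+* ℂ) p) (gal σ A) = σ (ev p A) := by
  rw [ev, MvPolynomial.eval_map]
  exact (MvPolynomial.eval₂_comp (σ : ℂ →+* ℂ) _ p).symm

lemma Vanishes.map {Z Z' : Set (GL (Fin n) ℂ)} {σ : ℂ ≃ₐ[ℚ] ℂ}
    (hZ : ∀ g ∈ Z', mapGL ((σ⁻¹ : ℂ ≃ₐ[ℚ] ℂ) : ℂ →+* ℂ) g ∈ Z)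
    {p : MvPolynomial (Fin n × Fin n) ℂ} (hp : Vanishes p Z) :
    Vanishes (MvPolynomial.map (σ : ℂ →+* ℂ) p) Z' := by
  intro g hg
  rw [← gal_gal_inv σ (g : Matrix (Fin n) (Fin n) ℂ), ev_map, ← coe_mapGL, hp _ (hZ g hg),
    map_zero]

/-- A polynomial with rational coefficients comes from `ℚ`. -/
lemma exists_map_eq_of_rational {ι : Type*} {p : MvPolynomial ι ℂ}
    (hp : ∀ m, ∃ q : ℚ, p.coeff m = q) :
    ∃ p₀ : MvPolynomial ι ℚ, MvPolynomial.map (algebraMap ℚ ℂ) p₀ = p := by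
  choose f hf using hp
  refine ⟨∑ m ∈ p.support, MvPolynomial.monomial m (f m), ?_⟩
  rw [map_sum]
  conv_rhs => rw [p.as_sum]
  refine Finset.sum_congr rfl fun m _ => ?_
  rw [MvPolynomial.map_monomial, hf]
  rfl

/-- A closed set that is stable under the automorphisms of `ℂ` is defined over `ℚ`. -/
theorem IsZariskiClosed.rational {Z : Set (GL (Fin n) ℂ)} (hZ : IsZariskiClosed ℂ Z)
    (hstable : ∀ σ : ℂ ≃ₐ[ℚ] ℂ, ∀ g ∈ Z, mapGL (σ : ℂ →+* ℂ) g ∈ Z) : IsZariskiClosed ℚ Z := by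
  let I : Submodule ℂ (MvPolynomial (Fin n × Fin n) ℂ) :=
    { carrier := {p | Vanishes p Z}
      add_mem' := fun {p q} hp hq g hg => by
        have h1 := hp g hg
        have h2 := hq g hg
        rw [ev] at h1 h2 ⊢
        rw [map_add, h1, h2, add_zero]
      zero_mem' := fun g hg => by rw [ev, map_zero]
      smul_mem' := fun c p hp g hg => by
        have h1 := hp g hg
        rw [ev] at h1 ⊢
        rw [MvPolynomial.smul_eval, h1, mul_zero] }
  have hI : ∀ p, p ∈ I ↔ Vanishes p Z := fun p => Iff.rfl
  have hrepr : ∀ (p : MvPolynomial (Fin n × Fin n) ℂ) m,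
      (MvPolynomial.basisMonomials (Fin n × Fin n) ℂ).repr p m = p.coeff m := fun p m => rfl
  refine ⟨{q | Vanishes (MvPolynomial.map (algebraMap ℚ ℂ) q) Z}, ?_⟩
  ext g
  have hev : ∀ q : MvPolynomial (Fin n × Fin n) ℚ, MvPolynomial.aeval
      (fun ij : Fin n × Fin n => (g : Matrix (Fin n) (Fin n) ℂ) ij.1 ij.2) q =
      ev (MvPolynomial.map (algebraMap ℚ ℂ) q) g := fun q => by
    rw [ev, MvPolynomial.eval_map]
    rfl
  refine ⟨fun hg q hq => (hev q).trans (hq g hg), fun hg => hZ.mem_iff.2 fun p hp => ?_⟩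
  have hspan := mem_span_rational_of_basis (MvPolynomial.basisMonomials (Fin n × Fin n) ℂ)
    (W := I) (fun σ q hq => by
      have h1 := ((hI q).1 hq).map (hstable σ⁻¹)
      have h2 : (MvPolynomial.basisMonomials (Fin n × Fin n) ℂ).repr.symm
          (((MvPolynomial.basisMonomials (Fin n × Fin n) ℂ).repr q).mapRange σ (map_zero σ)) =
          MvPolynomial.map (σ : ℂ →+* ℂ) q := by
        rw [LinearEquiv.symm_apply_eq]
        ext m
        rw [hrepr, MvPolynomial.coeff_map, Finsupp.mapRange_apply, hrepr]
        rfl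
      rw [h2]
      exact h1) ((hI p).2 hp)
  clear hp
  induction hspan using Submodule.span_induction with
  | mem q hq =>
    obtain ⟨q₀, rfl⟩ := exists_map_eq_of_rational fun m => (hrepr q m) ▸ hq.2 m
    rw [← hev]
    exact hg q₀ hq.1
  | zero => rw [ev, map_zero]
  | add q r _ _ h1 h2 =>
    rw [ev] at h1 h2 ⊢
    rw [map_add, h1, h2, add_zero]
  | smul c q _ h1 =>
    rw [ev] at h1 ⊢
    rw [MvPolynomial.smul_eval, h1, mul_zero]

lemma gal_mem_lie_of_mapsTo {G H : Subgroup (GL (Fin n) ℂ)} {σ : ℂ ≃ₐ[ℚ] ℂ}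
    (h : ∀ g ∈ G, mapGL (σ : ℂ →+* ℂ) g ∈ H) {A : Matrix (Fin n) (Fin n) ℂ} (hA : A ∈ lie G) :
    gal σ A ∈ lie H := by
  rw [mem_lie_iff_vanishes] at hA ⊢
  intro p hp
  have h1 := congrArg σ (hA _ (hp.map (σ := σ⁻¹) (by rwa [inv_inv])))
  rw [map_sum, map_zero] at h1
  rw [← h1]
  refine Finset.sum_congr rfl fun ij _ => ?_
  rw [map_mul, ← ev_map, ← MvPolynomial.pderiv_map, MvPolynomial.map_map]
  have h2 : ((σ : ℂ →+* ℂ).comp (σ⁻¹ : ℂ ≃ₐ[ℚ] ℂ) : ℂ →+* ℂ) = RingHom.id ℂ :=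
    RingHom.ext fun x => σ.apply_symm_apply x
  have h3 : gal σ (1 : Matrix (Fin n) (Fin n) ℂ) = 1 :=
    congrArg Units.val (map_one (mapGL (σ : ℂ →+* ℂ)))
  rw [h2, MvPolynomial.map_id, h3]
  rfl

lemma gal_mem_lie {G : Subgroup (GL (Fin n) ℂ)}
    (hG : IsZariskiClosed ℚ (G : Set (GL (Fin n) ℂ))) (σ : ℂ ≃ₐ[ℚ] ℂ)
    {A : Matrix (Fin n) (Fin n) ℂ} (hA : A ∈ lie G) : gal σ A ∈ lie G :=
  gal_mem_lie_of_mapsTo (fun _ hg => hG.mapGL_mem σ hg) hA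

lemma isZariskiClosed_preimage_mapGL (σ : ℂ ≃ₐ[ℚ] ℂ) {Z : Set (GL (Fin n) ℂ)}
    (hZ : IsZariskiClosed ℂ Z) : IsZariskiClosed ℂ (mapGL (σ : ℂ →+* ℂ) ⁻¹' Z) := by
  obtain ⟨S, rfl⟩ := hZ
  refine ⟨MvPolynomial.map ((σ⁻¹ : ℂ ≃ₐ[ℚ] ℂ) : ℂ →+* ℂ) '' S, ?_⟩
  ext g
  have h : ∀ p, ev (MvPolynomial.map ((σ⁻¹ : ℂ ≃ₐ[ℚ] ℂ) : ℂ →+* ℂ) p) g = 0 ↔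
      ev p ((mapGL (σ : ℂ →+* ℂ) g : GL (Fin n) ℂ) : Matrix (Fin n) (Fin n) ℂ) = 0 := by
    intro p
    rw [← gal_inv_gal σ (g : Matrix (Fin n) (Fin n) ℂ), ev_map, map_eq_zero_iff _
      (AlgEquiv.injective _), ← coe_mapGL]
  rw [Set.mem_preimage, mem_zeroLocus_complex, mem_zeroLocus_complex, Set.forall_mem_image]
  exact forall₂_congr fun p _ => (h p).symm

/-- A space of matrices that is stable under the automorphisms of `ℂ` is spanned by rational
matrices. -/
lemma mem_span_rational_matrix {W : Submodule ℂ (Matrix (Fin n) (Fin n) ℂ)}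
    (hW : ∀ σ : ℂ ≃ₐ[ℚ] ℂ, ∀ A ∈ W, gal σ A ∈ W) {A : Matrix (Fin n) (Fin n) ℂ} (hA : A ∈ W) :
    A ∈ Submodule.span ℂ {B | B ∈ W ∧
      ∃ B₀ : Matrix (Fin n) (Fin n) ℚ, B = B₀.map (algebraMap ℚ ℂ)} := by
  have hrepr : ∀ (B : Matrix (Fin n) (Fin n) ℂ) ij,
      (Matrix.stdBasis ℂ (Fin n) (Fin n)).repr B ij = B ij.1 ij.2 := by
    intro B ij
    simp [Matrix.stdBasis, Pi.basis_repr]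
  refine Submodule.span_mono ?_ (mem_span_rational_of_basis (Matrix.stdBasis ℂ (Fin n) (Fin n))
    (fun σ B hB => ?_) hA)
  · rintro B ⟨hB, hB'⟩
    choose f hf using hB'
    refine ⟨hB, Matrix.of fun i j => f (i, j), ?_⟩
    ext i j
    have := hf (i, j)
    rw [hrepr] at this
    simpa using this
  · have h2 : (Matrix.stdBasis ℂ (Fin n) (Fin n)).repr.symm
        (((Matrix.stdBasis ℂ (Fin n) (Fin n)).repr B).mapRange σ (map_zero σ)) = gal σ B := by
      rw [LinearEquiv.symm_apply_eq]
      ext ij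
      rw [hrepr, Finsupp.mapRange_apply, hrepr]
      rfl
    rw [h2]
    exact hW σ B hB

/-! ### The smallest torus whose Lie algebra contains given diagonal matrices -/

lemma charVal_add {d : ℕ} (m l : Fin d → ℤ) (t : Fin d → ℂˣ) :
    charVal (m + l) t = charVal m t * charVal l t := by
  simp [charVal, zpow_add, Finset.prod_mul_distrib]

lemma charVal_smul {d : ℕ} (a : ℤ) (m : Fin d → ℤ) (t : Fin d → ℂˣ) :
    charVal (a • m) t = charVal m t ^ a := by
  simp only [charVal, Pi.smul_apply, smul_eq_mul, ← Finset.prod_zpow, ← zpow_mul]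
  exact Finset.prod_congr rfl fun _ _ => by rw [mul_comm]

lemma charVal_sub {d : ℕ} (m l : Fin d → ℤ) (t : Fin d → ℂˣ) :
    charVal (m - l) t = charVal m t / charVal l t := by
  rw [eq_div_iff_mul_eq', mul_comm, ← charVal_add, add_sub_cancel]

lemma charVal_sum_smul {d e : ℕ} (m : Fin e → ℤ) (α : Fin e → Fin d → ℤ) (t : Fin d → ℂˣ) :
    charVal (∑ i, m i • α i) t = charVal m fun i => charVal (α i) t := by
  have h : ∀ s : Finset (Fin e), charVal (∑ i ∈ s, m i • α i) t =
      ∏ i ∈ s, charVal (α i) t ^ m i := by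
    intro s
    induction s using Finset.induction_on with
    | empty => simp [charVal]
    | insert i s hi ih => rw [Finset.sum_insert hi, Finset.prod_insert hi, charVal_add, ih,
        charVal_smul]
  exact h _

lemma charVal_single {d : ℕ} (k : Fin d) (t : Fin d → ℂˣ) :
    charVal (Pi.single k 1) t = t k := by
  rw [charVal, Finset.prod_eq_single k]
  · simp
  · intro b _ hb
    simp [Pi.single_eq_of_ne hb]
  · simp

lemma charVal_mul {d : ℕ} (m : Fin d → ℤ) (s t : Fin d → ℂˣ) :
    charVal m (s * t) = charVal m s * charVal m t := by
  simp [charVal, mul_zpow, Finset.prod_mul_distrib]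

lemma charVal_inv {d : ℕ} (m : Fin d → ℤ) (s : Fin d → ℂˣ) :
    charVal m s⁻¹ = (charVal m s)⁻¹ := by
  simp [charVal]

lemma charVal_one {d : ℕ} (m : Fin d → ℤ) : charVal m (1 : Fin d → ℂˣ) = 1 := by
  simp [charVal]

/-- The integral linear relations that hold on `W`. -/
def relations (W : Submodule ℂ (Fin n → ℂ)) : Submodule ℤ (Fin n → ℤ) where
  carrier := {m | ∀ v ∈ W, ∑ i, m i * v i = 0}
  add_mem' := fun {m l} hm hl v hv => by
    simp [add_mul, Finset.sum_add_distrib, hm v hv, hl v hv]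
  zero_mem' := fun v hv => by simp
  smul_mem' := fun c m hm v hv => by
    simp [mul_assoc, ← Finset.mul_sum, hm v hv]

lemma mem_relations {W : Submodule ℂ (Fin n → ℂ)} {m : Fin n → ℤ} :
    m ∈ relations W ↔ ∀ v ∈ W, ∑ i, (m i : ℂ) * v i = 0 := Iff.rfl

/-- The group of the matrices `P diag(s) P⁻¹` for which `s` satisfies the multiplicative versions of
all integral linear relations on `W`. -/
def torusOf (P : GL (Fin n) ℂ) (W : Submodule ℂ (Fin n → ℂ)) : Subgroup (GL (Fin n) ℂ) :=
  Subgroup.map (diagGL P)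
    { carrier := {s | ∀ m ∈ relations W, charVal m s = 1}
      mul_mem' := fun {s t} hs ht m hm => by rw [charVal_mul, hs m hm, ht m hm, one_mul]
      one_mem' := fun m _ => charVal_one m
      inv_mem' := fun {s} hs m hm => by rw [charVal_inv, hs m hm, inv_one] }

lemma mem_torusOf {P : GL (Fin n) ℂ} {W : Submodule ℂ (Fin n → ℂ)} {g : GL (Fin n) ℂ} :
    g ∈ torusOf P W ↔ ∃ s, (∀ m ∈ relations W, charVal m s = 1) ∧ diagGL P s = g := Iff.rfl

lemma diagGL_mem_torusOf {P : GL (Fin n) ℂ} {W : Submodule ℂ (Fin n → ℂ)} {s : Fin n → ℂˣ} :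
    diagGL P s ∈ torusOf P W ↔ ∀ m ∈ relations W, charVal m s = 1 := by
  rw [mem_torusOf]
  refine ⟨?_, fun h => ⟨s, h, rfl⟩⟩
  rintro ⟨t, ht, h⟩
  rwa [← diagGL_injective P h]

lemma expGL_mem_torusOf {P : GL (Fin n) ℂ} {W : Submodule ℂ (Fin n → ℂ)} {v : Fin n → ℂ}
    (hv : v ∈ W) : expGL (diagConj P v) ∈ torusOf P W := by
  rw [expGL_diagConj, diagGL_mem_torusOf]
  intro m hm
  rw [charVal_expU, hm v hv]
  exact Units.ext Complex.exp_zero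

/-- The polynomial in the entries of `A` whose value is the `(i, j)` entry of `P⁻¹ A P`. -/
lemma exists_ev_eq_Ad (P : GL (Fin n) ℂ) (i j : Fin n) :
    ∃ p : MvPolynomial (Fin n × Fin n) ℂ, ∀ A, ev p A = Ad P⁻¹ A i j := by
  refine ⟨∑ k, ∑ l, MvPolynomial.C ((P⁻¹ : GL (Fin n) ℂ) i k * P l j) * MvPolynomial.X (k, l),
    fun A => ?_⟩
  rw [ev, Ad, Matrix.mul_apply, inv_inv]
  simp only [map_sum, map_mul, MvPolynomial.eval_C, MvPolynomial.eval_X, Matrix.mul_apply,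
    Finset.sum_mul]
  rw [Finset.sum_comm]
  exact Finset.sum_congr rfl fun k _ => Finset.sum_congr rfl fun l _ => by ring

lemma Ad_inv_diagConj (P : GL (Fin n) ℂ) (v : Fin n → ℂ) :
    Ad P⁻¹ (diagConj P v) = Matrix.diagonal v := Ad_inv_Ad P _

lemma exists_diagGL_of_Ad {P g : GL (Fin n) ℂ}
    (h : ∀ i j, i ≠ j → Ad P⁻¹ (g : Matrix (Fin n) (Fin n) ℂ) i j = 0) : ∃ s, g = diagGL P s := by
  let D : GL (Fin n) ℂ := P⁻¹ * g * P
  have hD : (D : Matrix (Fin n) (Fin n) ℂ) = Ad P⁻¹ g := by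
    rw [Ad, inv_inv]
    rfl
  have hdiag : (D : Matrix (Fin n) (Fin n) ℂ) = Matrix.diagonal fun i => Ad P⁻¹ g i i := by
    ext i j
    rw [Matrix.diagonal_apply, hD]
    split_ifs with hij
    · rw [hij]
    · exact h i j hij
  have hne : ∀ i, Ad P⁻¹ (g : Matrix (Fin n) (Fin n) ℂ) i i ≠ 0 := by
    have h1 := Matrix.GeneralLinearGroup.det_ne_zero D
    rw [hdiag, Matrix.det_diagonal] at h1
    exact fun i => Finset.prod_ne_zero_iff.1 h1 i (Finset.mem_univ i)
  refine ⟨fun i => Units.mk0 _ (hne i), Units.ext ?_⟩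
  rw [coe_diagGL, diagConj]
  simp only [Units.val_mk0]
  rw [← hdiag, hD, Ad_Ad_inv]

/-- A character value as a quotient of two monomials with the same shift in the exponents. -/
lemma charVal_mul_prod_pow {d : ℕ} (m : Fin d → ℤ) (N : ℕ) (hN : ∀ k, 0 ≤ m k + N)
    (t : Fin d → ℂˣ) :
    (charVal m t : ℂ) * (∏ k, (t k : ℂ)) ^ N = ∏ k, (t k : ℂ) ^ (m k + N).toNat := by
  rw [charVal, Units.coe_prod, ← Finset.prod_pow, ← Finset.prod_mul_distrib]
  refine Finset.prod_congr rfl fun k _ => ?_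
  rw [Units.val_zpow_eq_zpow_val, ← zpow_natCast, ← zpow_natCast, Int.toNat_of_nonneg (hN k),
    zpow_add₀ (Units.ne_zero _)]

lemma exists_shift {d : ℕ} (m : Fin d → ℤ) : ∃ N : ℕ, ∀ k, 0 ≤ m k + N := by
  refine ⟨∑ k, (m k).natAbs, fun k => ?_⟩
  have := Finset.single_le_sum (f := fun k => (m k).natAbs) (fun _ _ => Nat.zero_le _)
    (Finset.mem_univ k)
  omega

lemma det_diagGL (P : GL (Fin n) ℂ) (s : Fin n → ℂˣ) :
    (diagGL P s : Matrix (Fin n) (Fin n) ℂ).det = ∏ i, (s i : ℂ) := by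
  rw [coe_diagGL, diagConj, Ad, Matrix.coe_units_inv, Matrix.det_conj (Units.isUnit P),
    Matrix.det_diagonal]

lemma isZariskiClosed_torusOf (P : GL (Fin n) ℂ) (W : Submodule ℂ (Fin n → ℂ)) :
    IsZariskiClosed ℂ (torusOf P W : Set (GL (Fin n) ℂ)) := by
  choose q hq using exists_ev_eq_Ad P
  refine ⟨{p | (∃ i j, i ≠ j ∧ p = q i j) ∨ ∃ m ∈ relations W, ∃ N : ℕ, (∀ k, 0 ≤ m k + N) ∧
    p = ∏ k, q k k ^ (m k + N).toNat - (∏ k, q k k) ^ N}, ?_⟩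
  have hqs : ∀ s i, ev (q i i) (diagGL P s : GL (Fin n) ℂ) = s i := by
    intro s i
    rw [hq, coe_diagGL, Ad_inv_diagConj, Matrix.diagonal_apply_eq]
  have hev : ∀ (m : Fin n → ℤ) (N : ℕ) s, ev (∏ k, q k k ^ (m k + N).toNat - (∏ k, q k k) ^ N)
      (diagGL P s : GL (Fin n) ℂ) = ∏ k, (s k : ℂ) ^ (m k + N).toNat - (∏ k, (s k : ℂ)) ^ N := by
    intro m N s
    have := hqs s
    rw [ev] at *
    simp only [ev] at this
    simp only [map_sub, map_prod, map_pow, this]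
  ext g
  rw [mem_zeroLocus_complex, SetLike.mem_coe]
  constructor
  · rw [mem_torusOf]
    rintro ⟨s, hs, rfl⟩ p (⟨i, j, hij, rfl⟩ | ⟨m, hm, N, hN, rfl⟩)
    · rw [hq, coe_diagGL, Ad_inv_diagConj, Matrix.diagonal_apply_ne _ hij]
    · rw [hev, ← charVal_mul_prod_pow m N hN, hs m hm, Units.val_one, one_mul, sub_self]
  · intro h
    obtain ⟨s, rfl⟩ := exists_diagGL_of_Ad (P := P) (g := g) fun i j hij => by
      rw [← hq]
      exact h _ (Or.inl ⟨i, j, hij, rfl⟩)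
    rw [diagGL_mem_torusOf]
    intro m hm
    obtain ⟨N, hN⟩ := exists_shift m
    have h1 := h _ (Or.inr ⟨m, hm, N, hN, rfl⟩)
    rw [hev, ← charVal_mul_prod_pow m N hN, sub_eq_zero] at h1
    exact Units.ext (mul_right_cancel₀ (pow_ne_zero _ (Finset.prod_ne_zero_iff.2 fun k _ =>
      Units.ne_zero _)) (h1.trans (one_mul _).symm))

/-- The character `v ↦ exp(∑ mᵢ vᵢ)` of the additive group `W`. -/
noncomputable def expChar (W : Submodule ℂ (Fin n → ℂ)) (m : Fin n →₀ ℕ) :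
    Multiplicative W →* ℂ where
  toFun v := Complex.exp (∑ i, (m i : ℂ) * (v.toAdd : Fin n → ℂ) i)
  map_one' := by simp
  map_mul' v w := by
    rw [← Complex.exp_add, ← Finset.sum_add_distrib]
    simp [mul_add]

/-- Two monomials that agree on the exponentials of `W` differ by an integral linear relation. -/
lemma sub_mem_relations_of_expChar_eq {W : Submodule ℂ (Fin n → ℂ)} {m l : Fin n →₀ ℕ}
    (h : expChar W m = expChar W l) : (fun i => (m i : ℤ) - l i) ∈ relations W := by
  rw [mem_relations]
  intro v hv
  by_contra hne
  have h1 : ∀ z : ℂ, Complex.exp (z * ∑ i, (((m i : ℤ) - l i : ℤ) : ℂ) * v i) = 1 := by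
    intro z
    have h2 : Complex.exp (∑ i, (m i : ℂ) * (z • v) i) =
        Complex.exp (∑ i, (l i : ℂ) * (z • v) i) :=
      DFunLike.congr_fun h (Multiplicative.ofAdd (⟨z • v, W.smul_mem z hv⟩ : W))
    have h3 : z * ∑ i, (((m i : ℤ) - l i : ℤ) : ℂ) * v i =
        ∑ i, (m i : ℂ) * (z • v) i - ∑ i, (l i : ℂ) * (z • v) i := by
      rw [Finset.mul_sum, ← Finset.sum_sub_distrib]
      refine Finset.sum_congr rfl fun i _ => ?_
      rw [Pi.smul_apply, smul_eq_mul]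
      push_cast
      ring
    rw [h3, Complex.exp_sub, h2, div_self (Complex.exp_ne_zero _)]
  have h4 := h1 (1 / ∑ i, (((m i : ℤ) - l i : ℤ) : ℂ) * v i)
  rw [one_div_mul_cancel hne] at h4
  have h5 := congrArg norm h4
  rw [Complex.norm_exp, Complex.one_re, norm_one] at h5
  exact absurd h5 (by rw [Real.exp_eq_one_iff]; norm_num)

/-- The exponentials of the `P diag(v) P⁻¹` with `v ∈ W` are Zariski dense in `torusOf P W`: by
the independence of characters, a polynomial relation between these exponentials follows from the
integral linear relations on `W`. -/
theorem torusOf_le {P : GL (Fin n) ℂ} {W : Submodule ℂ (Fin n → ℂ)} {G : Subgroup (GL (Fin n) ℂ)}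
    (hG : IsZariskiClosed ℂ (G : Set (GL (Fin n) ℂ)))
    (h : ∀ v ∈ W, expGL (diagConj P v) ∈ G) : torusOf P W ≤ G := by
  intro g hg
  obtain ⟨s, hs, rfl⟩ := mem_torusOf.1 hg
  refine hG.mem_iff.2 fun p hp => ?_
  -- The restriction of `p` to the matrices `P diag(x) P⁻¹`, as a polynomial in `x`.
  obtain ⟨r, hr⟩ : ∃ r : MvPolynomial (Fin n) ℂ, ∀ x : Fin n → ℂ,
      MvPolynomial.eval x r = ev p (diagConj P x) := by
    refine ⟨MvPolynomial.bind₁ (fun ij : Fin n × Fin n => ∑ k, MvPolynomial.C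
      ((P : Matrix (Fin n) (Fin n) ℂ) ij.1 k * (P⁻¹ : GL (Fin n) ℂ) k ij.2) * MvPolynomial.X k) p,
      fun x => ?_⟩
    rw [MvPolynomial.eval, MvPolynomial.eval₂Hom_bind₁, ev]
    refine congrArg (fun f => MvPolynomial.eval f p) (funext fun ij => ?_)
    rw [diagConj, Ad, Matrix.mul_apply, map_sum]
    refine Finset.sum_congr rfl fun k _ => ?_
    rw [Matrix.mul_diagonal]
    simp
    ring
  have hfac : Function.FactorsThrough (fun m : Fin n →₀ ℕ => ∏ i, (s i : ℂ) ^ m i)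
      (expChar W) := by
    intro m l hml
    have h1 := congrArg Units.val (hs _ (sub_mem_relations_of_expChar_eq hml))
    have h2 := charVal_sub (fun i => (m i : ℤ)) (fun i => (l i : ℤ)) s
    have h3 : ∀ m : Fin n →₀ ℕ, (charVal (fun i => (m i : ℤ)) s : ℂ) = ∏ i, (s i : ℂ) ^ m i := by
      intro m
      simp [charVal]
    change ((charVal ((fun i => (m i : ℤ)) - fun i => (l i : ℤ)) s : ℂˣ) : ℂ) = 1 at h1
    rw [h2, Units.val_one.symm, Units.val_inj, div_eq_one] at h1
    change ∏ i, (s i : ℂ) ^ m i = ∏ i, (s i : ℂ) ^ l i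
    rw [← h3, ← h3, h1]
  -- The coefficients of `r`, collected by the character of `W` that the monomial induces, vanish.
  -- The value of a monomial at `s` depends only on that character.
  have hzero : ∑ m ∈ r.support, Finsupp.single (expChar W m) (r.coeff m) = 0 := by
    refine (linearIndependent_monoidHom (Multiplicative W) ℂ).finsuppLinearCombination_injective ?_
    rw [map_zero, map_sum]
    funext v
    have h1 : MvPolynomial.eval (fun i => Complex.exp ((v.toAdd : Fin n → ℂ) i)) r = 0 := by
      rw [hr, ← hp _ (h v.toAdd v.toAdd.2), expGL_diagConj, coe_diagGL]
      rfl
    rw [MvPolynomial.eval_eq'] at h1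
    rw [Finset.sum_apply, Pi.zero_apply, ← h1]
    refine Finset.sum_congr rfl fun m _ => ?_
    rw [Finsupp.linearCombination_single, Pi.smul_apply, smul_eq_mul]
    simp only [expChar, MonoidHom.coe_mk, OneHom.coe_mk, Complex.exp_sum, Complex.exp_nat_mul]
  have hmain := congrArg (Finsupp.linearCombination ℂ (Function.extend (expChar W)
    (fun m : Fin n →₀ ℕ => ∏ i, (s i : ℂ) ^ m i) 0)) hzero
  rw [map_zero, map_sum] at hmain
  rw [coe_diagGL, ← hr, MvPolynomial.eval_eq', ← hmain]
  refine Finset.sum_congr rfl fun m _ => ?_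
  rw [Finsupp.linearCombination_single, hfac.extend_apply, smul_eq_mul]

lemma isAlgebraicHom_diagGL {d : ℕ} (P : GL (Fin n) ℂ) (α : Fin n → Fin d → ℤ)
    {f : (Fin d → ℂˣ) →* GL (Fin n) ℂ} (hf : ∀ t, f t = diagGL P fun i => charVal (α i) t) :
    IsAlgebraicHom f := by
  intro i j
  refine ⟨∑ l, Finsupp.single (α l)
    ((P : Matrix (Fin n) (Fin n) ℂ) i l * (P⁻¹ : GL (Fin n) ℂ) l j), fun t => ?_⟩
  rw [hf, coe_diagGL, diagConj, Ad, Matrix.mul_apply]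
  rw [← Finsupp.sum_finsetSum_index (by simp) (by intros; ring)]
  refine Finset.sum_congr rfl fun l _ => ?_
  rw [Matrix.mul_diagonal, Finsupp.sum_single_index (by simp)]
  simp only [charVal, Units.coe_prod, Units.val_zpow_eq_zpow_val]
  ring

/-- Characters of the diagonal matrices are regular functions. -/
lemma exists_charVal_eq_div_det {P : GL (Fin n) ℂ} (c : Fin n → ℤ) :
    ∃ (p : MvPolynomial (Fin n × Fin n) ℂ) (N : ℕ), ∀ s,
      (charVal c s : ℂ) = ev p (diagGL P s : GL (Fin n) ℂ) /
        (diagGL P s : Matrix (Fin n) (Fin n) ℂ).det ^ N := by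
  choose q hq using exists_ev_eq_Ad P
  obtain ⟨N, hN⟩ := exists_shift c
  refine ⟨∏ k, q k k ^ (c k + N).toNat, N, fun s => ?_⟩
  have hqs : ∀ i, ev (q i i) (diagGL P s : GL (Fin n) ℂ) = s i := by
    intro i
    rw [hq, coe_diagGL, Ad_inv_diagConj, Matrix.diagonal_apply_eq]
  rw [det_diagGL, eq_div_iff (pow_ne_zero _ (Finset.prod_ne_zero_iff.2 fun k _ =>
    Units.ne_zero _)), charVal_mul_prod_pow c N hN]
  have := hqs
  simp only [ev] at this ⊢
  simp only [map_prod, map_pow, this]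

/-- The lattice of characters of `torusOf P W` is the free group `ℤⁿ / relations W`. -/
theorem isTorus_torusOf_of_rational {P : GL (Fin n) ℂ} {W : Submodule ℂ (Fin n → ℂ)}
    (hQ : IsZariskiClosed ℚ (torusOf P W : Set (GL (Fin n) ℂ))) : IsTorus (torusOf P W) := by
  have htf : Module.IsTorsionFree ℤ ((Fin n → ℤ) ⧸ relations W) := by
    refine ⟨fun a ha => ?_⟩
    have ha0 : a ≠ 0 := ha.ne_zero
    intro x y hxy
    obtain ⟨m, rfl⟩ := Submodule.mkQ_surjective _ x
    obtain ⟨l, rfl⟩ := Submodule.mkQ_surjective _ y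
    simp only [← map_smul] at hxy
    rw [Submodule.mkQ_apply, Submodule.mkQ_apply, Submodule.Quotient.eq] at hxy ⊢
    rw [mem_relations] at hxy ⊢
    intro v hv
    have h1 := hxy v hv
    have h2 : ∑ i, (((a • m - a • l) i : ℤ) : ℂ) * v i =
        (a : ℂ) * ∑ i, (((m - l) i : ℤ) : ℂ) * v i := by
      rw [Finset.mul_sum]
      refine Finset.sum_congr rfl fun i _ => ?_
      simp only [Pi.sub_apply, Pi.smul_apply, smul_eq_mul]
      push_cast
      ring
    rw [h2] at h1
    exact (mul_eq_zero.1 h1).resolve_left (Int.cast_ne_zero.2 ha0)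
  have hfree : Module.Free ℤ ((Fin n → ℤ) ⧸ relations W) := inferInstance
  let b := Module.finBasis ℤ ((Fin n → ℤ) ⧸ relations W)
  let α : Fin n → Fin (Module.finrank ℤ ((Fin n → ℤ) ⧸ relations W)) → ℤ := fun i =>
    b.repr ((relations W).mkQ (Pi.single i 1))
  -- `t ↦ (charVal (α i) t)ᵢ` is the isomorphism, with inverse `s ↦ (charVal (c j) s)ⱼ`.
  choose c hc using fun j => Submodule.mkQ_surjective (relations W) (b j)
  have hα : ∀ m : Fin n → ℤ, ∑ i, m i • α i = b.repr ((relations W).mkQ m) := by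
    intro m
    have h1 : m = ∑ i, m i • Pi.single i (1 : ℤ) := by
      funext k
      simp [Finset.sum_apply, Pi.single_apply]
    conv_rhs => rw [h1]
    funext k
    simp only [α, map_sum, map_smul, Finset.sum_apply, Finsupp.coe_finsetSum, Finsupp.coe_smul]
  have hcong : ∀ s : Fin n → ℂˣ, (∀ m ∈ relations W, charVal m s = 1) → ∀ m l,
      (relations W).mkQ m = (relations W).mkQ l → charVal m s = charVal l s := by
    intro s hs m l hml
    have h1 := hs _ ((Submodule.Quotient.eq _).1 hml)
    rwa [charVal_sub, div_eq_one] at h1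
  have hmem : ∀ t, diagGL P (fun i => charVal (α i) t) ∈ torusOf P W := by
    intro t
    rw [diagGL_mem_torusOf]
    intro m hm
    rw [← charVal_sum_smul, hα, Submodule.mkQ_apply, (Submodule.Quotient.mk_eq_zero _).2 hm,
      map_zero]
    simp [charVal]
  have hleft : ∀ t j, charVal (c j) (fun i => charVal (α i) t) = t j := by
    intro t j
    rw [← charVal_sum_smul, hα, hc, b.repr_self, Finsupp.single_eq_pi_single, charVal_single]
  have hright : ∀ s : Fin n → ℂˣ, (∀ m ∈ relations W, charVal m s = 1) → ∀ i,
      charVal (α i) (fun j => charVal (c j) s) = s i := by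
    intro s hs i
    rw [← charVal_sum_smul, ← charVal_single i s]
    refine hcong s hs _ _ ?_
    rw [map_sum]
    simp only [map_smul, hc]
    exact b.sum_repr _
  let f : (Fin (Module.finrank ℤ ((Fin n → ℤ) ⧸ relations W)) → ℂˣ) →* torusOf P W :=
    { toFun := fun t => ⟨diagGL P fun i => charVal (α i) t, hmem t⟩
      map_one' := Subtype.ext (by
        simp only [charVal_one]
        exact map_one (diagGL P))
      map_mul' := fun s t => Subtype.ext (by
        simp only [charVal_mul]
        exact map_mul (diagGL P) _ _) }
  have hf : Function.Bijective f := by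
    constructor
    · intro t t' h
      funext j
      have h1 := diagGL_injective P (congrArg Subtype.val h)
      rw [← hleft t j, h1, hleft]
    · rintro ⟨g, hg⟩
      obtain ⟨s, hs, rfl⟩ := mem_torusOf.1 hg
      refine ⟨fun j => charVal (c j) s, Subtype.ext ?_⟩
      exact congrArg (diagGL P) (funext (hright s hs))
  refine ⟨_, hQ, MulEquiv.ofBijective f hf, isAlgebraicHom_diagGL P α fun t => rfl, fun j => ?_⟩
  obtain ⟨p, N, hp⟩ := exists_charVal_eq_div_det (P := P) (c j)
  refine ⟨p, N, fun g => ?_⟩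
  obtain ⟨t, rfl⟩ := hf.2 g
  have h1 : (MulEquiv.ofBijective f hf).symm (f t) = t :=
    (MulEquiv.ofBijective f hf).symm_apply_apply t
  rw [h1, ← hleft t j, hp]
  rfl

/-- If the space of the matrices `P diag(v) P⁻¹` with `v ∈ W` is stable under the automorphisms of
`ℂ`, then `torusOf P W` is a `ℚ`-torus: its images under the automorphisms of `ℂ` contain
`torusOf P W`, which is the smallest group with the given matrices in its Lie algebra. -/
theorem isTorus_torusOf {P : GL (Fin n) ℂ} {W : Submodule ℂ (Fin n → ℂ)}
    (hW : ∀ σ : ℂ ≃ₐ[ℚ] ℂ, ∀ v ∈ W, ∃ w ∈ W, gal σ (diagConj P v) = diagConj P w) :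
    IsTorus (torusOf P W) := by
  have hcl := isZariskiClosed_torusOf P W
  have hlie : ∀ v ∈ W, diagConj P v ∈ lie (torusOf P W) := by
    intro v hv
    refine (mem_lie_iff hcl).2 fun z => ?_
    rw [← diagConj_smul]
    exact expGL_mem_torusOf (W.smul_mem z hv)
  refine isTorus_torusOf_of_rational (hcl.rational fun σ g hg => ?_)
  have hcl' : IsZariskiClosed ℂ ((torusOf P W).comap (mapGL (σ : ℂ →+* ℂ)) : Set (GL (Fin n) ℂ)) :=
    isZariskiClosed_preimage_mapGL σ hcl
  refine torusOf_le hcl' (fun v hv => expGL_mem hcl' ?_) hg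
  obtain ⟨w, hw, hvw⟩ := hW σ v hv
  rw [← gal_inv_gal σ (diagConj P v), hvw]
  refine gal_mem_lie_of_mapsTo (fun g hg => ?_) (hlie w hw)
  have h1 : mapGL (σ : ℂ →+* ℂ) (mapGL ((σ⁻¹ : ℂ ≃ₐ[ℚ] ℂ) : ℂ →+* ℂ) g) = g :=
    Units.ext (gal_gal_inv σ _)
  rw [Subgroup.mem_comap, h1]
  exact hg

/-! ### The Jordan decomposition in the Lie algebra of a closed group -/

/-- On `q`, the differential operator `d/dz + c` is injective for `c ≠ 0`. -/
lemma derivative_add_smul_injective {c : ℂ} (hc : c ≠ 0) {q : Polynomial ℂ}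
    (h : Polynomial.derivative q + c • q = 0) : q = 0 := by
  by_contra hq
  have h1 := Polynomial.degree_derivative_lt hq
  rw [eq_neg_of_add_eq_zero_left h, Polynomial.degree_neg, Polynomial.degree_smul_of_smul_regular _
    (IsSMulRegular.of_ne_zero hc)] at h1
  exact lt_irrefl _ h1

/-- The exponentials with distinct exponents are linearly independent over the polynomials. -/
lemma eq_zero_of_sum_mul_exp_eq_zero (s : Finset ℂ) : ∀ q : ℂ → Polynomial ℂ,
    (∀ z, ∑ c ∈ s, (q c).eval z * Complex.exp (c * z) = 0) → ∀ c ∈ s, q c = 0 := by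
  induction s using Finset.induction_on with
  | empty => simp
  | insert b s hb ih =>
    intro q hq
    let L : ℂ → Polynomial ℂ → Polynomial ℂ := fun c p => Polynomial.derivative p + (c - b) • p
    have hstep : ∀ q : ℂ → Polynomial ℂ,
        (∀ z, ∑ c ∈ insert b s, (q c).eval z * Complex.exp (c * z) = 0) →
        ∀ z, ∑ c ∈ insert b s, (L c (q c)).eval z * Complex.exp (c * z) = 0 := by
      intro q hq z
      have h1 : HasDerivAt (fun z => ∑ c ∈ insert b s, (q c).eval z * Complex.exp (c * z))
          (∑ c ∈ insert b s, ((Polynomial.derivative (q c)).eval z * Complex.exp (c * z) +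
            (q c).eval z * (Complex.exp (c * z) * (c * 1)))) z :=
        HasDerivAt.fun_sum fun c _ => ((q c).hasDerivAt z).mul
          (((hasDerivAt_id z).const_mul c).cexp)
      have h2 := h1.unique ((hasDerivAt_const z (0 : ℂ)).congr_of_eventuallyEq
        (Filter.Eventually.of_forall hq))
      have h3 : ∑ c ∈ insert b s, (L c (q c)).eval z * Complex.exp (c * z) =
          ∑ c ∈ insert b s, ((Polynomial.derivative (q c)).eval z * Complex.exp (c * z) +
            (q c).eval z * (Complex.exp (c * z) * (c * 1))) -
          b * ∑ c ∈ insert b s, (q c).eval z * Complex.exp (c * z) := by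
        rw [Finset.mul_sum, ← Finset.sum_sub_distrib]
        refine Finset.sum_congr rfl fun c _ => ?_
        simp only [L, Polynomial.eval_add, Polynomial.eval_smul, smul_eq_mul]
        ring
      rw [h3, h2, hq, mul_zero, sub_zero]
    have hiter : ∀ k z, ∑ c ∈ insert b s, ((L c)^[k] (q c)).eval z * Complex.exp (c * z) = 0 := by
      intro k
      induction k with
      | zero => exact hq
      | succ k ihk =>
        simp only [Function.iterate_succ_apply']
        exact hstep _ ihk
    have hLb : L b = Polynomial.derivative := by
      funext p
      simp [L]
    have hs : ∀ c ∈ s, q c = 0 := by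
      intro c hc
      have h1 := ih (fun c => (L c)^[(q b).natDegree + 1] (q c)) (fun z => by
        have h2 := hiter ((q b).natDegree + 1) z
        rwa [Finset.sum_insert hb, hLb, Polynomial.iterate_derivative_eq_zero (Nat.lt_succ_self _),
          Polynomial.eval_zero, zero_mul, zero_add] at h2) c hc
      have hcb : c - b ≠ 0 := sub_ne_zero.2 fun h => hb (h ▸ hc)
      have h3 : ∀ k p, (L c)^[k] p = 0 → p = 0 := by
        intro k
        induction k with
        | zero => exact fun p hp => hp
        | succ k ihk =>
          intro p hp
          rw [Function.iterate_succ_apply] at hp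
          exact derivative_add_smul_injective hcb (ihk _ hp)
      exact h3 _ _ h1
    intro c hc
    rcases Finset.mem_insert.1 hc with rfl | hc
    · refine Polynomial.funext fun z => ?_
      have h1 := hq z
      rw [Finset.sum_insert hb, Finset.sum_eq_zero fun c hc => by
        rw [hs c hc, Polynomial.eval_zero, zero_mul], add_zero] at h1
      rw [(mul_eq_zero.1 h1).resolve_right (Complex.exp_ne_zero _), Polynomial.eval_zero]
    · exact hs c hc

/-- If an exponential polynomial vanishes, then it vanishes with independent variables in the
coefficients and in the exponentials. -/
lemma sum_eval_mul_exp_eq_zero {ι : Type*} (s : Finset ι) (c : ι → ℂ) (q : ι → Polynomial ℂ)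
    (h : ∀ z, ∑ i ∈ s, (q i).eval z * Complex.exp (c i * z) = 0) (z w : ℂ) :
    ∑ i ∈ s, (q i).eval w * Complex.exp (c i * z) = 0 := by
  classical
  have key : ∀ z w, ∑ i ∈ s, (q i).eval w * Complex.exp (c i * z) =
      ∑ b ∈ s.image c, (∑ i ∈ s with c i = b, q i).eval w * Complex.exp (b * z) := by
    intro z w
    rw [← Finset.sum_fiberwise_of_maps_to (fun i hi => Finset.mem_image_of_mem c hi)]
    refine Finset.sum_congr rfl fun b _ => ?_
    rw [Polynomial.eval_finsetSum, Finset.sum_mul]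
    exact Finset.sum_congr rfl fun i hi => by rw [(Finset.mem_filter.1 hi).2]
  have h1 := eq_zero_of_sum_mul_exp_eq_zero (s.image c) (fun b => ∑ i ∈ s with c i = b, q i)
    fun z => (key z z).symm.trans (h z)
  rw [key]
  exact Finset.sum_eq_zero fun b hb => by rw [h1 b hb, Polynomial.eval_zero, zero_mul]

lemma exists_exp_smul_eq_eval {N : Matrix (Fin n) (Fin n) ℂ} (hN : IsNilpotent N) :
    ∃ b : Matrix (Fin n) (Fin n) (Polynomial ℂ), ∀ w : ℂ,
      NormedSpace.exp (w • N) = b.map (Polynomial.eval w) := by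
  obtain ⟨k, hk⟩ := hN
  refine ⟨Matrix.of fun i j => ∑ m ∈ Finset.range k,
    Polynomial.C ((m.factorial : ℂ)⁻¹ * (N ^ m) i j) * Polynomial.X ^ m, fun w => ?_⟩
  rw [NormedSpace.exp_eq_tsum ℂ]
  have h1 : ∀ m ∉ Finset.range k, ((m.factorial : ℂ)⁻¹) • (w • N) ^ m = 0 := by
    intro m hm
    rw [smul_pow, pow_eq_zero_of_le (not_lt.1 fun h => hm (Finset.mem_range.2 h)) hk, smul_zero,
      smul_zero]
  simp only
  rw [tsum_eq_sum h1]
  ext i j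
  rw [Matrix.sum_apply, Matrix.map_apply, Matrix.of_apply, Polynomial.eval_finsetSum]
  refine Finset.sum_congr rfl fun m _ => ?_
  simp [smul_pow]
  ring

/-- The semisimple part of an element of the Lie algebra of a closed group lies in the Lie
algebra. -/
theorem diagConj_mem_lie_of_add {G : Subgroup (GL (Fin n) ℂ)}
    (hG : IsZariskiClosed ℂ (G : Set (GL (Fin n) ℂ))) {P : GL (Fin n) ℂ} {v : Fin n → ℂ}
    {N : Matrix (Fin n) (Fin n) ℂ} (hN : IsNilpotent N) (hcomm : Commute (diagConj P v) N)
    (h : diagConj P v + N ∈ lie G) : diagConj P v ∈ lie G := by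
  rw [mem_lie_iff hG] at h ⊢
  intro z
  refine hG.mem_iff.2 fun p hp => ?_
  obtain ⟨b, hb⟩ := exists_exp_smul_eq_eval hN
  let Pm : Matrix (Fin n) (Fin n) ℂ := P
  let Pi : Matrix (Fin n) (Fin n) ℂ := (P⁻¹ : GL (Fin n) ℂ)
  -- The entries of `exp(z P diag(v) P⁻¹) exp(wN)` are polynomials in the `exp(z vₖ)` and in `w`.
  let Φ : ℂ → ℂ → MvPolynomial (Fin n) (Polynomial ℂ) →+* ℂ := fun z w =>
    MvPolynomial.eval₂Hom (Polynomial.evalRingHom w) fun k => Complex.exp (z * v k)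
  let g : Fin n × Fin n → MvPolynomial (Fin n) (Polynomial ℂ) := fun ij =>
    ∑ l, (∑ k, MvPolynomial.C (Polynomial.C (Pm ij.1 k * Pi k l)) * MvPolynomial.X k) *
      MvPolynomial.C (b l ij.2)
  have hg : ∀ z w ij, Φ z w (g ij) =
      (NormedSpace.exp (z • diagConj P v) * NormedSpace.exp (w • N)) ij.1 ij.2 := by
    intro z w ij
    have h1 : NormedSpace.exp (z • diagConj P v) =
        Pm * Matrix.diagonal (fun k => Complex.exp (z * v k)) * Pi := by
      rw [← diagConj_smul, ← coe_expGL, expGL_diagConj, coe_diagGL]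
      rfl
    rw [h1, hb, Matrix.mul_apply, map_sum]
    refine Finset.sum_congr rfl fun l _ => ?_
    rw [map_mul, map_sum, Matrix.mul_apply]
    congr 1
    · refine Finset.sum_congr rfl fun k _ => ?_
      rw [Matrix.mul_diagonal]
      simp [Φ]
      ring
    · simp [Φ]
  have hev : ∀ z w, Φ z w (MvPolynomial.aeval g p) =
      ev p (NormedSpace.exp (z • diagConj P v) * NormedSpace.exp (w • N)) := by
    intro z w
    rw [MvPolynomial.map_aeval, ev]
    have h1 : (Φ z w).comp (algebraMap ℂ (MvPolynomial (Fin n) (Polynomial ℂ))) = RingHom.id ℂ := by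
      exact RingHom.ext fun x => (MvPolynomial.eval₂_C (Polynomial.evalRingHom w) _
        (Polynomial.C x)).trans Polynomial.eval_C
    rw [h1, funext (hg z w)]
    rfl
  have hsum : ∀ z w, Φ z w (MvPolynomial.aeval g p) =
      ∑ m ∈ (MvPolynomial.aeval g p).support, ((MvPolynomial.aeval g p).coeff m).eval w *
        Complex.exp ((∑ k, m k * v k) * z) := by
    intro z w
    change MvPolynomial.eval₂ _ _ _ = _
    rw [MvPolynomial.eval₂_eq']
    refine Finset.sum_congr rfl fun m _ => ?_
    rw [Finset.sum_mul, Complex.exp_sum]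
    congr 1
    refine Finset.prod_congr rfl fun k _ => ?_
    rw [← Complex.exp_nat_mul]
    congr 1
    ring
  have h1 := sum_eval_mul_exp_eq_zero _ _ _ (fun z => by
    rw [← hsum z z, hev]
    have h2 := hp _ (h z)
    rw [coe_expGL, smul_add, Matrix.exp_add_of_commute _ _ ((hcomm.smul_left z).smul_right z)] at h2
    exact h2) z 0
  rw [← hsum, hev, zero_smul, NormedSpace.exp_zero, mul_one] at h1
  exact h1

/-! ### Maximal tori are their own centralisers among the semisimple elements -/

lemma diagConj_pow (P : GL (Fin n) ℂ) (v : Fin n → ℂ) (k : ℕ) :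
    diagConj P v ^ k = diagConj P (v ^ k) := by
  induction k with
  | zero => simp [diagConj, Ad]
  | succ k ih => rw [pow_succ, ih, diagConj_mul, pow_succ]

@[simp] lemma diagConj_zero (P : GL (Fin n) ℂ) : diagConj P (0 : Fin n → ℂ) = 0 := by
  simp [diagConj]

lemma exists_squarefree_aeval_diagConj (P : GL (Fin n) ℂ) (v : Fin n → ℂ) :
    ∃ p : Polynomial ℂ, Squarefree p ∧ Polynomial.aeval (diagConj P v) p = 0 := by
  classical
  refine ⟨∏ x ∈ Finset.univ.image v, (Polynomial.X - Polynomial.C x),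
    (Polynomial.separable_prod_X_sub_C_iff' |>.2 fun x _ y _ h => h).squarefree, ?_⟩
  have h1 : ∀ p : Polynomial ℂ, Polynomial.aeval (diagConj P v) p =
      diagConj P fun i => p.eval (v i) := by
    intro p
    induction p using Polynomial.induction_on' with
    | add p q hp hq =>
      rw [map_add, hp, hq, ← diagConj_add]
      congr 1
      funext i
      simp
    | monomial k c =>
      rw [Polynomial.aeval_monomial, diagConj_pow, ← Algebra.smul_def, ← diagConj_smul]
      congr 1
      funext i
      simp
  rw [h1]
  have h2 : (fun i => (∏ x ∈ Finset.univ.image v, (Polynomial.X - Polynomial.C x)).eval (v i)) =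
      0 := by
    funext i
    rw [Polynomial.eval_prod, Pi.zero_apply]
    exact Finset.prod_eq_zero (Finset.mem_image_of_mem v (Finset.mem_univ i)) (by simp)
  rw [h2, diagConj_zero]

lemma eq_zero_of_isNilpotent_diagConj {P : GL (Fin n) ℂ} {v : Fin n → ℂ}
    (h : IsNilpotent (diagConj P v)) : v = 0 := by
  obtain ⟨k, hk⟩ := h
  rw [diagConj_pow, ← diagConj_zero P] at hk
  exact IsReduced.eq_zero _ ⟨k, diagConj_injective P hk⟩

lemma pow_eq_zero_of_isNilpotent_matrix {M : Matrix (Fin n) (Fin n) ℚ} (h : IsNilpotent M) :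
    M ^ n = 0 := by
  have h1 := Matrix.isNilpotent_charpoly_sub_pow_of_isNilpotent h
  rw [isNilpotent_iff_eq_zero, sub_eq_zero, Fintype.card_fin] at h1
  have h2 := Matrix.aeval_self_charpoly M
  rwa [h1, map_pow, Polynomial.aeval_X] at h2

/-- If every rational matrix in `W` is nilpotent, then so is every matrix in the complex span of the
rational matrices in `W`, since nilpotence is a polynomial identity over `ℚ`. -/
lemma isNilpotent_of_mem_span {W : Submodule ℂ (Matrix (Fin n) (Fin n) ℂ)}
    (hW : ∀ X : Matrix (Fin n) (Fin n) ℚ, X.map (algebraMap ℚ ℂ) ∈ W → IsNilpotent X)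
    {A : Matrix (Fin n) (Fin n) ℂ} (hA : A ∈ Submodule.span ℂ {B | B ∈ W ∧
      ∃ B₀ : Matrix (Fin n) (Fin n) ℚ, B = B₀.map (algebraMap ℚ ℂ)}) : IsNilpotent A := by
  obtain ⟨k, c, B, rfl⟩ := Submodule.mem_span_set'.1 hA
  choose hB R hR using fun i => (B i).2
  let M : Matrix (Fin n) (Fin n) (MvPolynomial (Fin k) ℚ) := Matrix.of fun i j =>
    ∑ l, MvPolynomial.C (R l i j) * MvPolynomial.X l
  have hM : M ^ n = 0 := by
    ext i j
    refine congrArg _ (MvPolynomial.funext fun x => ?_)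
    have h1 : (MvPolynomial.eval x).mapMatrix M = ∑ l, x l • R l := by
      ext i j
      simp [M, Matrix.sum_apply, mul_comm]
    have h2 : IsNilpotent (∑ l, x l • R l) := by
      refine hW _ ?_
      have h3 : (∑ l, x l • R l).map (algebraMap ℚ ℂ) =
          ∑ l, (x l : ℂ) • (B l : Matrix (Fin n) (Fin n) ℂ) := by
        ext i j
        simp [Matrix.sum_apply, hR]
      rw [h3]
      exact W.sum_mem fun l _ => W.smul_mem _ (hB l)
    have h4 := congrArg (fun Z => Z i j) (map_pow (MvPolynomial.eval x).mapMatrix M n)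
    rw [h1, pow_eq_zero_of_isNilpotent_matrix h2] at h4
    exact h4.trans (map_zero _).symm
  refine ⟨n, ?_⟩
  have h5 : (MvPolynomial.aeval c : MvPolynomial (Fin k) ℚ →ₐ[ℚ] ℂ).toRingHom.mapMatrix M =
      ∑ l, c l • (B l : Matrix (Fin n) (Fin n) ℂ) := by
    ext i j
    simp [M, Matrix.sum_apply, mul_comm, hR]
  rw [← h5, ← map_pow, hM, map_zero]

/-- The Jordan decomposition of a rational matrix, with semisimple part `p(X)`. -/
lemma exists_jordan (X : Matrix (Fin n) (Fin n) ℚ) : ∃ p q : Polynomial ℚ, q.Separable ∧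
    Polynomial.aeval (Polynomial.aeval X p) q = 0 ∧ IsNilpotent (X - Polynomial.aeval X p) := by
  let e : Matrix (Fin n) (Fin n) ℚ ≃ₐ[ℚ] Module.End ℚ (Fin n → ℚ) := Matrix.toLinAlgEquiv'
  obtain ⟨N, -, S, hS, hN, hss, hX⟩ := (e X).exists_isNilpotent_isSemisimple
  rw [Algebra.adjoin_singleton_eq_range_aeval] at hS
  obtain ⟨p, rfl⟩ := hS
  have h1 : Polynomial.aeval (e X) p = e (Polynomial.aeval X p) :=
    Polynomial.aeval_algHom_apply e.toAlgHom X p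
  change Module.End.IsSemisimple (Polynomial.aeval (e X) p) at hss
  change e X = N + Polynomial.aeval (e X) p at hX
  rw [h1] at hss hX
  refine ⟨p, minpoly ℚ (e (Polynomial.aeval X p)), PerfectField.separable_iff_squarefree.2
    hss.minpoly_squarefree, ?_, ?_⟩
  · refine e.injective ?_
    rw [map_zero]
    exact (Polynomial.aeval_algHom_apply e.toAlgHom _ _).symm.trans (minpoly.aeval ℚ _)
  · have h2 : X - Polynomial.aeval X p = e.symm N := by
      rw [AlgEquiv.eq_symm_apply, map_sub, hX, add_sub_cancel_right]
    rw [h2]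
    exact hN.map e.symm

lemma commute_of_eq_diagConj {A B : Matrix (Fin n) (Fin n) ℂ} {P : GL (Fin n) ℂ}
    (hA : ∃ v, A = diagConj P v) (hB : ∃ v, B = diagConj P v) : Commute A B := by
  obtain ⟨v, rfl⟩ := hA
  obtain ⟨w, rfl⟩ := hB
  exact diagConj_commute P v w

/-- A diagonalisable rational element of `lie G` that commutes with the Lie algebra of a maximal
torus `T` lies in `lie T`, as otherwise it would generate a larger torus together with `T`. -/
lemma IsMaximalTorus.mem_lie_of_rational {G T : Subgroup (GL (Fin n) ℂ)}
    (hG : IsZariskiClosed ℚ (G : Set (GL (Fin n) ℂ))) (hT : IsMaximalTorus T G)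
    {S : Matrix (Fin n) (Fin n) ℂ} (hS : S ∈ lie G) (hSd : ∃ P v, S = diagConj P v)
    (hSr : ∀ σ : ℂ ≃ₐ[ℚ] ℂ, gal σ S = S) (hcomm : ∀ B ∈ lie T, Commute S B) : S ∈ lie T := by
  obtain ⟨⟨d, hd⟩, hTG, hmax⟩ := hT
  obtain ⟨P₀, χ, hlie, hexp, -⟩ := hd.exists_torusLie
  have hTcl := hd.1
  obtain ⟨P, hP⟩ := exists_forall_eq_diagConj
    (F := insert S (lie T : Set (Matrix (Fin n) (Fin n) ℂ)))
    (by
      rintro A (rfl | hA) B (rfl | hB)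
      · exact Commute.refl _
      · exact hcomm B hB
      · exact (hcomm A hA).symm
      · exact commute_of_eq_diagConj (((hlie A).1 hA).imp' _ fun u hu => hu)
          (((hlie B).1 hB).imp' _ fun u hu => hu))
    (by
      rintro A (rfl | hA)
      · obtain ⟨Q, v, rfl⟩ := hSd
        exact exists_squarefree_aeval_diagConj Q v
      · obtain ⟨u, rfl⟩ := (hlie A).1 hA
        exact exists_squarefree_aeval_diagConj _ _)
  -- The Lie algebra of the torus generated by `T` and `S`.
  let a : Submodule ℂ (Matrix (Fin n) (Fin n) ℂ) := lie T ⊔ Submodule.span ℂ {S}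
  have hSa : S ∈ a := Submodule.mem_sup_right (Submodule.mem_span_singleton_self S)
  let f : (Fin n → ℂ) →ₗ[ℂ] Matrix (Fin n) (Fin n) ℂ :=
    { toFun := diagConj P
      map_add' := diagConj_add P
      map_smul' := diagConj_smul P }
  have ha : ∀ A ∈ a, ∃ w ∈ a.comap f, A = diagConj P w := by
    intro A hA
    have h1 : a ≤ LinearMap.range f := by
      refine sup_le (fun B hB => ?_) ((Submodule.span_singleton_le_iff_mem _ _).2 ?_)
      · obtain ⟨w, hw⟩ := hP B (Or.inr hB)
        exact ⟨w, hw.symm⟩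
      · obtain ⟨w, hw⟩ := hP S (Or.inl rfl)
        exact ⟨w, hw.symm⟩
    obtain ⟨w, hw⟩ := h1 hA
    exact ⟨w, show f w ∈ a by rwa [hw], hw.symm⟩
  have haG : ∀ w ∈ a.comap f, diagConj P w ∈ lie G := by
    intro w hw
    have h1 : a ≤ lie G := by
      refine sup_le (fun B hB => ?_) ((Submodule.span_singleton_le_iff_mem _ _).2 hS)
      exact (mem_lie_iff hG.complex).2 fun z => hTG ((mem_lie_iff hTcl.complex).1 hB z)
    exact h1 hw
  have hagal : ∀ σ : ℂ ≃ₐ[ℚ] ℂ, ∀ A ∈ a, gal σ A ∈ a := by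
    intro σ A hA
    obtain ⟨B, hB, C, hC, rfl⟩ := Submodule.mem_sup.1 hA
    obtain ⟨c, rfl⟩ := Submodule.mem_span_singleton.1 hC
    rw [gal_add, gal_smul, hSr]
    exact a.add_mem (Submodule.mem_sup_left (gal_mem_lie hTcl σ hB)) (a.smul_mem _ hSa)
  have htorus : IsTorus (torusOf P (a.comap f)) :=
    isTorus_torusOf fun σ v hv => ha _ (hagal σ _ hv)
  have hTle : T ≤ torusOf P (a.comap f) := by
    intro g hg
    obtain ⟨u, rfl⟩ := hexp g hg
    obtain ⟨w, hw, h1⟩ := ha _ (Submodule.mem_sup_left ((hlie _).2 ⟨u, rfl⟩))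
    rw [h1]
    exact expGL_mem_torusOf hw
  have heq := hmax _ htorus hTle
    (torusOf_le hG.complex fun w hw => expGL_mem hG.complex (haG w hw))
  obtain ⟨w, hw, h1⟩ := ha S hSa
  rw [mem_lie_iff hTcl.complex]
  intro z
  rw [h1, ← diagConj_smul, ← heq]
  exact expGL_mem_torusOf (Submodule.smul_mem _ z hw)

/-- The trace form is nondegenerate on the Lie algebra of a torus: the trace of the product of the
elements with coordinates `u` and `ū` is a sum of squares of absolute values. -/
lemma IsTorusOfDim.eq_zero_of_trace {T : Subgroup (GL (Fin n) ℂ)} {d : ℕ} (hT : IsTorusOfDim T d)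
    {A : Matrix (Fin n) (Fin n) ℂ} (hA : A ∈ lie T) (h : ∀ B ∈ lie T, (A * B).trace = 0) :
    A = 0 := by
  obtain ⟨P, χ, hlie, -, -⟩ := hT.exists_torusLie
  obtain ⟨u, rfl⟩ := (hlie A).1 hA
  have h1 := h _ ((hlie _).2 ⟨fun k => starRingEnd ℂ (u k), rfl⟩)
  rw [torusLie, torusLie, diagConj_mul, trace_diagConj] at h1
  have h2 : ∀ i, (∑ k, χ i k * u k) * (∑ k, χ i k * starRingEnd ℂ (u k)) =
      ((Complex.normSq (∑ k, χ i k * u k) : ℝ) : ℂ) := by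
    intro i
    rw [Complex.normSq_eq_conj_mul_self, mul_comm, map_sum]
    simp
  simp only [Pi.mul_apply, h2] at h1
  rw [← Complex.ofReal_sum, Complex.ofReal_eq_zero,
    Finset.sum_eq_zero_iff_of_nonneg fun i _ => Complex.normSq_nonneg _] at h1
  have h3 : (fun i => ∑ k, (χ i k : ℂ) * u k) = 0 :=
    funext fun i => Complex.normSq_eq_zero.1 (h1 i (Finset.mem_univ i))
  rw [torusLie, h3, diagConj_zero]

lemma gal_eq_of_rational (σ : ℂ ≃ₐ[ℚ] ℂ) (X : Matrix (Fin n) (Fin n) ℚ) :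
    gal σ (X.map (algebraMap ℚ ℂ)) = X.map (algebraMap ℚ ℂ) := by
  ext i j
  rw [gal_apply]
  exact σ.commutes _

lemma commute_gal {A B : Matrix (Fin n) (Fin n) ℂ} (h : Commute A B) (σ : ℂ ≃ₐ[ℚ] ℂ) :
    Commute (gal σ A) (gal σ B) := by
  rw [Commute, SemiconjBy, ← gal_mul, h.eq, gal_mul]

lemma trace_eq_zero_of_isNilpotent {N : Matrix (Fin n) (Fin n) ℂ} (hN : IsNilpotent N) :
    N.trace = 0 :=
  (Matrix.isNilpotent_trace_of_isNilpotent hN).eq_zero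

lemma IsMaximalTorus.lie_le {G T : Subgroup (GL (Fin n) ℂ)}
    (hG : IsZariskiClosed ℂ (G : Set (GL (Fin n) ℂ))) (hT : IsMaximalTorus T G) :
    lie T ≤ lie G := by
  obtain ⟨⟨d, hd⟩, hTG, -⟩ := hT
  exact fun B hB => (mem_lie_iff hG).2 fun z => hTG ((mem_lie_iff hd.1.complex).1 hB z)

/-- The centraliser of `lie T` in `lie G` meets the orthogonal complement of `lie T` under the trace
form in nilpotent matrices only: both spaces are defined over `ℚ`, and the semisimple part of a
rational matrix in the intersection lies in `lie T` and is orthogonal to it. -/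
lemma IsMaximalTorus.isNilpotent_of_trace {G T : Subgroup (GL (Fin n) ℂ)}
    (hG : IsZariskiClosed ℚ (G : Set (GL (Fin n) ℂ))) (hT : IsMaximalTorus T G)
    {A : Matrix (Fin n) (Fin n) ℂ} (hA : A ∈ lie G) (hcomm : ∀ B ∈ lie T, Commute A B)
    (htr : ∀ B ∈ lie T, (A * B).trace = 0) : IsNilpotent A := by
  have hTcl : IsZariskiClosed ℚ (T : Set (GL (Fin n) ℂ)) := hT.1.choose_spec.1
  let W : Submodule ℂ (Matrix (Fin n) (Fin n) ℂ) :=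
    { carrier := {X | X ∈ lie G ∧ ∀ B ∈ lie T, Commute X B ∧ (X * B).trace = 0}
      add_mem' := fun {X Y} hX hY => ⟨add_mem hX.1 hY.1, fun B hB =>
        ⟨(hX.2 B hB).1.add_left (hY.2 B hB).1, by
          rw [add_mul, Matrix.trace_add, (hX.2 B hB).2, (hY.2 B hB).2, add_zero]⟩⟩
      zero_mem' := ⟨zero_mem _, fun B _ => ⟨Commute.zero_left B, by simp⟩⟩
      smul_mem' := fun c X hX => ⟨Submodule.smul_mem _ c hX.1, fun B hB =>
        ⟨(hX.2 B hB).1.smul_left c, by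
          rw [smul_mul_assoc, Matrix.trace_smul, (hX.2 B hB).2, smul_zero]⟩⟩ }
  have hWgal : ∀ σ : ℂ ≃ₐ[ℚ] ℂ, ∀ X ∈ W, gal σ X ∈ W := by
    intro σ X hX
    refine ⟨gal_mem_lie hG σ hX.1, fun B hB => ?_⟩
    obtain ⟨h1, h2⟩ := hX.2 _ (gal_mem_lie hTcl σ⁻¹ hB)
    rw [← gal_gal_inv σ B]
    exact ⟨commute_gal h1 σ, by rw [← gal_mul, trace_gal, h2, map_zero]⟩
  refine isNilpotent_of_mem_span (W := W) (fun X hX => ?_)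
    (mem_span_rational_matrix hWgal ⟨hA, fun B hB => ⟨hcomm B hB, htr B hB⟩⟩)
  obtain ⟨p, q, hq, hS, hN⟩ := exists_jordan X
  let φ : Matrix (Fin n) (Fin n) ℚ →ₐ[ℚ] Matrix (Fin n) (Fin n) ℂ :=
    (Algebra.ofId ℚ ℂ).mapMatrix
  have hφ : ∀ Y, φ Y = Y.map (algebraMap ℚ ℂ) := fun Y => rfl
  have hφS : φ (Polynomial.aeval X p) = Polynomial.aeval (φ X) p :=
    (Polynomial.aeval_algHom_apply φ X p).symm
  have hcommS : ∀ B, Commute (φ X) B → Commute (φ (Polynomial.aeval X p)) B := by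
    intro B hB
    rw [hφS]
    have h1 := Algebra.commute_of_mem_adjoin_singleton_of_commute
      (Polynomial.aeval_mem_adjoin_singleton ℚ (φ X) (p := p)) hB.symm
    exact h1.symm
  have hNφ : IsNilpotent (φ X - φ (Polynomial.aeval X p)) := by
    rw [← map_sub]
    exact hN.map φ
  obtain ⟨P, hP⟩ := exists_forall_eq_diagConj (F := {φ (Polynomial.aeval X p)})
    (by rintro A rfl B rfl; exact Commute.refl _)
    (by
      rintro A rfl
      refine ⟨q.map (algebraMap ℚ ℂ), (hq.map).squarefree, ?_⟩
      rw [Polynomial.aeval_map_algebraMap]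
      rw [Polynomial.aeval_algHom_apply φ, hS, map_zero])
  obtain ⟨v, hv⟩ := hP _ rfl
  have hSG : φ (Polynomial.aeval X p) ∈ lie G := by
    rw [hv]
    refine diagConj_mem_lie_of_add hG.complex hNφ ?_ ?_
    · rw [← hv]
      exact (hcommS _ (Commute.refl _)).sub_right (Commute.refl _)
    · rw [← hv, add_sub_cancel]
      exact hX.1
  have hST := hT.mem_lie_of_rational hG hSG ⟨P, v, hv⟩ (fun σ => gal_eq_of_rational σ _)
    fun B hB => hcommS B (hX.2 B hB).1
  obtain ⟨d, hd⟩ := hT.1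
  have hS0 : φ (Polynomial.aeval X p) = 0 := hd.eq_zero_of_trace hST fun B hB => by
    have h1 : Commute (φ X - φ (Polynomial.aeval X p)) B :=
      (hX.2 B hB).1.sub_left (hcommS B (hX.2 B hB).1)
    have h2 := trace_eq_zero_of_isNilpotent (h1.isNilpotent_mul_right hNφ)
    rw [sub_mul, Matrix.trace_sub] at h2
    exact (sub_eq_zero.1 h2).symm.trans (hX.2 B hB).2
  rw [hS0, sub_zero] at hNφ
  exact (IsNilpotent.map_iff (f := φ) (Matrix.map_injective (algebraMap ℚ ℂ).injective)).1 hNφ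

/-- A diagonalisable element of `lie G` that commutes with the Lie algebra of a maximal `ℚ`-torus
`T` lies in `lie T`: the difference to its orthogonal projection to `lie T` is both nilpotent and
diagonalisable. -/
theorem IsMaximalTorus.mem_lie_of_commute {G T : Subgroup (GL (Fin n) ℂ)}
    (hG : IsZariskiClosed ℚ (G : Set (GL (Fin n) ℂ))) (hT : IsMaximalTorus T G)
    {A : Matrix (Fin n) (Fin n) ℂ} (hA : A ∈ lie G) (hAd : ∃ P v, A = diagConj P v)
    (hcomm : ∀ B ∈ lie T, Commute A B) : A ∈ lie T := by
  obtain ⟨d, hd⟩ := hT.1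
  -- `B` is the orthogonal projection of `A` to `lie T`.
  let f : lie T →ₗ[ℂ] Module.Dual ℂ (lie T) := LinearMap.mk₂ ℂ
    (fun B C => ((B : Matrix (Fin n) (Fin n) ℂ) * C).trace)
    (fun B B' C => by simp [add_mul]) (fun c B C => by simp)
    (fun B C C' => by simp [mul_add]) (fun c B C => by simp)
  have hf : Function.Injective f := by
    refine (injective_iff_map_eq_zero f).2 fun B hB => Subtype.ext ?_
    exact hd.eq_zero_of_trace B.2 fun C hC => LinearMap.congr_fun hB ⟨C, hC⟩
  have hf' : Function.Surjective f :=
    (LinearMap.injective_iff_surjective_of_finrank_eq_finrank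
      (Subspace.dual_finrank_eq).symm).1 hf
  obtain ⟨B, hB⟩ := hf' ((Matrix.traceLinearMap (Fin n) ℂ ℂ).comp
    ((LinearMap.mulLeft ℂ A).comp (lie T).subtype))
  have hBtr : ∀ C ∈ lie T, ((B : Matrix (Fin n) (Fin n) ℂ) * C).trace = (A * C).trace :=
    fun C hC => LinearMap.congr_fun hB ⟨C, hC⟩
  have hcommT : ∀ C ∈ lie T, Commute (B : Matrix (Fin n) (Fin n) ℂ) C := by
    intro C hC
    obtain ⟨P, χ, hlie, -, -⟩ := hd.exists_torusLie
    obtain ⟨u, hu⟩ := (hlie _).1 B.2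
    obtain ⟨w, hw⟩ := (hlie _).1 hC
    rw [hu, hw]
    exact diagConj_commute _ _ _
  have hnil : IsNilpotent (A - B) := hT.isNilpotent_of_trace hG
    (sub_mem hA (hT.lie_le hG.complex B.2))
    (fun C hC => (hcomm C hC).sub_left (hcommT C hC))
    (fun C hC => by rw [sub_mul, Matrix.trace_sub, hBtr C hC, sub_self])
  obtain ⟨P, hP⟩ := exists_forall_eq_diagConj (F := {A, (B : Matrix (Fin n) (Fin n) ℂ)})
    (by
      rintro X (rfl | rfl) Y (rfl | rfl)
      · exact Commute.refl _
      · exact hcomm _ B.2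
      · exact (hcomm _ B.2).symm
      · exact Commute.refl _)
    (by
      rintro X (rfl | rfl)
      · obtain ⟨Q, v, rfl⟩ := hAd
        exact exists_squarefree_aeval_diagConj Q v
      · obtain ⟨Q, χ, hlie, -, -⟩ := hd.exists_torusLie
        obtain ⟨u, hu⟩ := (hlie _).1 B.2
        rw [hu]
        exact exists_squarefree_aeval_diagConj _ _)
  obtain ⟨v, hv⟩ := hP A (Or.inl rfl)
  obtain ⟨w, hw⟩ := hP B (Or.inr rfl)
  rw [hv, hw, ← diagConj_sub] at hnil
  have h1 := eq_zero_of_isNilpotent_diagConj hnil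
  rw [hv, sub_eq_zero.1 h1, ← hw]
  exact B.2

/-! ### The Galois action on the cocharacters of a torus -/

/-- **Minkowski's lemma**: an integral matrix `g` that preserves a positive definite integral
quadratic form and is congruent to `1` modulo `3` is trivial. The form is given here as a sum of
squares of linear forms. With `g = 1 + 3h`, the form decreases under `h`; so inductively
`h (h x) = 0`, and the values of the form on `x`, `g x = x + 3 h x` and `g (g x) = x + 6 h x` can
agree only if `h x = 0`. -/
lemma eq_zero_of_isometry {L : Type*} [AddCommGroup L] (f : L →+ (Fin n → ℤ))
    (hf : Function.Injective f) (h : L →+ L)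
    (hiso : ∀ x, f (x + 3 • h x) ⬝ᵥ f (x + 3 • h x) = f x ⬝ᵥ f x) (x : L) : h x = 0 := by
  have hpos : ∀ v : Fin n → ℤ, 0 ≤ v ⬝ᵥ v := fun v =>
    Finset.sum_nonneg fun i _ => mul_self_nonneg (v i)
  have hzero : ∀ y, f y ⬝ᵥ f y ≤ 0 → y = 0 := by
    intro y hy
    have h1 := dotProduct_self_eq_zero.1 (le_antisymm hy (hpos _))
    exact hf (h1.trans (map_zero f).symm)
  have hexpand : ∀ x, 6 * (f x ⬝ᵥ f (h x)) + 9 * (f (h x) ⬝ᵥ f (h x)) = 0 := by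
    intro x
    have h1 := hiso x
    rw [map_add, map_nsmul, add_dotProduct, dotProduct_add, dotProduct_add, smul_dotProduct,
      dotProduct_smul, smul_dotProduct, dotProduct_smul, dotProduct_comm (f (h x)) (f x)] at h1
    simp only [nsmul_eq_mul, Nat.cast_ofNat] at h1
    linarith
  have key : ∀ k : ℕ, ∀ x, f x ⬝ᵥ f x ≤ k → h x = 0 := by
    intro k
    induction k with
    | zero =>
      intro x hx
      rw [hzero x (by exact_mod_cast hx), map_zero]
    | succ k ih =>
      intro x hx
      have h1 := hexpand x
      by_cases hlt : f (h x) ⬝ᵥ f (h x) ≤ k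
      · have h2 := ih (h x) hlt
        have h3 := hexpand (x + 3 • h x)
        rw [map_add h, map_nsmul h, h2, smul_zero, add_zero, map_add, map_nsmul, add_dotProduct,
          smul_dotProduct, nsmul_eq_mul, Nat.cast_ofNat] at h3
        exact hzero _ (by linarith)
      · -- Here `9 q(h x) = q(g x - x) ≤ 2 q(g x) + 2 q(x) = 4 q(x)`, so `q(h x) ≤ k`.
        exfalso
        have h4 := hpos (2 • f x + 3 • f (h x))
        rw [add_dotProduct, dotProduct_add, dotProduct_add, smul_dotProduct,
          dotProduct_smul, smul_dotProduct, dotProduct_smul, smul_dotProduct, dotProduct_smul,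
          smul_dotProduct, dotProduct_smul, dotProduct_comm (f (h x)) (f x)] at h4
        simp only [nsmul_eq_mul, Nat.cast_ofNat] at h4
        push_cast at hx
        have := hpos (f x)
        omega
  exact key (f x ⬝ᵥ f x).toNat x (Int.self_le_toNat _)

lemma expGL_two_pi_I_smul_diagConj (P : GL (Fin n) ℂ) (m : Fin n → ℤ) :
    expGL ((2 * Real.pi * Complex.I : ℂ) • diagConj P fun i => (m i : ℂ)) = 1 := by
  rw [← diagConj_smul, expGL_diagConj]
  have h1 : (fun i => expU (((2 * Real.pi * Complex.I : ℂ) • fun i => (m i : ℂ)) i)) = 1 := by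
    funext i
    refine Units.ext ?_
    rw [coe_expU, Pi.smul_apply, smul_eq_mul, mul_comm, Complex.exp_int_mul_two_pi_mul_I]
    rfl
  rw [h1, map_one]

lemma torusLie_intCast {d : ℕ} (P : GL (Fin n) ℂ) (χ : Fin n → Fin d → ℤ) (x : Fin d → ℤ) :
    torusLie P χ (fun k => (x k : ℂ)) =
      diagConj P fun i => ((Matrix.mulVec (Matrix.of χ) x i : ℤ) : ℂ) := by
  rw [torusLie]
  congr 1
  funext i
  simp [Matrix.mulVec, dotProduct]

/-- `Aut(ℂ/ℚ)` acts on the cocharacters of a torus of dimension `d`, here the elements `A` of its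
Lie algebra with `exp(2πiA) = 1`, through a finite group of order at most `3 ^ (d ^ 2)`: the
action on the lattice `ℤ^d` of the cocharacters preserves the positive definite form `tr(A ^ 2)`,
so it is faithful modulo `3`. -/
theorem IsTorusOfDim.exists_subgroup {T : Subgroup (GL (Fin n) ℂ)} {d : ℕ}
    (hT : IsTorusOfDim T d) : ∃ N : Subgroup (ℂ ≃ₐ[ℚ] ℂ), N.Normal ∧ N.FiniteIndex ∧
      N.index ≤ 3 ^ (d ^ 2) ∧ (IntermediateField.fixedField N).fixingSubgroup ≤ N ∧
      ∀ σ ∈ N, ∀ A ∈ lie T, expGL ((2 * Real.pi * Complex.I : ℂ) • A) = 1 → gal σ A = A := by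
  obtain ⟨P, χ, hlie, -, hint⟩ := hT.exists_torusLie
  have hinj := torusLieHom_injective hint
  -- `t` identifies `ℤ^d` with the cocharacters, and `R σ` is the matrix of the action of `σ`.
  let t : (Fin d → ℤ) → Matrix (Fin n) (Fin n) ℂ := fun x => torusLie P χ fun k => (x k : ℂ)
  have ht : ∀ x y, t x = t y → x = y := by
    intro x y hxy
    have h1 := hinj hxy
    funext k
    exact_mod_cast congrFun h1 k
  have htadd : ∀ x y, t (x + y) = t x + t y := by
    intro x y
    change torusLie P χ _ = torusLie P χ _ + torusLie P χ _
    rw [← torusLie_add]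
    congr 1
    funext k
    simp
  have htsum : ∀ x : Fin d → ℤ, t x = ∑ k, (x k : ℂ) • t (Pi.single k 1) := by
    intro x
    change torusLieHom P χ _ = ∑ k, (x k : ℂ) • torusLieHom P χ _
    simp only [← map_smul, ← map_sum]
    congr 1
    funext l
    simp [Finset.sum_apply, Pi.single_apply]
  have hsingle : ∀ σ : ℂ ≃ₐ[ℚ] ℂ, ∀ k, ∃ m : Fin d → ℤ, gal σ (t (Pi.single k 1)) = t m := by
    intro σ k
    obtain ⟨u, hu⟩ := (hlie _).1 (gal_mem_lie hT.1 σ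
      ((hlie _).2 ⟨_, rfl⟩ : t (Pi.single k 1) ∈ lie T))
    obtain ⟨m, hm⟩ := hint u (by
      rw [← hu]
      change expGL (_ • gal σ (torusLie P χ _)) = 1
      rw [torusLie_intCast, gal_diagConj]
      simp only [map_intCast]
      exact expGL_two_pi_I_smul_diagConj _ _)
    exact ⟨m, by rw [hu, hm]⟩
  choose m hm using hsingle
  let R : (ℂ ≃ₐ[ℚ] ℂ) → Matrix (Fin d) (Fin d) ℤ := fun σ => Matrix.of fun l k => m σ k l
  have hR : ∀ σ x, gal σ (t x) = t ((R σ).mulVec x) := by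
    intro σ x
    have h1 : gal σ (∑ k, (x k : ℂ) • t (Pi.single k 1)) =
        ∑ k, (x k : ℂ) • gal σ (t (Pi.single k 1)) := by
      ext i j
      rw [gal_apply, Matrix.sum_apply, map_sum, Matrix.sum_apply]
      refine Finset.sum_congr rfl fun k _ => ?_
      rw [Matrix.smul_apply, Matrix.smul_apply, gal_apply, smul_eq_mul, smul_eq_mul, map_mul,
        map_intCast]
    rw [htsum x, h1]
    simp only [hm]
    change ∑ k, (x k : ℂ) • torusLieHom P χ _ = torusLieHom P χ _
    simp only [← map_smul, ← map_sum]
    congr 1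
    funext l
    simp [Finset.sum_apply, R, Matrix.mulVec, dotProduct, mul_comm]
  let ρ : (ℂ ≃ₐ[ℚ] ℂ) →* Matrix (Fin d) (Fin d) ℤ :=
    { toFun := R
      map_one' := Matrix.ext_of_mulVec_single fun k => ht _ _ (by
        rw [← hR, gal_one, Matrix.one_mulVec])
      map_mul' := fun σ τ => Matrix.ext_of_mulVec_single fun k => ht _ _ (by
        rw [← hR, gal_comp, hR, hR, Matrix.mulVec_mulVec]) }
  let f : (ℂ ≃ₐ[ℚ] ℂ) →* (Matrix (Fin d) (Fin d) (ZMod 3))ˣ :=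
    ((Int.castRingHom (ZMod 3)).mapMatrix.toMonoidHom.comp ρ).toHomUnits
  have hker : ∀ σ ∈ f.ker, R σ = 1 := by
    intro σ hσ
    have h1 : (Int.castRingHom (ZMod 3)).mapMatrix (R σ) = 1 := congrArg Units.val hσ
    have h2 : ∀ l k, ∃ c : ℤ, R σ l k = (1 : Matrix (Fin d) (Fin d) ℤ) l k + 3 * c := by
      intro l k
      have h3 : ((R σ l k : ℤ) : ZMod 3) = (((1 : Matrix (Fin d) (Fin d) ℤ) l k : ℤ) : ZMod 3) := by
        have h4 := congrFun (congrFun (h1.trans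
          (map_one (Int.castRingHom (ZMod 3)).mapMatrix).symm) l) k
        exact h4
      obtain ⟨c, hc⟩ := (ZMod.intCast_eq_intCast_iff_dvd_sub _ _ 3).1 h3.symm
      exact ⟨c, by push_cast at hc; linarith⟩
    choose H hH using h2
    have hRH : R σ = 1 + (3 : ℤ) • Matrix.of H := by
      ext l k
      rw [hH]
      simp
    have hgx : ∀ x, (R σ).mulVec x = x + 3 • (Matrix.of H).mulVec x := by
      intro x
      rw [hRH, Matrix.add_mulVec, Matrix.one_mulVec, Matrix.smul_mulVec]
      rfl
    have htr : ∀ x, (t x * t x).trace =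
        (((Matrix.of χ).mulVec x ⬝ᵥ (Matrix.of χ).mulVec x : ℤ) : ℂ) := by
      intro x
      change (torusLie P χ _ * torusLie P χ _).trace = _
      rw [torusLie_intCast, diagConj_mul, trace_diagConj]
      simp [dotProduct]
    have hinjχ : Function.Injective (Matrix.mulVecLin (Matrix.of χ)).toAddMonoidHom := by
      intro x y hxy
      refine ht x y ?_
      change torusLie P χ _ = torusLie P χ _
      rw [torusLie_intCast, torusLie_intCast]
      exact congrArg (fun v : Fin n → ℤ => diagConj P fun i => ((v i : ℤ) : ℂ)) hxy
    have hH0 := eq_zero_of_isometry _ hinjχ (Matrix.mulVecLin (Matrix.of H)).toAddMonoidHom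
      (fun x => by
        have h5 : (Matrix.of χ).mulVec ((R σ).mulVec x) ⬝ᵥ (Matrix.of χ).mulVec ((R σ).mulVec x) =
            (Matrix.of χ).mulVec x ⬝ᵥ (Matrix.of χ).mulVec x := by
          have h6 := htr ((R σ).mulVec x)
          rw [← hR, ← gal_mul, trace_gal, htr, map_intCast] at h6
          exact_mod_cast h6.symm
        rw [hgx] at h5
        exact h5)
    refine Matrix.ext_of_mulVec_single fun k => ?_
    have h7 : (Matrix.of H).mulVec (Pi.single k 1) = 0 := hH0 _
    rw [hgx, h7, smul_zero, add_zero, Matrix.one_mulVec]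
  have hfix : ∀ σ : ℂ ≃ₐ[ℚ] ℂ, (∀ k, gal σ (t (Pi.single k 1)) = t (Pi.single k 1)) → R σ = 1 := by
    intro σ hσ
    refine Matrix.ext_of_mulVec_single fun k => ht _ _ ?_
    rw [← hR, hσ, Matrix.one_mulVec]
  have hfin : Finite f.range := inferInstance
  refine ⟨f.ker, inferInstance, ⟨?_⟩, ?_, fun σ hσ => ?_, fun σ hσ A hA hAint => ?_⟩
  · rw [Subgroup.index_ker]
    exact Nat.card_pos.ne'
  · rw [Subgroup.index_ker]
    refine (Nat.card_le_card_of_injective _ Subtype.val_injective).trans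
      ((Nat.card_le_card_of_injective _ Units.val_injective).trans ?_)
    change Nat.card (Fin d → Fin d → ZMod 3) ≤ _
    rw [Nat.card_fun, Nat.card_fun, Nat.card_zmod, Nat.card_fin, ← pow_mul, pow_two]
  · have h1 : R σ = 1 := by
      refine hfix σ fun k => ?_
      ext i j
      rw [gal_apply]
      have h2 : t (Pi.single k 1) i j ∈ IntermediateField.fixedField f.ker := by
        intro τ
        have h3 := hR τ (Pi.single k 1)
        rw [hker _ τ.2, Matrix.one_mulVec] at h3
        exact congrFun (congrFun h3 i) j
      exact (IntermediateField.mem_fixingSubgroup_iff _ _).1 hσ _ h2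
    refine Units.ext ?_
    change (Int.castRingHom (ZMod 3)).mapMatrix (R σ) = 1
    rw [h1, map_one]
  · obtain ⟨u, rfl⟩ := (hlie A).1 hA
    obtain ⟨x, rfl⟩ := hint u hAint
    have h1 := hR σ x
    rwa [hker σ hσ, Matrix.one_mulVec] at h1

/-! ### Existence and size of maximal tori -/

/-- A diagonalisable element of the Lie algebra of a torus `T` whose centraliser is that of
`lie T`: its coordinates are linearly independent over `ℚ`, so distinct weights of `T` take distinct
values on it. -/
lemma IsTorusOfDim.exists_generic {T : Subgroup (GL (Fin n) ℂ)} {d : ℕ} (hT : IsTorusOfDim T d) :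
    ∃ B ∈ lie T, (∃ P v, B = diagConj P v) ∧ ∀ A, Commute B A → ∀ C ∈ lie T, Commute A C := by
  obtain ⟨P, χ, hlie, -, -⟩ := hT.exists_torusLie
  obtain ⟨u, hu⟩ : ∃ u : Fin d → ℂ, LinearIndependent ℚ u := by
    rw [← Module.le_rank_iff, Complex.rank_rat_complex]
    exact (Cardinal.natCast_lt_aleph0.trans Cardinal.aleph0_lt_continuum).le
  have hχ : ∀ i j, ∑ k, (χ i k : ℂ) * u k = ∑ k, (χ j k : ℂ) * u k → χ i = χ j := by
    intro i j hij
    funext k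
    have h1 := Fintype.linearIndependent_iff.1 hu (fun k => (χ i k : ℚ) - χ j k) (by
      rw [← sub_eq_zero, ← Finset.sum_sub_distrib] at hij
      rw [← hij]
      refine Finset.sum_congr rfl fun k _ => ?_
      rw [Algebra.smul_def]
      simp
      ring) k
    exact_mod_cast sub_eq_zero.1 h1
  refine ⟨torusLie P χ u, (hlie _).2 ⟨u, rfl⟩, ⟨P, _, rfl⟩, fun A hA C hC => ?_⟩
  obtain ⟨w, rfl⟩ := (hlie C).1 hC
  -- `D` is `A` in a basis of common eigenvectors of `T`.
  obtain ⟨D, rfl⟩ : ∃ D, A = Ad P D := ⟨Ad P⁻¹ A, (Ad_Ad_inv P A).symm⟩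
  have hD : ∀ v, Commute (diagConj P v) (Ad P D) ↔ ∀ i j, v i * D i j = D i j * v j := by
    intro v
    have hinj : Function.Injective (Ad P) := Function.LeftInverse.injective (Ad_inv_Ad P)
    rw [Commute, SemiconjBy, diagConj, ← Ad_mul_mul, ← Ad_mul_mul, hinj.eq_iff, ← Matrix.ext_iff]
    simp only [Matrix.diagonal_mul, Matrix.mul_diagonal]
  refine ((hD _).2 fun i j => ?_).symm
  by_cases h0 : D i j = 0
  · rw [h0, mul_zero, zero_mul]
  · have h1 := (hD _).1 hA i j
    rw [mul_comm] at h1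
    rw [hχ i j (mul_left_cancel₀ h0 h1), mul_comm]

lemma IsTorusOfDim.dim_le {T : Subgroup (GL (Fin n) ℂ)} {d : ℕ} (hT : IsTorusOfDim T d) :
    d ≤ n ^ 2 := by
  obtain ⟨P, χ, -, -, hint⟩ := hT.exists_torusLie
  have h1 := LinearMap.finrank_le_finrank_of_injective (torusLieHom_injective hint)
  rwa [Module.finrank_fin_fun, Module.finrank_matrix, Module.finrank_self, Fintype.card_fin,
    mul_one, ← pow_two] at h1

/-- A `ℚ`-torus in `G` whose Lie algebra has the largest possible dimension is maximal. -/
lemma exists_isMaximalTorus {G : Subgroup (GL (Fin n) ℂ)}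
    (hG : IsZariskiClosed ℚ (G : Set (GL (Fin n) ℂ))) : ∃ T, IsMaximalTorus T G := by
  have hexp0 : ∀ v ∈ (⊥ : Submodule ℂ (Fin n → ℂ)), diagConj (1 : GL (Fin n) ℂ) v = 0 := by
    intro v hv
    rw [(Submodule.mem_bot ℂ).1 hv, diagConj_zero]
  have h1 : IsTorus (torusOf (1 : GL (Fin n) ℂ) ⊥) := isTorus_torusOf fun σ v hv =>
    ⟨v, hv, by rw [hexp0 v hv, gal_zero]⟩
  have h2 : torusOf (1 : GL (Fin n) ℂ) ⊥ ≤ G := torusOf_le hG.complex fun v hv => by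
    rw [hexp0 v hv, expGL_zero]
    exact G.one_mem
  -- The codimension of the Lie algebra, to be minimised.
  let m : Subgroup (GL (Fin n) ℂ) → ℕ := fun T =>
    Module.finrank ℂ (Matrix (Fin n) (Fin n) ℂ) - Module.finrank ℂ (lie T)
  obtain ⟨T, ⟨hT, hTG⟩, hmin⟩ := WellFounded.has_min (measure m).wf
    {T | IsTorus T ∧ T ≤ G} ⟨_, h1, h2⟩
  refine ⟨T, hT, hTG, fun T' hT' hle hT'G => le_antisymm ?_ hle⟩
  have h3 : ¬ m T' < m T := hmin T' ⟨hT', hT'G⟩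
  obtain ⟨d, hd⟩ := hT
  obtain ⟨d', hd'⟩ := hT'
  have h4 : lie T ≤ lie T' := fun A hA => (mem_lie_iff hd'.1.complex).2 fun z =>
    hle ((mem_lie_iff hd.1.complex).1 hA z)
  have h5 : lie T = lie T' := by
    refine Submodule.eq_of_le_of_finrank_le h4 ?_
    have h6 := Submodule.finrank_le (lie T')
    simp only [m] at h3
    omega
  intro g hg
  obtain ⟨P, χ, hlie, hexp, -⟩ := hd'.exists_torusLie
  obtain ⟨u, rfl⟩ := hexp g hg
  refine expGL_mem hd.1.complex ?_
  rw [h5]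
  exact (hlie _).2 ⟨u, rfl⟩

/-! ### The stabiliser of the class of cocharacters and the reflex field -/

lemma galoisAct_mul (σ τ : ℂ ≃ₐ[ℚ] ℂ) (ν : ℂˣ →* GL (Fin n) ℂ) :
    galoisAct (σ * τ) ν = galoisAct σ (galoisAct τ ν) := by
  refine MonoidHom.ext fun t => Units.ext (Matrix.ext fun i j => ?_)
  rfl

lemma galoisAct_one (ν : ℂˣ →* GL (Fin n) ℂ) : galoisAct 1 ν = ν := by
  refine MonoidHom.ext fun t => Units.ext (Matrix.ext fun i j => ?_)
  rfl

lemma conjHom_mul (g h : GL (Fin n) ℂ) (ν : ℂˣ →* GL (Fin n) ℂ) :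
    conjHom (g * h) ν = conjHom g (conjHom h ν) := by
  refine MonoidHom.ext fun t => ?_
  simp [conjHom, mul_assoc]

lemma mu_conjHom (g : GL (Fin n) ℂ) (h : (Fin 2 → ℂˣ) →* GL (Fin n) ℂ) :
    mu (conjHom g h) = conjHom g (mu h) := rfl

namespace ShimuraDatum

/-- The stabiliser in `Aut(ℂ/ℚ)` of the conjugacy class of the `μ_h`. -/
def stabilizer (D : ShimuraDatum n) : Subgroup (ℂ ≃ₐ[ℚ] ℂ) where
  carrier := {σ | galoisAct σ '' D.cocharClass = D.cocharClass}
  mul_mem' := fun {σ τ} hσ hτ => by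
    have h1 : galoisAct (n := n) (σ * τ) = galoisAct σ ∘ galoisAct τ := funext (galoisAct_mul σ τ)
    change galoisAct (σ * τ) '' _ = _
    rw [h1, Set.image_comp, hτ, hσ]
  one_mem' := by
    change galoisAct 1 '' _ = _
    rw [show galoisAct (n := n) 1 = id from funext galoisAct_one, Set.image_id]
  inv_mem' := fun {σ} hσ => by
    change galoisAct σ⁻¹ '' _ = _
    conv_lhs => rw [← show galoisAct σ '' _ = D.cocharClass from hσ]
    rw [← Set.image_comp, ← show galoisAct (n := n) (σ⁻¹ * σ) = galoisAct σ⁻¹ ∘ galoisAct σ from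
      funext (galoisAct_mul _ σ), inv_mul_cancel,
      show galoisAct (n := n) 1 = id from funext galoisAct_one, Set.image_id]

lemma mem_stabilizer {D : ShimuraDatum n} {σ : ℂ ≃ₐ[ℚ] ℂ} :
    σ ∈ D.stabilizer ↔ galoisAct σ '' D.cocharClass = D.cocharClass := Iff.rfl

lemma mu_mem_cocharClass (D : ShimuraDatum n) {h : (Fin 2 → ℂˣ) →* GL (Fin n) ℂ} (hh : h ∈ D.X) :
    mu h ∈ D.cocharClass := by
  refine ⟨h, hh, 1, D.G.one_mem, MonoidHom.ext fun t => ?_⟩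
  simp [conjHom]

/-- The class of the `μ_h` is the orbit of each of its elements. -/
lemma exists_conjHom_of_mem_cocharClass (D : ShimuraDatum n) {ν ν' : ℂˣ →* GL (Fin n) ℂ}
    (hν : ν ∈ D.cocharClass) (hν' : ν' ∈ D.cocharClass) : ∃ g ∈ D.G, ν' = conjHom g ν := by
  obtain ⟨h₀, -, hX⟩ := D.isConjClass
  have key : ∀ ν ∈ D.cocharClass, ∃ g ∈ D.G, ν = conjHom g (mu h₀) := by
    rintro _ ⟨h, hh, g, hg, rfl⟩
    rw [hX] at hh
    obtain ⟨k, hk, -, rfl⟩ := hh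
    exact ⟨g * k, D.G.mul_mem hg hk, by rw [mu_conjHom, conjHom_mul]⟩
  obtain ⟨g, hg, rfl⟩ := key ν hν
  obtain ⟨k, hk, rfl⟩ := key ν' hν'
  exact ⟨k * g⁻¹, D.G.mul_mem hk (D.G.inv_mem hg), by
    rw [← conjHom_mul, inv_mul_cancel_right]⟩

lemma conjHom_mem_cocharClass (D : ShimuraDatum n) {ν : ℂˣ →* GL (Fin n) ℂ}
    (hν : ν ∈ D.cocharClass) {g : GL (Fin n) ℂ} (hg : g ∈ D.G) :
    conjHom g ν ∈ D.cocharClass := by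
  obtain ⟨h, hh, k, hk, rfl⟩ := hν
  exact ⟨h, hh, g * k, D.G.mul_mem hg hk, by rw [conjHom_mul]⟩

/-- To stabilise the class, it is enough to map one element of the class into the class. -/
lemma mem_stabilizer_of_galoisAct_mem (D : ShimuraDatum n) {σ : ℂ ≃ₐ[ℚ] ℂ}
    {ν : ℂˣ →* GL (Fin n) ℂ} (hν : ν ∈ D.cocharClass) (hσν : galoisAct σ ν ∈ D.cocharClass) :
    σ ∈ D.stabilizer := by
  refine mem_stabilizer.2 (Set.Subset.antisymm ?_ fun ν' hν' => ?_)
  · rintro _ ⟨ν', hν', rfl⟩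
    obtain ⟨g, hg, rfl⟩ := D.exists_conjHom_of_mem_cocharClass hν hν'
    rw [galoisAct_conjHom]
    exact D.conjHom_mem_cocharClass hσν (D.isClosed.mapGL_mem σ hg)
  · obtain ⟨g, hg, rfl⟩ := D.exists_conjHom_of_mem_cocharClass hσν hν'
    refine ⟨conjHom (mapGL ((σ⁻¹ : ℂ ≃ₐ[ℚ] ℂ) : ℂ →+* ℂ) g) ν,
      D.conjHom_mem_cocharClass hν (D.isClosed.mapGL_mem σ⁻¹ hg), ?_⟩
    rw [galoisAct_conjHom]
    congr 1
    exact Units.ext (gal_gal_inv σ _)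

/-- The class of the `μ_h` contains a cocharacter of a given maximal `ℚ`-torus `T`: the derivative
of `μ_h` has a conjugate that commutes with a generic element of `lie T`. -/
lemma exists_cochar_mem_cocharClass (D : ShimuraDatum n) {T : Subgroup (GL (Fin n) ℂ)}
    (hT : IsMaximalTorus T D.G) : ∃ P m, cochar P m ∈ D.cocharClass ∧
      (diagConj P fun i => (m i : ℂ)) ∈ lie T := by
  obtain ⟨h, hh, -⟩ := D.isConjClass
  obtain ⟨halg, hG, -⟩ := D.isDeligneHom h hh
  obtain ⟨P, m, hm⟩ := exists_mu_eq_cochar halg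
  have hcl := D.isClosed.complex
  have hA : (diagConj P fun i => (m i : ℂ)) ∈ lie D.G := by
    refine (mem_lie_iff hcl).2 fun z => ?_
    rw [← cochar_expU, ← hm]
    exact hG _
  obtain ⟨d, hd⟩ := hT.1
  obtain ⟨B, hB, hBd, hgen⟩ := hd.exists_generic
  obtain ⟨g, hg, hcomm⟩ := exists_Ad_commute hcl hA (hT.lie_le hcl hB) ⟨P, _, rfl⟩ hBd
  refine ⟨g * P, m, ?_, ?_⟩
  · rw [← conjHom_cochar, ← hm]
    exact D.conjHom_mem_cocharClass (D.mu_mem_cocharClass hh) hg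
  · rw [← Ad_diagConj]
    exact hT.mem_lie_of_commute D.isClosed (Ad_mem_lie hcl hg hA)
      ⟨g * P, _, Ad_diagConj _ _ _⟩ (hgen _ hcomm)

/-- The stabiliser of the class of the `μ_h` is the Galois group of its fixed field, whose degree is
bounded in terms of the dimension `d` of a maximal `ℚ`-torus. -/
theorem fixingSubgroup_fixedField_stabilizer (D : ShimuraDatum n) {T : Subgroup (GL (Fin n) ℂ)}
    (hT : IsMaximalTorus T D.G) {d : ℕ} (hd : IsTorusOfDim T d) :
    (IntermediateField.fixedField D.stabilizer).fixingSubgroup = D.stabilizer ∧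
      Module.rank ℚ (IntermediateField.fixedField D.stabilizer) ≤
        ((3 ^ (d ^ 2) : ℕ) : Cardinal) := by
  obtain ⟨P, m, hmem, hlie⟩ := D.exists_cochar_mem_cocharClass hT
  obtain ⟨N, hN, hfin, hindex, hclosed, hfix⟩ := hd.exists_subgroup
  have hle : N ≤ D.stabilizer := by
    intro σ hσ
    refine D.mem_stabilizer_of_galoisAct_mem hmem ?_
    have h1 := hfix σ hσ _ hlie (expGL_two_pi_I_smul_diagConj P m)
    rw [gal_diagConj] at h1
    simp only [map_intCast] at h1
    rwa [galoisAct_cochar, cochar_eq_of_diagConj_eq h1]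
  obtain ⟨h1, h2⟩ := fixingSubgroup_fixedField_of_le hclosed hle
  exact ⟨h1, h2.trans (Nat.cast_le.2 hindex)⟩

lemma reflexField_le_fixedField (D : ShimuraDatum n) {T : Subgroup (GL (Fin n) ℂ)}
    (hT : IsMaximalTorus T D.G) :
    D.reflexField ≤ IntermediateField.fixedField D.stabilizer := by
  obtain ⟨d, hd⟩ := hT.1
  refine sInf_le fun σ => ?_
  rw [(D.fixingSubgroup_fixedField_stabilizer hT hd).1, mem_stabilizer]

theorem rank_reflexField_le (D : ShimuraDatum n) {T : Subgroup (GL (Fin n) ℂ)}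
    (hT : IsMaximalTorus T D.G) {d : ℕ} (hd : IsTorusOfDim T d) :
    Module.rank ℚ D.reflexField ≤ ((3 ^ (d ^ 2) : ℕ) : Cardinal) :=
  (LinearMap.rank_le_of_injective
    (IntermediateField.inclusion (D.reflexField_le_fixedField hT)).toLinearMap
    (IntermediateField.inclusion_injective (D.reflexField_le_fixedField hT))).trans
    (D.fixingSubgroup_fixedField_stabilizer hT hd).2

/-- The reflex field of a datum is contained in the reflex field of a subdatum: an automorphism that
stabilises the smaller class maps one of its elements into the larger class, which is one orbit. -/
theorem reflexField_le_of_isSubdatum {D' D : ShimuraDatum n} (h : D'.IsSubdatum D) :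
    D.reflexField ≤ D'.reflexField := by
  obtain ⟨T, hT⟩ := exists_isMaximalTorus D.isClosed
  obtain ⟨d, hd⟩ := hT.1
  refine le_sInf fun F hF x hx => ?_
  by_contra hxF
  obtain ⟨σ, hσ, hne⟩ := exists_mem_fixingSubgroup_ne F hxF
  have hsub : D'.cocharClass ⊆ D.cocharClass := by
    rintro _ ⟨k, hk, g, hg, rfl⟩
    exact ⟨k, h.2 hk, g, h.1 hg, rfl⟩
  obtain ⟨k, hk, -⟩ := D'.isConjClass
  have hk' := D'.mu_mem_cocharClass hk
  have hstab : σ ∈ D.stabilizer := by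
    refine D.mem_stabilizer_of_galoisAct_mem (hsub hk') (hsub ?_)
    rw [← (hF σ).1 hσ]
    exact Set.mem_image_of_mem _ hk'
  rw [← (D.fixingSubgroup_fixedField_stabilizer hT hd).1] at hstab
  exact hne ((IntermediateField.mem_fixingSubgroup_iff _ _).1 hstab x
    (D.reflexField_le_fixedField hT hx))

end ShimuraDatum

end ShimuraBound

theorem mainTheorem10 :
    (∃ d : ℕ → ℕ, ∀ (n : ℕ) (D : ShimuraBound.ShimuraDatum n) (r : ℕ),
      ShimuraBound.HasRank D.G r → Module.rank ℚ D.reflexField ≤ (d r : Cardinal)) ∧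
    (∀ (n : ℕ) (D : ShimuraBound.ShimuraDatum n), ∃ c : ℕ,
      ∀ D' : ShimuraBound.ShimuraDatum n, D'.IsSubdatum D →
        D.reflexField ≤ D'.reflexField ∧
          IntermediateField.relrank D.reflexField D'.reflexField ≤ (c : Cardinal)) := by
  refine ⟨⟨fun r => 3 ^ (r ^ 2), fun n D r ⟨T, hT, hr⟩ => D.rank_reflexField_le hT hr⟩,
    fun n D => ⟨3 ^ ((n ^ 2) ^ 2), fun D' h => ?_⟩⟩
  have hle := ShimuraBound.ShimuraDatum.reflexField_le_of_isSubdatum h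
  refine ⟨hle, ?_⟩
  obtain ⟨T, hT⟩ := ShimuraBound.exists_isMaximalTorus D'.isClosed
  obtain ⟨d, hd⟩ := hT.1
  have h1 : Module.rank ℚ D'.reflexField ≤ ((3 ^ ((n ^ 2) ^ 2) : ℕ) : Cardinal) :=
    (D'.rank_reflexField_le hT hd).trans (Nat.cast_le.2
      (Nat.pow_le_pow_right (by norm_num) (Nat.pow_le_pow_left hd.dim_le 2)))
  rw [← IntermediateField.rank_bot_mul_relrank hle] at h1
  exact (le_mul_of_one_le_left' (Cardinal.one_le_iff_pos.2 rank_pos)).trans h1
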